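/- **Theorem 5.3.** Let $(X,d,\mu)$ be a separable metric measure space, write $V_r(x)=V(x,r)=\mu(B(x,r))$, and assume $0<V(x,r)<\infty$ and the doubling condition $V(x,\lambda r)\le C\lambda^nV(x,r)$ for all $x\in X$, $r>0$, $\lambda\ge1$, with exponent $n>0$. Let $1\le p<2\le q\le\infty$, $\sigma_p=\frac1p-\frac12$, $N>n+[n/2]+1$ and $a=N-n$, where $[\cdot]$ is the integer part. Let $A$ be a bounded self-adjoint operator on $L^2(X,\mu)$ such that, for every integer $k\ge1$, the operator $A^k$ has a kernel $A^k(x,y)$ with $$|A^k(x,y)|\le \frac{C}{\max\big(V(x,k^{1/2}),V(y,k^{1/2})\big)}\Big(1+\frac{d(x,y)^2}{k}\Big)^{-N}\qquad(x,y\in X),$$ with $C$ independent of $k$. Let $-1\le R_1<R_2\le1$ and assume that the restriction type bounds $\mathrm{ST}^q_{p,2}(k^{1/2})$ hold for $A^k$ on $(R_1,R_2)$ uniformly in $k$: there is $C$ such that, for all $k\ge1$ and all bounded Borel functions $F:\mathbb R\to\mathbb C$ with $\operatorname{supp}F\subset(R_1,R_2)$, $$\big\|F(A^k)\,A^k\,V_{k^{1/2}}^{\sigma_p}\big\|_{p\to2}\le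 C\|F\|_q .$$ Let $s>n\sigma_p+\frac{n}{4[a]}$ and $\gamma>0$. Then there is a constant $C$ such that, for every integer $k\ge1$ and every bounded Borel function $F\in W^{s,q}(\mathbb R)$ with $\operatorname{supp}F\subset[1/4,1/2]$ and $$\big(1-\tfrac tk\big)^k\in[R_1+\gamma,\,R_2-\gamma]\quad\text{for all }t\in\operatorname{supp}F ,$$ one has $$\|F(k(I-A))\|_{p\to p}\le C\,\|F\|_{W^{s,q}} .$$ (The last condition on $F$ holds for all $k$ and all $F$ with $\operatorname{supp}F\subset[1/4,1/2]$ and a suitable $\gamma$, if $[\frac12,e^{-1/4}]\subset(R_1,R_2)$.) Here $\|F\|_{W^{s,q}}=\|(I-\frac{d^2}{dx^2})^{s/2}F\|_{L^q(\mathbb R)}$; for $q=\infty$, $\|F\|_\infty$ in the restriction bounds is the supremum of $|F|$, and an element $F$ of $W^{s,\infty}$ is taken to be its continuous representative. -/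

import Mathlib

open MeasureTheory Set
open scoped ENNReal NNReal CompactlySupported SchwartzMap ComplexInnerProductSpace

namespace SpectralMultiplier

/-! ### Borel functional calculus of a bounded self-adjoint operator -/

section BorelCalculus

variable {H : Type*} [NormedAddCommGroup H] [InnerProductSpace ℂ H] [CompleteSpace H]

/-- For a bounded self-adjoint `A` and a vector `x`, the positive linear functional
`f ↦ ⟪x, f(A) x⟫` on `C_c(ℝ)`, with `f(A)` given by the continuous functional calculus. -/
noncomputable def spectralFunctional (A : H →L[ℂ] H) (x : H) : C_c(ℝ, ℝ) →ₚ[ℝ] ℝ :=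
  PositiveLinearMap.mk₀
    { toFun := fun f => (⟪x, (cfc (fun t : ℝ => f t) A) x⟫).re
      map_add' := by
        intro f g
        have : cfc (fun t : ℝ => (f + g) t) A
            = cfc (fun t : ℝ => f t) A + cfc (fun t : ℝ => g t) A := by
          simpa using cfc_add (a := A) (fun t : ℝ => f t) (fun t : ℝ => g t)
            f.continuous.continuousOn g.continuous.continuousOn
        rw [this]
        simp
      map_smul' := by
        intro c f
        have : cfc (fun t : ℝ => (c • f) t) A = c • cfc (fun t : ℝ => f t) A := by
          simpa using cfc_smul (a := A) c (fun t : ℝ => f t) f.continuous.continuousOn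
        rw [this]
        simp [inner_smul_right_eq_smul] }
    (by
      intro f hf
      have h : (0 : H →L[ℂ] H) ≤ cfc (fun t : ℝ => f t) A := cfc_nonneg (fun t _ => hf t)
      rw [ContinuousLinearMap.nonneg_iff_isPositive] at h
      have := h.re_inner_nonneg_right x
      simpa using this)

/-- The scalar spectral measure `E ↦ ⟪x, 1_E(A) x⟫` of `A` at the vector `x`, obtained from the
continuous functional calculus by the Riesz-Markov-Kakutani theorem. -/
noncomputable def spectralMeasure (A : H →L[ℂ] H) (x : H) : Measure ℝ :=
  RealRMK.rieszMeasure (spectralFunctional A x)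

lemma integral_spectralMeasure (A : H →L[ℂ] H) (x : H) (f : C_c(ℝ, ℝ)) :
    ∫ t, f t ∂(spectralMeasure A x) = (⟪x, (cfc (fun t : ℝ => f t) A) x⟫).re :=
  RealRMK.integral_rieszMeasure (spectralFunctional A x) f

instance (A : H →L[ℂ] H) (x : H) : (spectralMeasure A x).Regular := by
  unfold spectralMeasure; infer_instance

lemma spectralMeasure_univ_le (A : H →L[ℂ] H) (x : H) :
    spectralMeasure A x univ ≤ ENNReal.ofReal (‖x‖ ^ 2) := by
  have hle : ∀ f : C_c(ℝ, ℝ), (∀ t, 0 ≤ f t ∧ f t ≤ 1) → spectralFunctional A x f ≤ ‖x‖ ^ 2 := by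
    intro f hf
    have h1 : ‖cfc (fun t : ℝ => f t) A‖ ≤ 1 :=
      norm_cfc_le zero_le_one fun t _ => by
        rw [Real.norm_eq_abs, abs_le]; exact ⟨by linarith [(hf t).1], (hf t).2⟩
    change (⟪x, (cfc (fun t : ℝ => f t) A) x⟫).re ≤ _
    calc _ ≤ ‖⟪x, (cfc (fun t : ℝ => f t) A) x⟫‖ := Complex.re_le_norm _
      _ ≤ ‖x‖ * ‖(cfc (fun t : ℝ => f t) A) x‖ := norm_inner_le_norm _ _
      _ ≤ ‖x‖ * (1 * ‖x‖) := by
          gcongr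
          exact (ContinuousLinearMap.le_opNorm _ _).trans (by gcongr)
      _ = ‖x‖ ^ 2 := by ring
  have hU : (univ : Set ℝ) = ⋃ n : ℕ, Icc (-(n : ℝ)) n := by
    symm
    rw [eq_univ_iff_forall]
    intro t
    obtain ⟨n, hn⟩ := exists_nat_ge |t|
    exact mem_iUnion.2 ⟨n, abs_le.1 hn⟩
  have hmono : Monotone fun n : ℕ => Icc (-(n : ℝ)) n := by
    intro m n hmn
    have : (m : ℝ) ≤ n := by exact_mod_cast hmn
    exact Icc_subset_Icc (by linarith) this
  rw [hU, hmono.measure_iUnion]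
  refine iSup_le fun n => ?_
  obtain ⟨g, hg1, -, hgc, hg2⟩ := exists_continuous_one_zero_of_isCompact
    (isCompact_Icc (a := -(n : ℝ)) (b := n)) (isClosed_empty (X := ℝ)) (disjoint_empty _)
  let f : C_c(ℝ, ℝ) := ⟨g, hgc⟩
  have hK : ∀ t ∈ Icc (-(n : ℝ)) n, f t = 1 := fun t ht => hg1 ht
  refine (RealRMK.rieszMeasure_le_of_eq_one (spectralFunctional A x) (f := f)
    (fun t => (hg2 t).1) isCompact_Icc hK).trans ?_
  exact ENNReal.ofReal_le_ofReal (hle f fun t => ⟨(hg2 t).1, (hg2 t).2⟩)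

instance (A : H →L[ℂ] H) (x : H) : IsFiniteMeasure (spectralMeasure A x) :=
  ⟨(spectralMeasure_univ_le A x).trans_lt ENNReal.ofReal_lt_top⟩

/-- Linear relations between quadratic forms `v ↦ ⟪v, T v⟫` pass to the spectral measures. -/
lemma sum_integral_spectralMeasure_eq_zero (A : H →L[ℂ] H) {F : ℝ → ℂ} (hF : Measurable F)
    {M : ℝ} (hM : ∀ t, ‖F t‖ ≤ M) {m : ℕ} (w : Fin m → ℝ) (v : Fin m → H)
    (h : ∀ T : H →L[ℂ] H, ∑ i, w i * (⟪v i, T (v i)⟫).re = 0) :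
    ∑ i, (w i : ℂ) * ∫ t, F t ∂(spectralMeasure A (v i)) = 0 := by
  have hint : ∀ (ν : Measure ℝ) [IsFiniteMeasure ν], Integrable F ν := fun ν _ =>
    Integrable.of_bound hF.aestronglyMeasurable M (Filter.Eventually.of_forall hM)
  have hintf : ∀ (f : C_c(ℝ, ℝ)) (ν : Measure ℝ) [IsFiniteMeasure ν],
      Integrable (fun t => f t) ν := fun f ν _ => f.continuous.integrable_of_hasCompactSupport f.2
  let P : Measure ℝ := ∑ i, (w i).toNNReal • spectralMeasure A (v i)
  let N : Measure ℝ := ∑ i, (-w i).toNNReal • spectralMeasure A (v i)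
  have hw : ∀ i, (w i) = ((w i).toNNReal : ℝ) - ((-w i).toNNReal : ℝ) := fun i => by
    rw [Real.coe_toNNReal', Real.coe_toNNReal']
    rcases le_total 0 (w i) with h0 | h0
    · rw [max_eq_left h0, max_eq_right (by linarith)]; ring
    · rw [max_eq_right h0, max_eq_left (by linarith)]; ring
  have key : P = N := by
    apply Measure.ext_of_integral_eq_on_compactlySupported
    intro f
    rw [integral_finsetSum_measure fun i _ => hintf f _,
      integral_finsetSum_measure fun i _ => hintf f _, ← sub_eq_zero, ← Finset.sum_sub_distrib]
    rw [← h (cfc (fun t : ℝ => f t) A)]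
    refine Finset.sum_congr rfl fun i _ => ?_
    rw [integral_smul_nnreal_measure, integral_smul_nnreal_measure, integral_spectralMeasure]
    conv_rhs => rw [hw i]
    simp only [NNReal.smul_def, smul_eq_mul]
    ring
  have h2 : ∫ t, F t ∂P = ∫ t, F t ∂N := by rw [key]
  rw [integral_finsetSum_measure fun i _ => hint _,
    integral_finsetSum_measure fun i _ => hint _, ← sub_eq_zero, ← Finset.sum_sub_distrib] at h2
  rw [← h2]
  refine Finset.sum_congr rfl fun i _ => ?_
  rw [integral_smul_nnreal_measure, integral_smul_nnreal_measure]
  conv_lhs => rw [hw i]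
  simp only [NNReal.smul_def, Complex.real_smul]
  push_cast
  ring

/-- Existence and uniqueness of the Borel functional calculus: for a bounded Borel `F` exactly one
bounded operator `T` satisfies `⟪x, T x⟫ = ∫ F dμ_x` for all `x`. -/
theorem existsUnique_borelCalculus (A : H →L[ℂ] H) {F : ℝ → ℂ} (hF : Measurable F)
    (hb : ∃ M : ℝ, ∀ t, ‖F t‖ ≤ M) :
    ∃! T : H →L[ℂ] H, ∀ x : H, ⟪x, T x⟫ = ∫ t, F t ∂(spectralMeasure A x) := by
  obtain ⟨M, hM⟩ := hb
  have hM0 : 0 ≤ M := (norm_nonneg _).trans (hM 0)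
  set Q : H → ℂ := fun x => ∫ t, F t ∂(spectralMeasure A x) with hQ
  have hQb : ∀ x, ‖Q x‖ ≤ M * ‖x‖ ^ 2 := fun x => by
    refine (norm_integral_le_of_norm_le_const (Filter.Eventually.of_forall hM)).trans ?_
    gcongr
    exact ENNReal.toReal_le_of_le_ofReal (by positivity) (spectralMeasure_univ_le A x)
  have hQsmul : ∀ (c : ℂ) (x : H), Q (c • x) = (‖c‖ ^ 2 : ℝ) * Q x := fun c x => by
    have := sum_integral_spectralMeasure_eq_zero A hF hM ![1, -‖c‖ ^ 2] ![c • x, x] (fun T => by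
      simp only [Fin.sum_univ_two, Matrix.cons_val_zero, Matrix.cons_val_one, map_smul,
        inner_smul_left, inner_smul_right, ← mul_assoc, Complex.mul_conj]
      rw [Complex.re_ofReal_mul, Complex.normSq_eq_norm_sq]; ring)
    simp only [Fin.sum_univ_two, Matrix.cons_val_zero, Matrix.cons_val_one] at this
    push_cast at this ⊢
    linear_combination this
  have hQneg : ∀ x, Q (-x) = Q x := fun x => by simpa using hQsmul (-1) x
  set D : H → H → ℂ := fun x y => (Q (x + y) - Q (x - y)) / 4 with hD
  have hDsymm : ∀ x y, D x y = D y x := fun x y => by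
    simp only [hD]; rw [add_comm, ← neg_sub y x, hQneg]
  have hDadd : ∀ x y z, D x (y + z) = D x y + D x z := fun x y z => by
    have := sum_integral_spectralMeasure_eq_zero A hF hM ![1, -1, -1, 1, -1, 1]
      ![x + (y + z), x - (y + z), x + y, x - y, x + z, x - z] (fun T => by
        simp [Fin.sum_univ_succ]
        ring)
    simp [Fin.sum_univ_succ] at this
    simp only [hD, hQ]
    linear_combination this / 4
  have hDsmul : ∀ (r : ℝ) x y, D x ((r : ℂ) • y) = r * D x y := fun r x y => by
    have := sum_integral_spectralMeasure_eq_zero A hF hM ![1, -1, -r, r]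
      ![x + (r : ℂ) • y, x - (r : ℂ) • y, x + y, x - y] (fun T => by
        simp [Fin.sum_univ_succ]
        ring)
    simp [Fin.sum_univ_succ] at this
    simp only [hD, hQ]
    linear_combination this / 4
  have hDI : ∀ x y, D (Complex.I • x) (Complex.I • y) = D x y := fun x y => by
    simp only [hD]
    rw [← smul_add, ← smul_sub, hQsmul, hQsmul]; simp
  have hDneg : ∀ x y, D x (-y) = - D x y := fun x y => by simpa using hDsmul (-1) x y
  have hII : ∀ y : H, Complex.I • Complex.I • y = -y := fun y => by
    rw [smul_smul, Complex.I_mul_I, neg_one_smul]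
  have hDI' : ∀ x y, D (Complex.I • x) y = - D x (Complex.I • y) := fun x y => by
    rw [← hDI x (Complex.I • y), hII, hDneg, neg_neg]
  set B : H → H → ℂ := fun x y => D x y - Complex.I * D x (Complex.I • y) with hB
  have hc : ∀ (c : ℂ) (y : H), c • y = (c.re : ℂ) • y + (c.im : ℂ) • Complex.I • y := fun c y => by
    rw [smul_smul, ← add_smul, Complex.re_add_im]
  have hBadd : ∀ x y z, B x (y + z) = B x y + B x z := fun x y z => by
    simp only [hB, smul_add, hDadd]; ring
  have hBadd' : ∀ x y z, B (x + y) z = B x z + B y z := fun x y z => by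
    simp only [hB]
    rw [hDsymm (x + y), hDsymm (x + y), hDadd, hDadd, hDsymm z, hDsymm z, hDsymm _ x, hDsymm _ y]
    ring
  have hBI : ∀ x y, B x (Complex.I • y) = Complex.I * B x y := fun x y => by
    simp only [hB, hII, hDneg]; linear_combination (D x (Complex.I • y)) * Complex.I_mul_I
  have hBI' : ∀ x y, B (Complex.I • x) y = - Complex.I * B x y := fun x y => by
    simp only [hB, hDI, hDI']; linear_combination (-D x (Complex.I • y)) * Complex.I_mul_I
  have hBr : ∀ (r : ℝ) x y, B x ((r : ℂ) • y) = r * B x y := fun r x y => by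
    simp only [hB]; rw [smul_comm Complex.I (r : ℂ) y, hDsmul, hDsmul]; ring
  have hBr' : ∀ (r : ℝ) x y, B ((r : ℂ) • x) y = r * B x y := fun r x y => by
    simp only [hB]
    rw [hDsymm, hDsymm _ (Complex.I • y), hDsmul, hDsmul, hDsymm y, hDsymm _ x]; ring
  have hBsmul : ∀ (c : ℂ) x y, B x (c • y) = c * B x y := fun c x y => by
    conv_rhs => rw [← Complex.re_add_im c]
    rw [hc, hBadd, hBr, hBr, hBI]; ring
  have hBsmul' : ∀ (c : ℂ) x y, B (c • x) y = (starRingEnd ℂ c) * B x y := fun c x y => by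
    have hcc : (starRingEnd ℂ) c = c.re - c.im * Complex.I := by
      apply Complex.ext <;> simp
    rw [hc, hBadd', hBr', hBr', hBI', hcc]; ring
  have hDb : ∀ x y, ‖x‖ ≤ 1 → ‖y‖ ≤ 1 → ‖D x y‖ ≤ 2 * M := fun x y hx hy => by
    simp only [hD]
    rw [norm_div]
    have h1 : ‖Q (x + y)‖ ≤ M * 2 ^ 2 := (hQb _).trans (by
      gcongr; exact (norm_add_le _ _).trans (by linarith))
    have h2 : ‖Q (x - y)‖ ≤ M * 2 ^ 2 := (hQb _).trans (by
      gcongr; exact (norm_sub_le _ _).trans (by linarith))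
    have h3 := norm_sub_le (Q (x + y)) (Q (x - y))
    rw [div_le_iff₀ (by simp)]
    simp; linarith
  have hBb1 : ∀ x y, ‖x‖ ≤ 1 → ‖y‖ ≤ 1 → ‖B x y‖ ≤ 4 * M := fun x y hx hy => by
    simp only [hB]
    refine (norm_sub_le _ _).trans ?_
    rw [norm_mul, Complex.norm_I, one_mul]
    have h1 := hDb x y hx hy
    have h2 := hDb x (Complex.I • y) hx (by rw [norm_smul, Complex.norm_I, one_mul]; exact hy)
    linarith
  have hBb : ∀ x y, ‖B x y‖ ≤ 4 * M * ‖x‖ * ‖y‖ := fun x y => by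
    rcases eq_or_ne x 0 with rfl | hx
    · have := hBsmul' 0 0 y
      simp at this; simp [this]
    rcases eq_or_ne y 0 with rfl | hy
    · have := hBsmul 0 x 0
      simp at this; simp [this]
    have hx' : ‖x‖ ≠ 0 := norm_ne_zero_iff.2 hx
    have hy' : ‖y‖ ≠ 0 := norm_ne_zero_iff.2 hy
    have h1 := hBb1 (((‖x‖⁻¹ : ℝ) : ℂ) • x) (((‖y‖⁻¹ : ℝ) : ℂ) • y)
      (by rw [norm_smul]; simp [hx']) (by rw [norm_smul]; simp [hy'])
    rw [hBr', hBr, norm_mul, norm_mul] at h1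
    simp only [Complex.norm_real, norm_inv, norm_norm] at h1
    calc ‖B x y‖ = ‖x‖ * ‖y‖ * (‖x‖⁻¹ * (‖y‖⁻¹ * ‖B x y‖)) := by field_simp
      _ ≤ ‖x‖ * ‖y‖ * (4 * M) := by gcongr
      _ = 4 * M * ‖x‖ * ‖y‖ := by ring
  let Bc : H →L⋆[ℂ] H →L[ℂ] ℂ :=
    (LinearMap.mk₂'ₛₗ (starRingEnd ℂ) (RingHom.id ℂ) B hBadd' hBsmul' hBadd hBsmul).mkContinuous₂
      (4 * M) hBb
  let S : H →L[ℂ] H := InnerProductSpace.continuousLinearMapOfBilin Bc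
  have hS : ∀ x y, ⟪S x, y⟫ = B x y := fun x y =>
    InnerProductSpace.continuousLinearMapOfBilin_apply Bc x y
  have hT : ∀ x, ⟪x, (ContinuousLinearMap.adjoint S) x⟫ = Q x := fun x => by
    rw [ContinuousLinearMap.adjoint_inner_right, hS]
    have e1 : D x x = Q x := by
      have h2 := hQsmul 2 x
      have h0 := hQsmul 0 x
      simp only [zero_smul, norm_zero] at h0
      simp only [hD]
      rw [← two_smul ℂ x, h2, sub_self, h0]; simp; ring
    have e2 : D x (Complex.I • x) = 0 := by
      have := hDI' x x
      rw [hDsymm] at this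
      linear_combination this / 2
    simp only [hB, e1, e2]; ring
  refine ⟨_, hT, fun T' hT' => ?_⟩
  have : ((T' : H →L[ℂ] H) : H →ₗ[ℂ] H) = (ContinuousLinearMap.adjoint S : H →L[ℂ] H) := by
    rw [← sub_eq_zero, ← inner_map_self_eq_zero]
    intro x
    have h1 := hT' x
    have h2 := hT x
    rw [← inner_conj_symm]
    simp [inner_sub_right, h1, h2, hQ]
  exact ContinuousLinearMap.coe_injective this

open Classical in
/-- The operator `F(A)` for a bounded self-adjoint `A` and a bounded Borel function `F`: the unique
bounded operator with `⟪x, F(A) x⟫ = ∫ F dμ_x` for every vector `x`, where `μ_x` is the spectral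
measure of `A` at `x`. (It exists by `existsUnique_borelCalculus`; for functions that are not
bounded Borel the value is irrelevant.) -/
noncomputable def borelCalculus (A : H →L[ℂ] H) (F : ℝ → ℂ) : H →L[ℂ] H :=
  if h : Measurable F ∧ ∃ M : ℝ, ∀ t, ‖F t‖ ≤ M then
    (existsUnique_borelCalculus A h.1 h.2).choose
  else 0

end BorelCalculus
/-! ### Sobolev norms on the line -/

/-- The symbol `(1 + (2πξ)²)^(s/2)` of `(I - d²/dx²)^(s/2)` for the Fourier transform
`𝓕 φ ξ = ∫ e^(-2πixξ) φ x dx`. -/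
noncomputable def besselSymbol (s : ℝ) : ℝ → ℝ :=
  fun ξ => (1 + (2 * Real.pi * ξ) ^ 2) ^ (s / 2)

/-- `G = (I - d²/dx²)^(s/2) F` in the sense of tempered distributions: the operator is moved to
the test function (its symbol is even, so it is its own transpose). -/
def IsBesselDerivative (s : ℝ) (F G : ℝ → ℂ) : Prop :=
  ∀ φ : 𝓢(ℝ, ℂ), ∫ x, G x * φ x
    = ∫ x, F x * (SchwartzMap.fourierMultiplierCLM ℂ (besselSymbol s) φ) x

/-- The norm `‖F‖_{W^{s,q}} = ‖(I - d²/dx²)^(s/2) F‖_q` of `F ∈ L^q(ℝ)`; it is `⊤` exactly when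
`F` does not belong to `W^{s,q}(ℝ)`. (There is at most one `G` up to null sets, so that the
infimum merely selects its norm.) -/
noncomputable def sobolevNorm (s : ℝ) (q : ℝ≥0∞) (F : ℝ → ℂ) : ℝ≥0∞ :=
  ⨅ (G : ℝ → ℂ) (_ : MemLp F q volume) (_ : MemLp G q volume) (_ : IsBesselDerivative s F G),
    eLpNorm G q volume

/-- The norm `‖F‖_q` of a Borel function on the line as it enters restriction estimates. For
`q = ∞` it is the supremum of `|F|` over all points, since `F` is applied to operators which may
have eigenvalues. -/
noncomputable def multiplierNorm (q : ℝ≥0∞) (F : ℝ → ℂ) : ℝ≥0∞ :=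
  if q = ⊤ then ⨆ t, ‖F t‖ₑ else eLpNorm F q volume

/-! ### Operators on a metric measure space -/

section MetricMeasure

variable {X : Type*} [MetricSpace X] [MeasurableSpace X]

/-- `V(x, r)`, the volume of the open ball of centre `x` and radius `r`. -/
noncomputable def vol (μ : Measure X) (x : X) (r : ℝ) : ℝ := μ.real (Metric.ball x r)

/-- The balls have positive finite volume, and `V(x, λr) ≤ C λ^n V(x, r)` for all `λ ≥ 1`: the
space is of homogeneous type with doubling exponent `n`. -/
structure IsDoubling (μ : Measure X) (n : ℝ) : Prop where
  ball_pos : ∀ (x : X) (r : ℝ), 0 < r → 0 < μ (Metric.ball x r)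
  ball_lt_top : ∀ (x : X) (r : ℝ), 0 < r → μ (Metric.ball x r) < ⊤
  exists_doubling : ∃ C : ℝ, 0 < C ∧ ∀ (x : X) (r : ℝ), 0 < r → ∀ l : ℝ, 1 ≤ l →
    vol μ x (l * r) ≤ C * l ^ n * vol μ x r

/-- `K` is the kernel of the operator `T` on `L²`:
`T f(x) = ∫ K(x, y) f(y) dμ(y)`, with an absolutely convergent integral, for almost all `x`. -/
def IsKernel (μ : Measure X) (T : Lp ℂ 2 μ →L[ℂ] Lp ℂ 2 μ) (K : X → X → ℂ) : Prop :=
  Measurable (Function.uncurry K) ∧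
    ∀ f : Lp ℂ 2 μ, ∀ᵐ x ∂μ, Integrable (fun y => K x y * f y) μ ∧ T f x = ∫ y, K x y * f y ∂μ

/-- The operator `T` has a kernel bounded by
`C / max(V(x, k^{1/2}), V(y, k^{1/2})) * (1 + d(x, y)² / k)^{-N}`. -/
def HasPolynomialKernelBound (μ : Measure X) (T : Lp ℂ 2 μ →L[ℂ] Lp ℂ 2 μ) (k : ℕ) (N C : ℝ) :
    Prop :=
  ∃ K : X → X → ℂ, IsKernel μ T K ∧ ∀ x y : X,
    ‖K x y‖ ≤ C * (1 / max (vol μ x (Real.sqrt k)) (vol μ y (Real.sqrt k)))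
      * (1 + dist x y ^ 2 / k) ^ (-N)

/-- `‖T‖_{p→p} ≤ M`, the norm being taken over `L² ∩ L^p`. For `p < ∞` this is the same as a bounded
extension of `T` to `L^p` with norm at most `M`. -/
def LpOperatorBound (μ : Measure X) (p : ℝ) (T : Lp ℂ 2 μ →L[ℂ] Lp ℂ 2 μ) (M : ℝ≥0∞) : Prop :=
  ∀ f : Lp ℂ 2 μ, MemLp f (ENNReal.ofReal p) μ →
    eLpNorm (T f) (ENNReal.ofReal p) μ ≤ M * eLpNorm f (ENNReal.ofReal p) μ

/-- The restriction type condition for the operator `T` at scale `τ` on the interval `(R₁, R₂)`,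
with constant `C`: every bounded Borel `F` with support in `(R₁, R₂)` satisfies
`‖F(T) T V_τ^σ f‖_2 ≤ C ‖F‖_q ‖f‖_p`, `σ = 1/p - 1/2`, for all `f ∈ L^p` with `V_τ^σ f ∈ L²`. -/
def RestrictionBound (μ : Measure X) (p : ℝ) (q : ℝ≥0∞) (τ R₁ R₂ : ℝ)
    (T : Lp ℂ 2 μ →L[ℂ] Lp ℂ 2 μ) (C : ℝ≥0) : Prop :=
  ∀ F : ℝ → ℂ, Measurable F → (∃ M : ℝ, ∀ t, ‖F t‖ ≤ M) → tsupport F ⊆ Ioo R₁ R₂ →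
    ∀ f : X → ℂ, MemLp f (ENNReal.ofReal p) μ →
      ∀ g : Lp ℂ 2 μ, (∀ᵐ x ∂μ, g x = ((vol μ x τ ^ (1 / p - 1 / 2) : ℝ) : ℂ) * f x) →
        eLpNorm (borelCalculus T F (T g)) 2 μ
          ≤ C * multiplierNorm q F * eLpNorm f (ENNReal.ofReal p) μ

end MetricMeasure

end SpectralMultiplier

/-! Put τ = √k, σ = σ_p and M = 2[N-n]. The hypothesis on N gives [N-n] > n/2, hence n < M ≤ 2(N-n).
The function F is split into Littlewood-Paley pieces F_j of frequency L = 2^j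
(`exists_littlewoodPaley`), with ‖F_j‖_q at most a constant times L^(-s) ‖F‖_{W^{s,q}}, and each
piece is multiplied by a smooth cutoff χ that equals one on the support of F and respects both
support conditions. It suffices that S = (F_j χ)(k(1-A)) has norm O(L^(-s) L^((1+1/M)nσ)) on L^p
(`IsDoubling.exists_smoothPiece_bound`): since σ ≤ 1/2, (1+1/M)nσ ≤ nσ + n/(4[N-n]) < s, and the
bounds form a convergent geometric series.

For one piece, localization (`IsDoubling.exists_localization`) reduces the L^p bound to functions f
carried by a ball B of radius r: because M > n, it is enough to bound (1 + d/r)^M S f in L² by K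
μ(B)^(-σ) ‖f‖_p, d being the distance to the centre of B. Two estimates are combined, with P of the
size of L^(-s) ‖F‖_{W^{s,q}}.

Near B: the substitution u = λ^k turns the restriction bound for A^k into ‖S f‖_2 ≲ P ‖V_τ^(-σ) f‖_p
(`RestrictionBound.eLpNorm_borelCalculus_le`).

Away from B: S = v(T)T, where T = A^l with l ∈ {k, k+1} odd and v is smooth, supported in [0,1] and
of frequency L (`exists_smooth_profile`). Let E be multiplication by the truncated distance to B.
Since E f = 0, E^M S f is the M-fold commutator of E with S, applied to f. Commuting T with E
multiplies its kernel by b(x) - b(y); the polynomial decay of the kernel pays for M such factors at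
the price τ each (`IsDoubling.exists_adPow_bound`). As e^{iT} is unitary, the i-th commutator of
e^{imT} grows only like (|m|τ)^i, and the Fourier series of v gives O(Q √L (Lτ)^i) for v(T), where Q
bounds |v| (`exists_operator_adPow_le`). The passage from L^q to sup norms, q ≥ 2, costs Q ≲ P √L,
so that d(·,B)^M S f has L² norm O(P L (Lτ)^M ‖V_τ^(-σ) f‖_p)
(`IsDoubling.exists_offDiagonal_bound`).

With r = τ L^(1+1/M) one has r^M = L (Lτ)^M, so at the scale r the two estimates agree, and by
doubling the replacement of V_τ^(-σ) by μ(B)^(-σ) costs (r/τ)^(nσ) = L^((1+1/M)nσ).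

Finally, the restriction bound applied to the remainder F - χ ΣF_j makes the sum of the pieces
converge in L² on functions of bounded support; Fatou's lemma and exhaustion by balls give the bound
for F (`RestrictionBound.lpOperatorBound_of_tendsto`). -/

namespace SpectralMultiplier

/-! ### Spectral measures and the Borel functional calculus. -/

section SpectralCalculus

variable {H : Type*} [NormedAddCommGroup H] [InnerProductSpace ℂ H] [CompleteSpace H]

lemma abs_le_norm_of_mem_spectrum {A : H →L[ℂ] H} {t : ℝ} (ht : t ∈ spectrum ℝ A) :
    |t| ≤ ‖A‖ := by
  have h := spectrum.norm_le_norm_mul_of_mem ht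
  have h1 : ‖(1 : H →L[ℂ] H)‖ ≤ 1 := ContinuousLinearMap.norm_id_le
  rw [Real.norm_eq_abs] at h
  nlinarith [norm_nonneg A]

/-- The trapezoidal function equal to one exactly on `[-R, R]`. -/
noncomputable def plateau (R : ℝ) : C_c(ℝ, ℝ) where
  toFun t := max 0 (1 - max 0 (|t| - R))
  continuous_toFun := by fun_prop
  hasCompactSupport' := by
    refine HasCompactSupport.of_support_subset_isCompact (isCompact_Icc (a := -(|R| + 1))
      (b := |R| + 1)) fun t ht => ?_
    rw [Function.mem_support] at ht
    rw [mem_Icc, ← abs_le]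
    by_contra hcon
    push Not at hcon
    apply ht
    refine max_eq_left ?_
    have := le_abs_self R
    have := le_max_right 0 (|t| - R)
    linarith

lemma plateau_apply (R t : ℝ) : plateau R t = max 0 (1 - max 0 (|t| - R)) := rfl

lemma plateau_eq_one {R t : ℝ} (h : |t| ≤ R) : plateau R t = 1 := by
  rw [plateau_apply, max_eq_left (by linarith : |t| - R ≤ 0)]; norm_num

lemma plateau_le_one (R t : ℝ) : plateau R t ≤ 1 := by
  rw [plateau_apply]
  exact max_le zero_le_one (by linarith [le_max_left 0 (|t| - R)])

lemma abs_le_of_plateau_eq_one {R t : ℝ} (h : plateau R t = 1) : |t| ≤ R := by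
  rw [plateau_apply] at h
  by_contra hc
  push Not at hc
  rw [max_eq_right (by linarith : 0 ≤ |t| - R)] at h
  have : max 0 (1 - (|t| - R)) < 1 := max_lt zero_lt_one (by linarith)
  linarith

/-- The plateau f at height `‖A‖` is one on the spectrum, so f(A) = 1 and f has integral ‖x‖², which
is at least the total mass. Hence 1 - f ≥ 0 has integral zero, and f is one only where |t| ≤ `‖A‖`.
-/
lemma ae_spectralMeasure_abs_le {A : H →L[ℂ] H} (hA : IsSelfAdjoint A) (x : H) :
    ∀ᵐ t ∂(spectralMeasure A x), |t| ≤ ‖A‖ := by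
  set f := plateau ‖A‖
  have hf1 : cfc (fun t : ℝ => f t) A = 1 := by
    rw [cfc_congr (g := fun _ => (1 : ℝ)) fun t ht =>
      plateau_eq_one (abs_le_norm_of_mem_spectrum ht), cfc_const_one ℝ A]
  have h1 : ∫ t, f t ∂(spectralMeasure A x) = ‖x‖ ^ 2 := by
    rw [integral_spectralMeasure, hf1, one_apply_eq_self, inner_self_eq_norm_sq_to_K]
    norm_cast
  have hfi : Integrable (fun t => f t) (spectralMeasure A x) :=
    f.continuous.integrable_of_hasCompactSupport f.2
  have h2 : ∫ t, (1 - f t) ∂(spectralMeasure A x) = 0 := by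
    refine le_antisymm ?_ (integral_nonneg fun t => sub_nonneg.2 (plateau_le_one _ _))
    rw [integral_sub (integrable_const 1) hfi, h1, integral_const, smul_eq_mul, mul_one,
      sub_nonpos]
    exact ENNReal.toReal_le_of_le_ofReal (by positivity) (spectralMeasure_univ_le A x)
  rw [integral_eq_zero_iff_of_nonneg (fun t => sub_nonneg.2 (plateau_le_one _ _))
    ((integrable_const 1).sub hfi)] at h2
  filter_upwards [h2] with t ht
  exact abs_le_of_plateau_eq_one (sub_eq_zero.1 ht).symm

lemma integral_spectralMeasure_of_continuous {A : H →L[ℂ] H} (hA : IsSelfAdjoint A) (x : H)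
    {g : ℝ → ℝ} (hg : Continuous g) :
    ∫ t, g t ∂(spectralMeasure A x) = (⟪x, (cfc g A) x⟫).re := by
  let f : C_c(ℝ, ℝ) := ⟨⟨fun t => g t * plateau ‖A‖ t, hg.mul (plateau ‖A‖).continuous⟩,
    (plateau ‖A‖).2.mul_left⟩
  have h1 : cfc g A = cfc (fun t => f t) A := cfc_congr fun t ht => by
    change g t = g t * _
    rw [plateau_eq_one (abs_le_norm_of_mem_spectrum ht), mul_one]
  rw [h1, ← integral_spectralMeasure]
  refine integral_congr_ae ?_
  filter_upwards [ae_spectralMeasure_abs_le hA x] with t ht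
  change g t = g t * _
  rw [plateau_eq_one ht, mul_one]

lemma integrable_spectralMeasure_of_continuous {A : H →L[ℂ] H} (hA : IsSelfAdjoint A) (x : H)
    {E : Type*} [NormedAddCommGroup E] {g : ℝ → E} (hg : Continuous g) :
    Integrable g (spectralMeasure A x) := by
  obtain ⟨C, hC⟩ := (isCompact_Icc (a := -‖A‖) (b := ‖A‖)).exists_bound_of_continuousOn
    hg.continuousOn
  refine Integrable.of_bound hg.aestronglyMeasurable C ?_
  filter_upwards [ae_spectralMeasure_abs_le hA x] with t ht
  exact hC t (abs_le.1 ht)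

/-- Both sides are finite measures on the line, so they may be compared on C_c functions, where the
claim is the composition rule of the continuous calculus. All substitutions u = λ^k and t = k(1-λ)
rest on this. -/
lemma spectralMeasure_cfc {A : H →L[ℂ] H} (hA : IsSelfAdjoint A) (x : H)
    {h : ℝ → ℝ} (hh : Continuous h) :
    spectralMeasure (cfc h A) x = (spectralMeasure A x).map h := by
  apply Measure.ext_of_integral_eq_on_compactlySupported
  intro f
  have h1 : ∫ t, f t ∂((spectralMeasure A x).map h) = ∫ t, f (h t) ∂(spectralMeasure A x) :=
    integral_map hh.aemeasurable f.continuous.aestronglyMeasurable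
  rw [integral_spectralMeasure, h1,
    integral_spectralMeasure_of_continuous hA x (g := fun t => f (h t))
      (f.continuous.comp hh),
    ← cfc_comp' (fun t => f t) h A f.continuous.continuousOn hh.continuousOn]

lemma spectralMeasure_pow {A : H →L[ℂ] H} (hA : IsSelfAdjoint A) (x : H) (k : ℕ) :
    spectralMeasure (A ^ k) x = (spectralMeasure A x).map (fun t => t ^ k) := by
  rw [← cfc_pow_id (R := ℝ) A k]
  exact spectralMeasure_cfc hA x (continuous_pow k)

lemma cfc_mul_sub_self {A : H →L[ℂ] H} (hA : IsSelfAdjoint A) (c : ℝ) :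
    cfc (fun t : ℝ => c * (1 - t)) A = (c : ℂ) • (1 - A) := by
  rw [cfc_const_mul c (fun t : ℝ => 1 - t) A, cfc_sub (fun _ : ℝ => (1 : ℝ)) (fun t => t) A,
    cfc_const_one ℝ A, cfc_id' ℝ A]
  rfl

lemma inner_apply_eq_apply_inner {A : H →L[ℂ] H} (hA : IsSelfAdjoint A) (x y : H) :
    ⟪x, A y⟫ = ⟪A x, y⟫ :=
  ((ContinuousLinearMap.isSelfAdjoint_iff_isSymmetric.1 hA) x y).symm

lemma inner_self_apply_eq_re {A : H →L[ℂ] H} (hA : IsSelfAdjoint A) (x : H) :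
    ⟪x, A x⟫ = ((⟪x, A x⟫).re : ℂ) := by
  refine (Complex.conj_eq_iff_re.1 ?_).symm
  rw [inner_conj_symm]
  exact (ContinuousLinearMap.isSelfAdjoint_iff_isSymmetric.1 hA) x x

lemma norm_sq_apply_eq {A : H →L[ℂ] H} (hA : IsSelfAdjoint A) (x : H) :
    ‖A x‖ ^ 2 = (⟪x, (A * A) x⟫).re := by
  rw [mul_apply_eq_comp, inner_apply_eq_apply_inner hA]
  exact (inner_self_eq_norm_sq (𝕜 := ℂ) _).symm

/-- On C_c functions this is ⟪A x, f(A) A x⟫ = ⟪x, A f(A) A x⟫. It converts the factor T in G(T) T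
into the weight t² of the spectral measure. -/
lemma lintegral_spectralMeasure_apply {A : H →L[ℂ] H} (hA : IsSelfAdjoint A) (x : H)
    {F : ℝ → ℝ≥0∞} (hF : Measurable F) :
    ∫⁻ t, F t ∂(spectralMeasure A (A x))
      = ∫⁻ t, ENNReal.ofReal (t ^ 2) * F t ∂(spectralMeasure A x) := by
  have hm : Measurable fun t : ℝ => ENNReal.ofReal (t ^ 2) := by fun_prop
  have h0 := lintegral_withDensity_eq_lintegral_mul (spectralMeasure A x) hm hF
  simp only [Pi.mul_apply] at h0
  rw [← h0]
  have hfin : IsFiniteMeasure ((spectralMeasure A x).withDensity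
      fun t => ENNReal.ofReal (t ^ 2)) :=
    isFiniteMeasure_withDensity_ofReal
      (integrable_spectralMeasure_of_continuous hA x (continuous_pow 2)).2
  congr 1
  apply Measure.ext_of_integral_eq_on_compactlySupported
  intro f
  rw [integral_withDensity_eq_integral_toReal_smul hm (by simp), integral_spectralMeasure]
  have hc : Continuous fun t : ℝ => (ENNReal.ofReal (t ^ 2)).toReal • f t := by
    simp only [ENNReal.toReal_ofReal (sq_nonneg _), smul_eq_mul]
    exact (continuous_pow 2).mul f.continuous
  rw [integral_spectralMeasure_of_continuous hA x hc]
  have h1 : cfc (fun t : ℝ => (ENNReal.ofReal (t ^ 2)).toReal • f t) A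
      = A * (cfc (fun t => f t) A) * A := by
    have e1 : A * cfc (fun t => f t) A = cfc (fun t => t * f t) A := by
      rw [cfc_mul (fun t => t) (fun t => f t) A continuous_id.continuousOn
        f.continuous.continuousOn, cfc_id' ℝ A]
    have e2 : cfc (fun t => t * f t) A * A = cfc (fun t => t * f t * t) A := by
      rw [cfc_mul (fun t => t * f t) (fun t => t) A (continuous_id.mul f.continuous).continuousOn
        continuous_id.continuousOn, cfc_id' ℝ A]
    rw [e1, e2]
    refine cfc_congr fun t _ => ?_
    simp only [ENNReal.toReal_ofReal (sq_nonneg t), smul_eq_mul]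
    ring
  rw [h1]
  simp only [mul_apply_eq_comp]
  rw [inner_apply_eq_apply_inner hA]

lemma inner_borelCalculus (A : H →L[ℂ] H) {F : ℝ → ℂ} (hF : Measurable F)
    (hb : ∃ M : ℝ, ∀ t, ‖F t‖ ≤ M) (x : H) :
    ⟪x, borelCalculus A F x⟫ = ∫ t, F t ∂(spectralMeasure A x) := by
  rw [borelCalculus, dif_pos ⟨hF, hb⟩]
  exact (existsUnique_borelCalculus A hF hb).choose_spec.1 x

lemma ext_inner_self {E : Type*} [NormedAddCommGroup E] [InnerProductSpace ℂ E] {S T : E →L[ℂ] E} (h : ∀ x, ⟪x, S x⟫ = ⟪x, T x⟫) : S = T := by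
  apply ContinuousLinearMap.coe_injective
  rw [← sub_eq_zero, ← inner_map_self_eq_zero]
  intro x
  rw [← inner_conj_symm]
  simp [inner_sub_right, h]

lemma eq_borelCalculus (A : H →L[ℂ] H) {F : ℝ → ℂ} (hF : Measurable F)
    (hb : ∃ M : ℝ, ∀ t, ‖F t‖ ≤ M) {S : H →L[ℂ] H}
    (h : ∀ x, ⟪x, S x⟫ = ∫ t, F t ∂(spectralMeasure A x)) : S = borelCalculus A F :=
  ext_inner_self fun x => by rw [h, inner_borelCalculus A hF hb]

lemma integrable_of_bounded {ν : Measure ℝ} [IsFiniteMeasure ν] {F : ℝ → ℂ} (hF : Measurable F)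
    (hb : ∃ M : ℝ, ∀ t, ‖F t‖ ≤ M) : Integrable F ν :=
  let ⟨M, hM⟩ := hb
  Integrable.of_bound hF.aestronglyMeasurable M (Filter.Eventually.of_forall hM)

lemma borelCalculus_add (A : H →L[ℂ] H) {F G : ℝ → ℂ} (hF : Measurable F)
    (hFb : ∃ M : ℝ, ∀ t, ‖F t‖ ≤ M) (hG : Measurable G) (hGb : ∃ M : ℝ, ∀ t, ‖G t‖ ≤ M) :
    borelCalculus A (fun t => F t + G t) = borelCalculus A F + borelCalculus A G := by
  symm
  obtain ⟨M, hM⟩ := hFb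
  obtain ⟨M', hM'⟩ := hGb
  refine eq_borelCalculus A (hF.add hG) ⟨M + M', fun t => (norm_add_le _ _).trans
    (add_le_add (hM t) (hM' t))⟩ fun x => ?_
  rw [add_apply, inner_add_right, inner_borelCalculus A hF ⟨M, hM⟩,
    inner_borelCalculus A hG ⟨M', hM'⟩, ← integral_add (integrable_of_bounded hF ⟨M, hM⟩)
    (integrable_of_bounded hG ⟨M', hM'⟩)]
  rfl

lemma borelCalculus_const_mul (A : H →L[ℂ] H) {F : ℝ → ℂ} (hF : Measurable F)
    (hFb : ∃ M : ℝ, ∀ t, ‖F t‖ ≤ M) (c : ℂ) :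
    borelCalculus A (fun t => c * F t) = c • borelCalculus A F := by
  symm
  obtain ⟨M, hM⟩ := hFb
  refine eq_borelCalculus A (hF.const_mul c) ⟨‖c‖ * M, fun t => ?_⟩ fun x => ?_
  · rw [norm_mul]; gcongr; exact hM t
  · rw [smul_apply, inner_smul_right, inner_borelCalculus A hF ⟨M, hM⟩,
      integral_const_mul]

lemma borelCalculus_sub (A : H →L[ℂ] H) {F G : ℝ → ℂ} (hF : Measurable F)
    (hFb : ∃ M : ℝ, ∀ t, ‖F t‖ ≤ M) (hG : Measurable G) (hGb : ∃ M : ℝ, ∀ t, ‖G t‖ ≤ M) :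
    borelCalculus A (fun t => F t - G t) = borelCalculus A F - borelCalculus A G := by
  have h := borelCalculus_add A hF hFb (hG.const_mul (-1)) (by
    obtain ⟨M, hM⟩ := hGb; exact ⟨M, fun t => by simpa using hM t⟩)
  rw [borelCalculus_const_mul A hG hGb] at h
  simpa [sub_eq_add_neg] using h

/-- Multiplicativity of the calculus is not used: T² ≤ M T follows from 0 ≤ T ≤ M alone, by
expanding ⟪y, T y⟫ ≥ 0 at y = x - M⁻¹ T x and bounding ⟪T x, T T x⟫ by M ‖T x‖². -/
lemma norm_sq_borelCalculus_nonneg_le (A : H →L[ℂ] H) {F : ℝ → ℝ} (hF : Measurable F)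
    (h0 : ∀ t, 0 ≤ F t) {M : ℝ} (hM : ∀ t, F t ≤ M) (x : H) :
    ‖borelCalculus A (fun t => (F t : ℂ)) x‖ ^ 2 ≤ M * ∫ t, F t ∂(spectralMeasure A x) := by
  set T := borelCalculus A (fun t => (F t : ℂ))
  have hFm : Measurable fun t => (F t : ℂ) := Complex.measurable_ofReal.comp hF
  have hFb : ∃ M : ℝ, ∀ t, ‖(F t : ℂ)‖ ≤ M := ⟨M, fun t => by
    rw [Complex.norm_real, Real.norm_of_nonneg (h0 t)]; exact hM t⟩
  have hT : ∀ y, ⟪y, T y⟫ = ((∫ t, F t ∂(spectralMeasure A y) : ℝ) : ℂ) := fun y => by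
    rw [inner_borelCalculus A hFm hFb, integral_complex_ofReal]
  have hM0 : 0 ≤ M := (h0 0).trans (hM 0)
  have hsa : IsSelfAdjoint T := by
    rw [ContinuousLinearMap.isSelfAdjoint_iff']
    refine ext_inner_self fun y => ?_
    rw [ContinuousLinearMap.adjoint_inner_right, ← inner_conj_symm, hT, Complex.conj_ofReal]
  have hle : ∀ y, ∫ t, F t ∂(spectralMeasure A y) ≤ M * ‖y‖ ^ 2 := fun y => by
    calc ∫ t, F t ∂(spectralMeasure A y) ≤ ∫ t, M ∂(spectralMeasure A y) :=
          integral_mono_of_nonneg (Filter.Eventually.of_forall h0) (integrable_const M)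
            (Filter.Eventually.of_forall hM)
      _ ≤ M * ‖y‖ ^ 2 := by
          rw [integral_const, smul_eq_mul, mul_comm]
          gcongr
          exact ENNReal.toReal_le_of_le_ofReal (by positivity) (spectralMeasure_univ_le A y)
  have hI : 0 ≤ ∫ t, F t ∂(spectralMeasure A x) := integral_nonneg h0
  rcases hM0.eq_or_lt with h | h
  · have hz : T = 0 := ext_inner_self fun y => by
      rw [hT]
      have : ∀ t, F t = 0 := fun t => le_antisymm (h ▸ hM t) (h0 t)
      simp [this]
    rw [hz]; simp [← h]
  have hq : 0 ≤ (⟪x - (M⁻¹ : ℂ) • T x, T (x - (M⁻¹ : ℂ) • T x)⟫).re := by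
    rw [hT]; exact integral_nonneg h0
  have hx1 : ⟪T x, T x⟫ = ((‖T x‖ ^ 2 : ℝ) : ℂ) := by
    rw [inner_self_eq_norm_sq_to_K]; norm_cast
  have hx2 : ⟪x, T (T x)⟫ = ((‖T x‖ ^ 2 : ℝ) : ℂ) := by
    rw [inner_apply_eq_apply_inner hsa, ← hx1]
  have key : ⟪x - (M⁻¹ : ℂ) • T x, T (x - (M⁻¹ : ℂ) • T x)⟫
      = (((∫ t, F t ∂(spectralMeasure A x)) - 2 * M⁻¹ * ‖T x‖ ^ 2
        + M⁻¹ ^ 2 * ∫ t, F t ∂(spectralMeasure A (T x)) : ℝ) : ℂ) := by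
    rw [map_sub, map_smul, inner_sub_left, inner_sub_right, inner_sub_right, inner_smul_left,
      inner_smul_left, inner_smul_right, inner_smul_right, hT, hT, hx1, hx2, ← Complex.ofReal_inv,
      Complex.conj_ofReal]
    push_cast
    ring
  rw [key, Complex.ofReal_re] at hq
  have h2 : M⁻¹ ^ 2 * ∫ t, F t ∂(spectralMeasure A (T x)) ≤ M⁻¹ ^ 2 * (M * ‖T x‖ ^ 2) := by
    gcongr; exact hle _
  have h3 : M⁻¹ ^ 2 * (M * ‖T x‖ ^ 2) = M⁻¹ * ‖T x‖ ^ 2 := by field_simp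
  have h4 : M⁻¹ * ‖T x‖ ^ 2 ≤ ∫ t, F t ∂(spectralMeasure A x) := by linarith
  rwa [inv_mul_le_iff₀ h] at h4

lemma norm_borelCalculus_real_le (A : H →L[ℂ] H) {F : ℝ → ℝ} (hF : Measurable F)
    {M : ℝ} (hM : ∀ t, |F t| ≤ M) (x : H) :
    ‖borelCalculus A (fun t => (F t : ℂ)) x‖
      ≤ 2 * √(M * ∫ t, |F t| ∂(spectralMeasure A x)) := by
  have hM0 : 0 ≤ M := (abs_nonneg _).trans (hM 0)
  have hi : Integrable (fun t => |F t|) (spectralMeasure A x) :=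
    Integrable.of_bound hF.abs.aestronglyMeasurable M (Filter.Eventually.of_forall fun t => by
      simpa using hM t)
  have aux : ∀ G : ℝ → ℝ, Measurable G → (∀ t, 0 ≤ G t) → (∀ t, G t ≤ |F t|) →
      ‖borelCalculus A (fun t => (G t : ℂ)) x‖ ≤ √(M * ∫ t, |F t| ∂(spectralMeasure A x)) := by
    intro G hG h0 h1
    refine Real.le_sqrt_of_sq_le ((norm_sq_borelCalculus_nonneg_le A hG h0
      (fun t => (h1 t).trans (hM t)) x).trans ?_)
    exact mul_le_mul_of_nonneg_left (integral_mono_of_nonneg (Filter.Eventually.of_forall h0) hi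
      (Filter.Eventually.of_forall h1)) hM0
  have hp : Measurable fun t => max (F t) 0 := hF.max measurable_const
  have hn : Measurable fun t => max (-F t) 0 := hF.neg.max measurable_const
  have bp : ∀ t, max (F t) 0 ≤ |F t| := fun t => max_le (le_abs_self _) (abs_nonneg _)
  have bn : ∀ t, max (-F t) 0 ≤ |F t| := fun t => max_le (neg_le_abs _) (abs_nonneg _)
  have hsub := borelCalculus_sub A (Complex.measurable_ofReal.comp hp)
    ⟨M, fun t => by
      simp only [Function.comp, Complex.norm_real]
      rw [Real.norm_of_nonneg (le_max_right _ _)]; exact (bp t).trans (hM t)⟩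
    (Complex.measurable_ofReal.comp hn)
    ⟨M, fun t => by
      simp only [Function.comp, Complex.norm_real]
      rw [Real.norm_of_nonneg (le_max_right _ _)]; exact (bn t).trans (hM t)⟩
  have e : (fun t => (F t : ℂ)) = fun t => (Complex.ofReal ∘ fun t => max (F t) 0) t
      - (Complex.ofReal ∘ fun t => max (-F t) 0) t := by
    funext t
    simp only [Function.comp, ← Complex.ofReal_sub]
    congr 1
    exact (max_zero_sub_max_neg_zero_eq_self (F t)).symm
  rw [e, hsub, sub_apply]
  refine (norm_sub_le _ _).trans ?_
  have h1 := aux _ hp (fun t => le_max_right _ _) bp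
  have h2 := aux _ hn (fun t => le_max_right _ _) bn
  simp only [Function.comp_def] at *
  linarith

/-- For uniformly bounded functions, convergence in L¹(μ_x) thus implies convergence of the
operators at x. This extends the isometry from continuous to Borel functions. -/
lemma norm_borelCalculus_le_sqrt (A : H →L[ℂ] H) {F : ℝ → ℂ} (hF : Measurable F)
    {M : ℝ} (hM : ∀ t, ‖F t‖ ≤ M) (x : H) :
    ‖borelCalculus A F x‖ ≤ 4 * √(M * ∫ t, ‖F t‖ ∂(spectralMeasure A x)) := by
  have hM0 : 0 ≤ M := (norm_nonneg _).trans (hM 0)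
  have hi : Integrable (fun t => ‖F t‖) (spectralMeasure A x) :=
    (integrable_of_bounded hF ⟨M, hM⟩).norm
  have hre : Measurable fun t => (F t).re := Complex.measurable_re.comp hF
  have him : Measurable fun t => (F t).im := Complex.measurable_im.comp hF
  have aux : ∀ G : ℝ → ℝ, Measurable G → (∀ t, |G t| ≤ ‖F t‖) →
      ‖borelCalculus A (fun t => (G t : ℂ)) x‖
        ≤ 2 * √(M * ∫ t, ‖F t‖ ∂(spectralMeasure A x)) := by
    intro G hG h1
    refine (norm_borelCalculus_real_le A hG (fun t => (h1 t).trans (hM t)) x).trans ?_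
    refine mul_le_mul_of_nonneg_left (Real.sqrt_le_sqrt (mul_le_mul_of_nonneg_left ?_ hM0))
      zero_le_two
    exact integral_mono_of_nonneg (Filter.Eventually.of_forall fun t => abs_nonneg _) hi
      (Filter.Eventually.of_forall h1)
  have b1 := aux _ hre (fun t => Complex.abs_re_le_norm _)
  have b2 := aux _ him (fun t => Complex.abs_im_le_norm _)
  have bd1 : ∃ M : ℝ, ∀ t, ‖(((F t).re : ℝ) : ℂ)‖ ≤ M := ⟨M, fun t => by
    rw [Complex.norm_real]; exact (Complex.abs_re_le_norm _).trans (hM t)⟩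
  have bd2 : ∃ M : ℝ, ∀ t, ‖(((F t).im : ℝ) : ℂ)‖ ≤ M := ⟨M, fun t => by
    rw [Complex.norm_real]; exact (Complex.abs_im_le_norm _).trans (hM t)⟩
  have e : F = fun t => (((F t).re : ℝ) : ℂ) + Complex.I * (((F t).im : ℝ) : ℂ) := by
    funext t; rw [mul_comm]; exact (Complex.re_add_im _).symm
  have m1 : Measurable fun t => (((F t).re : ℝ) : ℂ) := Complex.measurable_ofReal.comp hre
  have m2 : Measurable fun t => (((F t).im : ℝ) : ℂ) := Complex.measurable_ofReal.comp him
  have h := borelCalculus_add A m1 bd1 (m2.const_mul Complex.I) (by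
    obtain ⟨M', h'⟩ := bd2; exact ⟨M', fun t => by simpa using h' t⟩)
  rw [borelCalculus_const_mul A m2 bd2] at h
  have h3 : borelCalculus A F x = borelCalculus A (fun t => (((F t).re : ℝ) : ℂ)) x
      + Complex.I • borelCalculus A (fun t => (((F t).im : ℝ) : ℂ)) x := by
    conv_lhs => rw [e, h]
    rfl
  rw [h3]
  refine (norm_add_le _ _).trans ?_
  rw [norm_smul, Complex.norm_I, one_mul]
  linarith

/-- F(A) = C + iD with commuting self-adjoint C and D. The cross term in ‖C x + i D x‖² vanishes
because C D is self-adjoint, which makes ⟪C x, D x⟫ real. -/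
lemma norm_sq_borelCalculus_of_continuous {A : H →L[ℂ] H} (hA : IsSelfAdjoint A) {F : ℝ → ℂ}
    (hF : Continuous F) (hb : ∃ M : ℝ, ∀ t, ‖F t‖ ≤ M) (x : H) :
    ‖borelCalculus A F x‖ ^ 2 = ∫ t, ‖F t‖ ^ 2 ∂(spectralMeasure A x) := by
  have hre : Continuous fun t => (F t).re := Complex.continuous_re.comp hF
  have him : Continuous fun t => (F t).im := Complex.continuous_im.comp hF
  set C := cfc (fun t => (F t).re) A with hC
  set D := cfc (fun t => (F t).im) A with hD
  have hCs : IsSelfAdjoint C := cfc_predicate _ _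
  have hDs : IsSelfAdjoint D := cfc_predicate _ _
  have hcomm : C * D = D * C := cfc_commute_cfc _ _ A
  have e : C + Complex.I • D = borelCalculus A F := by
    refine eq_borelCalculus A hF.measurable hb fun y => ?_
    rw [add_apply, smul_apply, inner_add_right,
      inner_smul_right, inner_self_apply_eq_re hCs, inner_self_apply_eq_re hDs,
      ← integral_spectralMeasure_of_continuous hA y hre,
      ← integral_spectralMeasure_of_continuous hA y him,
      ← integral_complex_ofReal, ← integral_complex_ofReal, ← integral_const_mul, ← integral_add]
    · refine integral_congr_ae (Filter.Eventually.of_forall fun t => ?_)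
      simp only [mul_comm Complex.I, Complex.re_add_im]
    · exact integrable_spectralMeasure_of_continuous hA y (by fun_prop)
    · exact integrable_spectralMeasure_of_continuous hA y (by fun_prop)
  have hCC : C * C = cfc (fun t => (F t).re * (F t).re) A :=
    (cfc_mul _ _ A hre.continuousOn hre.continuousOn).symm
  have hDD : D * D = cfc (fun t => (F t).im * (F t).im) A :=
    (cfc_mul _ _ A him.continuousOn him.continuousOn).symm
  have h0 : (⟪C x, D x⟫).im = 0 := by
    have h1 : IsSelfAdjoint (C * D) := hCs.commute_iff hDs |>.1 hcomm
    have h2 := inner_self_apply_eq_re h1 x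
    rw [mul_apply_eq_comp, inner_apply_eq_apply_inner hCs] at h2
    have h3 := congrArg Complex.im h2
    rw [Complex.ofReal_im] at h3
    exact h3
  rw [← e, add_apply, smul_apply,
    norm_add_sq (𝕜 := ℂ), norm_smul, Complex.norm_I, one_mul, inner_smul_right, norm_sq_apply_eq hCs,
    norm_sq_apply_eq hDs, hCC, hDD,
    ← integral_spectralMeasure_of_continuous hA x (g := fun t => (F t).re * (F t).re) (hre.mul hre),
    ← integral_spectralMeasure_of_continuous hA x (g := fun t => (F t).im * (F t).im)
      (him.mul him)]
  have h4 : RCLike.re (Complex.I * ⟪C x, D x⟫) = 0 := by simp [h0]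
  rw [h4, mul_zero, add_zero, ← integral_add]
  · refine integral_congr_ae (Filter.Eventually.of_forall fun t => ?_)
    simp only [← Complex.normSq_eq_norm_sq, Complex.normSq_apply]
  · exact integrable_spectralMeasure_of_continuous hA x (by fun_prop)
  · exact integrable_spectralMeasure_of_continuous hA x (by fun_prop)

/-- Truncation of the real and imaginary parts of a complex number to `[-M, M]`. -/
noncomputable def clip (M : ℝ) (z : ℂ) : ℂ :=
  ⟨max (-M) (min M z.re), max (-M) (min M z.im)⟩

lemma continuous_clip (M : ℝ) : Continuous (clip M) := by
  have : clip M = fun z => ((max (-M) (min M z.re) : ℝ) : ℂ)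
      + ((max (-M) (min M z.im) : ℝ) : ℂ) * Complex.I := by
    funext z
    apply Complex.ext <;> simp [clip]
  rw [this]
  fun_prop

lemma norm_clip_le {M : ℝ} (hM : 0 ≤ M) (z : ℂ) : ‖clip M z‖ ≤ 2 * M := by
  refine (Complex.norm_le_abs_re_add_abs_im _).trans ?_
  have aux : ∀ t : ℝ, |max (-M) (min M t)| ≤ M := fun t => by
    rw [abs_le]
    exact ⟨le_max_left _ _, max_le (by linarith) (min_le_left _ _)⟩
  have h1 := aux z.re
  have h2 := aux z.im
  simp only [clip]
  linarith

lemma norm_sub_clip_le {M : ℝ} {w : ℂ} (hw : ‖w‖ ≤ M) (z : ℂ) :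
    ‖w - clip M z‖ ≤ 2 * ‖w - z‖ := by
  refine (Complex.norm_le_abs_re_add_abs_im _).trans ?_
  have aux : ∀ a t : ℝ, |a| ≤ M → |a - max (-M) (min M t)| ≤ |a - t| := fun a t ha => by
    have h1 : max (-M) (min M a) = a := by
      rw [min_eq_right (abs_le.1 ha).2, max_eq_right (abs_le.1 ha).1]
    conv_lhs => rw [← h1]
    refine (abs_max_sub_max_le_max _ _ _ _).trans ?_
    rw [sub_self, abs_zero]
    refine max_le (abs_nonneg _) ((abs_min_sub_min_le_max _ _ _ _).trans ?_)
    rw [sub_self, abs_zero]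
    exact max_le (abs_nonneg _) le_rfl
  have h1 := aux w.re z.re ((Complex.abs_re_le_norm w).trans hw)
  have h2 := aux w.im z.im ((Complex.abs_im_le_norm w).trans hw)
  have h3 := Complex.abs_re_le_norm (w - z)
  have h4 := Complex.abs_im_le_norm (w - z)
  simp only [clip, Complex.sub_re, Complex.sub_im] at *
  linarith

/-- The Borel functional calculus is isometric from `L²(μ_x)` to `H`. -/
theorem norm_sq_borelCalculus {A : H →L[ℂ] H} (hA : IsSelfAdjoint A) {F : ℝ → ℂ}
    (hF : Measurable F) (hb : ∃ M : ℝ, ∀ t, ‖F t‖ ≤ M) (x : H) :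
    ‖borelCalculus A F x‖ ^ 2 = ∫ t, ‖F t‖ ^ 2 ∂(spectralMeasure A x) := by
  obtain ⟨M, hM⟩ := hb
  have hM0 : 0 ≤ M := (norm_nonneg _).trans (hM 0)
  have hFi := integrable_of_bounded (ν := spectralMeasure A x) hF ⟨M, hM⟩
  -- C_c approximations in L¹(μ_x), clipped to stay uniformly bounded; clipping at most doubles the
  -- distance to F.
  have happ : ∀ n : ℕ, ∃ g : ℝ → ℂ, Continuous g ∧ (∀ t, ‖g t‖ ≤ 2 * M) ∧
      ∫ t, ‖F t - g t‖ ∂(spectralMeasure A x) ≤ 2 * (1 / (n + 1 : ℝ)) := by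
    intro n
    obtain ⟨g, hgc, hg1, hg2, hg3⟩ := hFi.exists_hasCompactSupport_integral_sub_le
      (Nat.one_div_pos_of_nat (α := ℝ) (n := n))
    refine ⟨fun t => clip M (g t), (continuous_clip M).comp hg2, fun t => norm_clip_le hM0 _, ?_⟩
    calc ∫ t, ‖F t - clip M (g t)‖ ∂(spectralMeasure A x)
        ≤ ∫ t, 2 * ‖F t - g t‖ ∂(spectralMeasure A x) :=
          integral_mono_of_nonneg (Filter.Eventually.of_forall fun t => norm_nonneg _)
            ((hFi.sub hg3).norm.const_mul 2)
            (Filter.Eventually.of_forall fun t => norm_sub_clip_le (hM t) _)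
      _ ≤ _ := by rw [integral_const_mul]; gcongr
  choose g hgc hgb hgi using happ
  have hlim : Filter.Tendsto (fun n : ℕ => 2 * (1 / (n + 1 : ℝ))) Filter.atTop (nhds 0) := by
    simpa using tendsto_one_div_add_atTop_nhds_zero_nat.const_mul (2 : ℝ)
  have hI : Filter.Tendsto (fun n => ∫ t, ‖F t - g n t‖ ∂(spectralMeasure A x)) Filter.atTop
      (nhds 0) :=
    squeeze_zero (fun n => integral_nonneg fun t => norm_nonneg _) hgi hlim
  have hsubb : ∀ n t, ‖F t - g n t‖ ≤ 3 * M := fun n t =>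
    (norm_sub_le _ _).trans (by linarith [hM t, hgb n t])
  have h1 : Filter.Tendsto (fun n => borelCalculus A (g n) x) Filter.atTop
      (nhds (borelCalculus A F x)) := by
    rw [tendsto_iff_norm_sub_tendsto_zero]
    have hb' : Filter.Tendsto (fun n => 4 * √(3 * M * ∫ t, ‖F t - g n t‖
        ∂(spectralMeasure A x))) Filter.atTop (nhds 0) := by
      have := ((hI.const_mul (3 * M)).sqrt).const_mul 4
      simpa using this
    refine squeeze_zero (fun n => norm_nonneg _) (fun n => ?_) hb'
    rw [norm_sub_rev, ← sub_apply, ← borelCalculus_sub A hF ⟨M, hM⟩ (hgc n).measurable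
      ⟨2 * M, hgb n⟩]
    exact norm_borelCalculus_le_sqrt A (hF.sub (hgc n).measurable) (hsubb n) x
  have h2 : Filter.Tendsto (fun n => ∫ t, ‖g n t‖ ^ 2 ∂(spectralMeasure A x)) Filter.atTop
      (nhds (∫ t, ‖F t‖ ^ 2 ∂(spectralMeasure A x))) := by
    rw [tendsto_iff_norm_sub_tendsto_zero]
    have hb' := hI.const_mul (3 * M)
    rw [mul_zero] at hb'
    have sqi : ∀ G : ℝ → ℂ, Measurable G → (∃ M : ℝ, ∀ t, ‖G t‖ ≤ M) →
        Integrable (fun t => ‖G t‖ ^ 2) (spectralMeasure A x) := fun G hG ⟨K, hK⟩ =>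
      Integrable.of_bound (hG.norm.pow_const 2).aestronglyMeasurable (K ^ 2)
        (Filter.Eventually.of_forall fun t => by
          rw [Real.norm_of_nonneg (by positivity)]
          exact pow_le_pow_left₀ (norm_nonneg _) (hK t) 2)
    refine squeeze_zero (fun n => norm_nonneg _) (fun n => ?_) hb'
    rw [← integral_sub (sqi _ (hgc n).measurable ⟨_, hgb n⟩) (sqi _ hF ⟨_, hM⟩),
      ← integral_const_mul]
    refine (norm_integral_le_integral_norm _).trans ?_
    refine integral_mono_of_nonneg (Filter.Eventually.of_forall fun t => norm_nonneg _)
      ((hFi.sub (integrable_of_bounded (hgc n).measurable ⟨_, hgb n⟩)).norm.const_mul _)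
      (Filter.Eventually.of_forall fun t => ?_)
    have e : ‖g n t‖ ^ 2 - ‖F t‖ ^ 2 = (‖g n t‖ + ‖F t‖) * (‖g n t‖ - ‖F t‖) := by ring
    change ‖‖g n t‖ ^ 2 - ‖F t‖ ^ 2‖ ≤ 3 * M * ‖F t - g n t‖
    rw [e, norm_mul, Real.norm_of_nonneg (by positivity), norm_sub_rev (F t)]
    exact mul_le_mul (by linarith [hM t, hgb n t]) (abs_norm_sub_norm_le _ _) (norm_nonneg _)
      (by positivity)
  refine tendsto_nhds_unique (h1.norm.pow 2) (h2.congr fun n => ?_)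
  rw [norm_sq_borelCalculus_of_continuous hA (hgc n) ⟨_, hgb n⟩]

lemma enorm_sq_borelCalculus {A : H →L[ℂ] H} (hA : IsSelfAdjoint A) {F : ℝ → ℂ}
    (hF : Measurable F) (hb : ∃ M : ℝ, ∀ t, ‖F t‖ ≤ M) (x : H) :
    ‖borelCalculus A F x‖ₑ ^ 2 = ∫⁻ t, ‖F t‖ₑ ^ 2 ∂(spectralMeasure A x) := by
  obtain ⟨M, hM⟩ := hb
  have h := norm_sq_borelCalculus hA hF ⟨M, hM⟩ x
  have hi : Integrable (fun t => ‖F t‖ ^ 2) (spectralMeasure A x) :=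
    Integrable.of_bound (hF.norm.pow_const 2).aestronglyMeasurable (M ^ 2)
      (Filter.Eventually.of_forall fun t => by
        rw [Real.norm_of_nonneg (by positivity)]
        exact pow_le_pow_left₀ (norm_nonneg _) (hM t) 2)
  rw [← ofReal_norm, ← ENNReal.ofReal_pow (norm_nonneg _), h,
    ofReal_integral_eq_lintegral_ofReal hi (Filter.Eventually.of_forall fun t => by positivity)]
  refine lintegral_congr fun t => ?_
  rw [ENNReal.ofReal_pow (norm_nonneg _), ofReal_norm]

lemma integral_pow_spectralMeasure {A : H →L[ℂ] H} (hA : IsSelfAdjoint A) (x : H) (l : ℕ) :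
    ∫ t, (t : ℂ) ^ l ∂(spectralMeasure A x) = ⟪x, (A ^ l) x⟫ := by
  have h := integral_spectralMeasure_of_continuous hA x (continuous_pow l)
  rw [cfc_pow_id (R := ℝ) A l] at h
  rw [inner_self_apply_eq_re (hA.pow l), ← h, ← integral_complex_ofReal]
  push_cast
  rfl

/-- The exponential series may be integrated term by term, since μ_x lives on |t| ≤ `‖A‖`. The
trailing factor t fits the form v(T) T in which multipliers are studied below. -/
lemma integral_exp_mul_spectralMeasure {A : H →L[ℂ] H} (hA : IsSelfAdjoint A) (x : H) (z : ℂ) :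
    ∫ t, Complex.exp (z * t) * t ∂(spectralMeasure A x)
      = ⟪x, (NormedSpace.exp (z • A) * A) x⟫ := by
  set F : ℕ → ℝ → ℂ := fun l t => (z ^ l / l.factorial) * (t : ℂ) ^ (l + 1) with hF
  have hFi : ∀ l, Integrable (F l) (spectralMeasure A x) := fun l =>
    integrable_spectralMeasure_of_continuous hA x (by fun_prop)
  have hsum : Summable fun l : ℕ => (‖z‖ * ‖A‖) ^ l / l.factorial * (‖A‖ * ‖x‖ ^ 2) :=
    (Real.summable_pow_div_factorial _).mul_right _
  have hnorm : Summable fun l => ∫ t, ‖F l t‖ ∂(spectralMeasure A x) := by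
    refine Summable.of_nonneg_of_le (fun l => integral_nonneg fun t => norm_nonneg _)
      (fun l => ?_) hsum
    calc ∫ t, ‖F l t‖ ∂(spectralMeasure A x)
        ≤ ∫ t, (‖z‖ * ‖A‖) ^ l / l.factorial * ‖A‖ ∂(spectralMeasure A x) := by
          refine integral_mono_ae (hFi l).norm (integrable_const _) ?_
          filter_upwards [ae_spectralMeasure_abs_le hA x] with t ht
          simp only [hF, norm_mul, norm_div, norm_pow, Complex.norm_natCast, Complex.norm_real,
            Real.norm_eq_abs]
          rw [pow_succ, mul_pow, ← mul_assoc]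
          have : |t| ^ l ≤ ‖A‖ ^ l := pow_le_pow_left₀ (abs_nonneg _) ht l
          rw [mul_div_right_comm]
          gcongr
      _ ≤ _ := by
          rw [integral_const, smul_eq_mul, mul_comm, mul_assoc]
          gcongr
          exact ENNReal.toReal_le_of_le_ofReal (by positivity) (spectralMeasure_univ_le A x)
  have h1 := hasSum_integral_of_summable_integral_norm hFi hnorm
  have h2 : ∀ t : ℝ, ∑' l, F l t = Complex.exp (z * t) * t := fun t => by
    have h := (NormedSpace.exp_series_hasSum_exp' (𝕂 := ℂ) (z * t)).mul_right (t : ℂ)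
    rw [← Complex.exp_eq_exp_ℂ] at h
    rw [← h.tsum_eq]
    refine tsum_congr fun l => ?_
    simp only [hF, smul_eq_mul]
    ring
  simp only [h2] at h1
  have h3 : HasSum (fun l : ℕ => ⟪x, (((l.factorial : ℂ)⁻¹ • (z • A) ^ l) * A) x⟫)
      ⟪x, (NormedSpace.exp (z • A) * A) x⟫ := by
    have h := (NormedSpace.exp_series_hasSum_exp' (𝕂 := ℂ) (z • A)).mul_right A
    have h' := h.mapL ((ContinuousLinearMap.apply ℂ H x))
    exact h'.mapL (innerSL ℂ x)
  have e : (fun l => ∫ t, F l t ∂(spectralMeasure A x))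
      = fun l : ℕ => ⟪x, (((l.factorial : ℂ)⁻¹ • (z • A) ^ l) * A) x⟫ := by
    funext l
    simp only [hF]
    rw [integral_const_mul, integral_pow_spectralMeasure hA, smul_pow, smul_smul, smul_mul_assoc,
      ← pow_succ, smul_apply, inner_smul_right]
    ring
  rw [e] at h1
  exact h1.unique h3

end SpectralCalculus

/-! ### Multiplication and restriction operators on L². -/

section MultiplicationOperators

variable {X : Type*} [MeasurableSpace X] {μ : Measure X}

lemma memLp_mul_of_bound {b : X → ℂ} (hb : Measurable b) {C : ℝ} (hC : ∀ x, ‖b x‖ ≤ C)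
    (f : Lp ℂ 2 μ) : MemLp (fun x => b x * f x) 2 μ :=
  (Lp.memLp f).of_le_mul (hb.aestronglyMeasurable.mul (Lp.aestronglyMeasurable f))
    (c := C) (Filter.Eventually.of_forall fun x => by rw [norm_mul]; gcongr; exact hC x)

/-- Multiplication by a bounded measurable function, as an operator on `L²`. -/
noncomputable def mulOp (μ : Measure X) (b : X → ℂ) (hb : Measurable b) (C : ℝ)
    (hC : ∀ x, ‖b x‖ ≤ C) : Lp ℂ 2 μ →L[ℂ] Lp ℂ 2 μ :=
  LinearMap.mkContinuous
    { toFun := fun f => (memLp_mul_of_bound hb hC f).toLp _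
      map_add' := fun f g => by
        apply Lp.ext
        filter_upwards [(memLp_mul_of_bound hb hC (f + g)).coeFn_toLp,
          (memLp_mul_of_bound hb hC f).coeFn_toLp, (memLp_mul_of_bound hb hC g).coeFn_toLp,
          Lp.coeFn_add f g, Lp.coeFn_add ((memLp_mul_of_bound hb hC f).toLp _)
            ((memLp_mul_of_bound hb hC g).toLp _)] with x h1 h2 h3 h4 h5
        rw [h1, h5, Pi.add_apply, h2, h3, h4, Pi.add_apply, mul_add]
      map_smul' := fun c f => by
        apply Lp.ext
        filter_upwards [(memLp_mul_of_bound hb hC (c • f)).coeFn_toLp,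
          (memLp_mul_of_bound hb hC f).coeFn_toLp, Lp.coeFn_smul c f,
          Lp.coeFn_smul c ((memLp_mul_of_bound hb hC f).toLp _)] with x h1 h2 h3 h4
        rw [h1, RingHom.id_apply, h4, Pi.smul_apply, h2, h3, Pi.smul_apply, smul_eq_mul,
          smul_eq_mul]
        ring }
    C (fun f => by
      refine Lp.norm_le_mul_norm_of_ae_le_mul ?_
      filter_upwards [(memLp_mul_of_bound hb hC f).coeFn_toLp] with x hx
      change ‖((memLp_mul_of_bound hb hC f).toLp _ : X → ℂ) x‖ ≤ _
      rw [hx, norm_mul]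
      gcongr
      exact hC x)

lemma mulOp_ae (b : X → ℂ) (hb : Measurable b) (C : ℝ) (hC : ∀ x, ‖b x‖ ≤ C) (f : Lp ℂ 2 μ) :
    ∀ᵐ x ∂μ, mulOp μ b hb C hC f x = b x * f x :=
  (memLp_mul_of_bound hb hC f).coeFn_toLp

/-- Restriction of an `L²` function to a measurable set. -/
noncomputable def restrictOp (μ : Measure X) (s : Set X) (hs : MeasurableSet s) :
    Lp ℂ 2 μ →L[ℂ] Lp ℂ 2 μ :=
  mulOp μ (s.indicator fun _ => 1) (measurable_const.indicator hs) 1 fun x => by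
    by_cases h : x ∈ s <;> simp [h]

lemma restrictOp_ae (s : Set X) (hs : MeasurableSet s) (f : Lp ℂ 2 μ) :
    ∀ᵐ x ∂μ, restrictOp μ s hs f x = s.indicator f x := by
  filter_upwards [mulOp_ae (s.indicator fun _ => 1) (measurable_const.indicator hs) 1 (fun x => by
    by_cases h : x ∈ s <;> simp [h]) f] with x hx
  rw [restrictOp, hx]
  by_cases h : x ∈ s <;> simp [h]

lemma eLpNorm_restrictOp (s : Set X) (hs : MeasurableSet s) (f : Lp ℂ 2 μ) (p : ℝ≥0∞) :
    eLpNorm (restrictOp μ s hs f) p μ = eLpNorm (s.indicator f) p μ :=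
  eLpNorm_congr_ae (restrictOp_ae s hs f)

lemma memLp_restrictOp (s : Set X) (hs : MeasurableSet s) (f : Lp ℂ 2 μ) {p : ℝ≥0∞}
    (hf : MemLp f p μ) : MemLp (restrictOp μ s hs f) p μ :=
  (memLp_congr_ae (restrictOp_ae s hs f)).2 (hf.indicator hs)

lemma tendsto_restrictOp {s : ℕ → Set X} (hs : ∀ i, MeasurableSet (s i)) (hmono : Monotone s)
    (hU : ⋃ i, s i = univ) (f : Lp ℂ 2 μ) :
    Filter.Tendsto (fun i => restrictOp μ (s i) (hs i) f) Filter.atTop (nhds f) := by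
  rw [Lp.tendsto_Lp_iff_tendsto_eLpNorm']
  have e : ∀ i, eLpNorm (⇑(restrictOp μ (s i) (hs i) f) - ⇑f) 2 μ
      = (∫⁻ x, ((s i)ᶜ.indicator (fun x => ‖f x‖ₑ ^ (2 : ℝ))) x ∂μ) ^ (1 / (2 : ℝ)) := by
    intro i
    rw [eLpNorm_eq_lintegral_rpow_enorm_toReal (by norm_num) (by norm_num)]
    simp only [ENNReal.toReal_ofNat]
    congr 1
    refine lintegral_congr_ae ?_
    filter_upwards [restrictOp_ae (s i) (hs i) f] with x hx
    rw [Pi.sub_apply, hx]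
    by_cases h : x ∈ s i <;> simp [h]
  simp only [e]
  have h0 : Filter.Tendsto (fun i => ∫⁻ x, ((s i)ᶜ.indicator (fun x => ‖f x‖ₑ ^ (2 : ℝ))) x ∂μ)
      Filter.atTop (nhds (∫⁻ _, 0 ∂μ)) := by
    refine tendsto_lintegral_of_dominated_convergence' (fun x => ‖f x‖ₑ ^ (2 : ℝ)) (fun i => ?_)
      (fun i => Filter.Eventually.of_forall fun x => indicator_le_self _ _ _) ?_
      (Filter.Eventually.of_forall fun x => ?_)
    · exact ((Lp.aestronglyMeasurable f).enorm.pow_const _).indicator (hs i).compl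
    · have := lintegral_rpow_enorm_lt_top_of_eLpNorm_lt_top (by norm_num) (by norm_num)
        (Lp.memLp f).2
      simpa using this.ne
    · obtain ⟨i, hi⟩ := mem_iUnion.1 (hU ▸ mem_univ x)
      refine tendsto_const_nhds.congr' ?_
      filter_upwards [Filter.eventually_ge_atTop i] with j hj
      simp [hmono hj hi]
  rw [lintegral_zero] at h0
  have := h0.ennrpow_const (1 / 2)
  rwa [ENNReal.zero_rpow_of_pos (by norm_num)] at this

/-- An L² convergent sequence has a subsequence converging almost everywhere, to which Fatou's lemma
applies. In this way L^p bounds pass from partial sums and restricted functions to their limits. -/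
lemma eLpNorm_le_of_tendsto_Lp {g : ℕ → Lp ℂ 2 μ} {g' : Lp ℂ 2 μ}
    (h : Filter.Tendsto g Filter.atTop (nhds g')) {p B : ℝ≥0∞}
    (hB : ∀ i, eLpNorm (g i) p μ ≤ B) : eLpNorm g' p μ ≤ B := by
  obtain ⟨ns, -, hns⟩ := (tendstoInMeasure_of_tendsto_Lp h).exists_seq_tendsto_ae
  exact Lp.eLpNorm_le_of_ae_tendsto (Filter.Eventually.of_forall fun i => hB (ns i))
    (fun i => Lp.aestronglyMeasurable _) hns

end MultiplicationOperators

/-! ### Doubling geometry and the localization principle. -/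

section Doubling

variable {X : Type*} [MetricSpace X] [MeasurableSpace X] {μ : Measure X} {n : ℝ}

lemma IsDoubling.ofReal_vol (hμ : IsDoubling μ n) (x : X) {r : ℝ} (hr : 0 < r) :
    ENNReal.ofReal (vol μ x r) = μ (Metric.ball x r) :=
  ENNReal.ofReal_toReal (hμ.ball_lt_top x r hr).ne

lemma IsDoubling.vol_pos (hμ : IsDoubling μ n) (x : X) {r : ℝ} (hr : 0 < r) : 0 < vol μ x r :=
  ENNReal.toReal_pos (hμ.ball_pos x r hr).ne' (hμ.ball_lt_top x r hr).ne

lemma IsDoubling.vol_le_vol (hμ : IsDoubling μ n) {x y : X} {r s : ℝ} (hs : 0 < s)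
    (h : r + dist x y ≤ s) : vol μ x r ≤ vol μ y s :=
  ENNReal.toReal_mono (hμ.ball_lt_top y s hs).ne
    (measure_mono (Metric.ball_subset_ball' h))

/-- The doubling condition, with the volumes at two centres compared. -/
lemma IsDoubling.exists_vol_le (hμ : IsDoubling μ n) : ∃ C : ℝ, 1 ≤ C ∧ ∀ (x y : X) (r s : ℝ),
    0 < r → r ≤ s → vol μ x s ≤ C * ((s + dist x y) / r) ^ n * vol μ y r := by
  obtain ⟨C, hC, h⟩ := hμ.exists_doubling
  refine ⟨max C 1, le_max_right _ _, fun x y r s hr hrs => ?_⟩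
  have h1 : 1 ≤ (s + dist x y) / r := by
    rw [le_div_iff₀ hr]; linarith [dist_nonneg (x := x) (y := y)]
  calc vol μ x s ≤ vol μ y ((s + dist x y) / r * r) := by
        refine hμ.vol_le_vol (by positivity) ?_
        rw [div_mul_cancel₀ _ hr.ne']
    _ ≤ C * ((s + dist x y) / r) ^ n * vol μ y r := h y r hr _ h1
    _ ≤ _ := by
        have := (hμ.vol_pos y hr).le
        gcongr
        exact le_max_left _ _

lemma IsDoubling.exists_measure_ball_le (hμ : IsDoubling μ n) : ∃ C : ℝ, 1 ≤ C ∧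
    ∀ (x y : X) (r s : ℝ), 0 < r → r ≤ s →
      μ (Metric.ball x s) ≤ ENNReal.ofReal (C * ((s + dist x y) / r) ^ n) * μ (Metric.ball y r) := by
  obtain ⟨C, hC, h⟩ := hμ.exists_vol_le
  refine ⟨C, hC, fun x y r s hr hrs => ?_⟩
  have : 0 ≤ C * ((s + dist x y) / r) ^ n := by
    have := hr.trans_le hrs
    positivity
  rw [← hμ.ofReal_vol x (hr.trans_le hrs), ← hμ.ofReal_vol y hr, ← ENNReal.ofReal_mul this]
  exact ENNReal.ofReal_le_ofReal (h x y r s hr hrs)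

lemma IsDoubling.sigmaFinite (hμ : IsDoubling μ n) : SigmaFinite μ := by
  rcases isEmpty_or_nonempty X with h | ⟨⟨x⟩⟩
  · have : μ = 0 := Measure.eq_zero_of_isEmpty μ
    rw [this]; infer_instance
  · refine ⟨⟨⟨fun i => Metric.ball x (i + 1), fun _ => trivial,
      fun i => hμ.ball_lt_top x _ (by positivity), ?_⟩⟩⟩
    rw [eq_univ_iff_forall]
    intro y
    obtain ⟨i, hi⟩ := exists_nat_ge (dist y x)
    exact mem_iUnion.2 ⟨i, Metric.mem_ball.2 (by linarith)⟩

lemma measurable_vol [TopologicalSpace.SeparableSpace X] [BorelSpace X] [SFinite μ] (r : ℝ) :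
    Measurable fun x => vol μ x r := by
  have : SecondCountableTopology X := UniformSpace.secondCountable_of_separable X
  have hs : MeasurableSet {z : X × X | dist z.2 z.1 < r} :=
    measurableSet_lt (measurable_snd.dist measurable_fst) measurable_const
  exact (measurable_measure_prodMk_left hs).ennreal_toReal

/-- Dyadic decomposition of the weight `(1 + t)^(-β)`. -/
lemma one_add_rpow_neg_le_tsum {β : ℝ} (hβ : 0 ≤ β) {t : ℝ} (ht : 0 ≤ t) :
    ENNReal.ofReal ((1 + t) ^ (-β)) ≤ ENNReal.ofReal (2 ^ β)
      * ∑' l : ℕ, ENNReal.ofReal (2 ^ (-β * l)) * {u : ℝ | u < 2 ^ l}.indicator 1 t := by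
  have hex : ∃ l : ℕ, t < 2 ^ l := pow_unbounded_of_one_lt t one_lt_two
  have key : ∃ l : ℕ, t < 2 ^ l ∧ (1 + t) ^ (-β) ≤ 2 ^ β * 2 ^ (-β * l) := by
    -- Minimality of l gives 2^(l-1) ≤ 1 + t; for l = 0 this reads 1/2 ≤ 1 + t.
    refine ⟨Nat.find hex, Nat.find_spec hex, ?_⟩
    have h1 : (2 : ℝ) ^ ((Nat.find hex : ℝ) - 1) ≤ 1 + t := by
      rcases Nat.eq_zero_or_pos (Nat.find hex) with h | h
      · rw [h]
        calc (2 : ℝ) ^ (((0 : ℕ) : ℝ) - 1) ≤ 1 :=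
              Real.rpow_le_one_of_one_le_of_nonpos one_le_two (by norm_num)
          _ ≤ 1 + t := by linarith
      · have h2 := Nat.find_min hex (Nat.sub_lt h one_pos)
        push Not at h2
        have e : ((Nat.find hex : ℝ) - 1) = ((Nat.find hex - 1 : ℕ) : ℝ) := by
          rw [Nat.cast_sub h]; simp
        rw [e, Real.rpow_natCast]
        linarith
    rw [← Real.rpow_add two_pos]
    calc (1 + t) ^ (-β) ≤ ((2 : ℝ) ^ ((Nat.find hex : ℝ) - 1)) ^ (-β) :=
          Real.rpow_le_rpow_of_nonpos (by positivity) h1 (by linarith)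
      _ = 2 ^ (β + -β * (Nat.find hex)) := by
          rw [← Real.rpow_mul two_pos.le]; congr 1; ring
  obtain ⟨l, hl, h⟩ := key
  calc ENNReal.ofReal ((1 + t) ^ (-β))
      ≤ ENNReal.ofReal (2 ^ β) * (ENNReal.ofReal (2 ^ (-β * l))
        * {u : ℝ | u < 2 ^ l}.indicator 1 t) := by
        rw [indicator_of_mem (show t ∈ {u : ℝ | u < 2 ^ l} from hl), Pi.one_apply, mul_one,
          ← ENNReal.ofReal_mul (by positivity)]
        exact ENNReal.ofReal_le_ofReal h
    _ ≤ _ := by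
        gcongr
        exact ENNReal.le_tsum (f := fun l : ℕ => ENNReal.ofReal (2 ^ (-β * l))
          * {u : ℝ | u < 2 ^ l}.indicator 1 t) l

lemma tsum_dyadic_ne_top {n c β : ℝ} (hβ : n < β) :
    ∑' l : ℕ, ENNReal.ofReal (2 ^ (-β * l)) * ENNReal.ofReal (c * (2 ^ l) ^ n) ≠ ⊤ := by
  have e : ∀ l : ℕ, ENNReal.ofReal (2 ^ (-β * l)) * ENNReal.ofReal (c * (2 ^ l) ^ n)
      = ENNReal.ofReal (c * ((2 : ℝ) ^ (n - β)) ^ l) := fun l => by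
    rw [← ENNReal.ofReal_mul (by positivity)]
    congr 1
    rw [← Real.rpow_natCast, ← Real.rpow_natCast, ← Real.rpow_mul two_pos.le,
      ← Real.rpow_mul two_pos.le, mul_left_comm, ← Real.rpow_add two_pos]
    congr 2
    ring
  simp only [e]
  refine Summable.tsum_ofReal_ne_top (Summable.mul_left _ ?_)
  exact summable_geometric_of_lt_one (by positivity)
    (Real.rpow_lt_one_of_one_lt_of_neg one_lt_two (by linarith))

lemma indicator_dist_div_lt {X : Type*} [MetricSpace X] {x y : X} {r : ℝ} (hr : 0 < r) (l : ℕ) :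
    ({u : ℝ | u < 2 ^ l}.indicator 1 (dist x y / r) : ℝ≥0∞)
      = (Metric.ball x (2 ^ l * r)).indicator 1 y := by
  have : dist x y / r < 2 ^ l ↔ dist y x < 2 ^ l * r := by
    rw [div_lt_iff₀ hr, dist_comm]
  by_cases h : dist y x < 2 ^ l * r
  · rw [indicator_of_mem (show dist x y / r ∈ {u : ℝ | u < 2 ^ l} from this.2 h),
      indicator_of_mem (Metric.mem_ball.2 h), Pi.one_apply, Pi.one_apply]
  · rw [indicator_of_notMem (show dist x y / r ∉ {u : ℝ | u < 2 ^ l} from fun h' => h (this.1 h')),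
      indicator_of_notMem (fun h' => h (Metric.mem_ball.1 h'))]

/-- On the dyadic ball of radius 2^l r the weight is of size 2^(-βl) and the measure grows like
2^(nl), so the series is geometric with ratio 2^(n-β) < 1. -/
lemma IsDoubling.exists_lintegral_weight_le [BorelSpace X] (hμ : IsDoubling μ n) {β : ℝ}
    (hn : 0 ≤ n) (hβ : n < β) :
    ∃ C : ℝ≥0, ∀ (x : X) (r : ℝ), 0 < r →
      ∫⁻ y, ENNReal.ofReal ((1 + dist x y / r) ^ (-β)) ∂μ ≤ C * μ (Metric.ball x r) := by
  obtain ⟨c, hc, h⟩ := hμ.exists_measure_ball_le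
  have hfin := tsum_dyadic_ne_top (c := c) hβ
  set S := ∑' l : ℕ, ENNReal.ofReal (2 ^ (-β * l)) * ENNReal.ofReal (c * (2 ^ l) ^ n)
  refine ⟨(ENNReal.ofReal (2 ^ β) * S).toNNReal, fun x r hr => ?_⟩
  rw [ENNReal.coe_toNNReal (ENNReal.mul_ne_top ENNReal.ofReal_ne_top hfin)]
  calc ∫⁻ y, ENNReal.ofReal ((1 + dist x y / r) ^ (-β)) ∂μ
      ≤ ∫⁻ y, ENNReal.ofReal (2 ^ β) * ∑' l : ℕ, ENNReal.ofReal (2 ^ (-β * l))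
        * (Metric.ball x (2 ^ l * r)).indicator 1 y ∂μ := by
        refine lintegral_mono fun y => ?_
        refine (one_add_rpow_neg_le_tsum (hn.trans hβ.le) (by positivity)).trans_eq ?_
        simp only [indicator_dist_div_lt hr]
    _ = ENNReal.ofReal (2 ^ β) * ∑' l : ℕ, ENNReal.ofReal (2 ^ (-β * l))
        * μ (Metric.ball x (2 ^ l * r)) := by
        have hm : ∀ l : ℕ, Measurable ((Metric.ball x (2 ^ l * r)).indicator (1 : X → ℝ≥0∞)) :=
          fun l => measurable_one.indicator Metric.isOpen_ball.measurableSet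
        rw [lintegral_const_mul _ (Measurable.tsum fun l => (hm l).const_mul _),
          lintegral_tsum fun l => ((hm l).const_mul _).aemeasurable]
        congr 2
        funext l
        rw [lintegral_const_mul _ (hm l), lintegral_indicator_one Metric.isOpen_ball.measurableSet]
    _ ≤ ENNReal.ofReal (2 ^ β) * ∑' l : ℕ, ENNReal.ofReal (2 ^ (-β * l))
        * ENNReal.ofReal (c * (2 ^ l) ^ n) * μ (Metric.ball x r) := by
        refine mul_le_mul_right (ENNReal.tsum_le_tsum fun l => ?_) _
        rw [mul_assoc]
        refine mul_le_mul_right ?_ _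
        refine (h x x r (2 ^ l * r) hr ?_).trans_eq ?_
        · exact le_mul_of_one_le_left hr.le (one_le_pow₀ one_le_two)
        · rw [dist_self, add_zero, mul_div_cancel_right₀ _ hr.ne']
    _ = _ := by rw [ENNReal.tsum_mul_right, mul_assoc]

/-- The discrete counterpart of the preceding integral bound: sums over an r-separated set behave
like integrals, because the number of its points in B(x, 2^l r) is O(2^(nl)). -/
lemma IsDoubling.exists_tsum_weight_le [BorelSpace X] (hμ : IsDoubling μ n) {β : ℝ}
    (hn : 0 ≤ n) (hβ : n < β) :
    ∃ C : ℝ≥0, ∀ (r : ℝ), 0 < r → ∀ S : Set X, S.Countable →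
      (S.PairwiseDisjoint fun z => Metric.ball z (r / 2)) → ∀ x : X,
        ∑' z : S, ENNReal.ofReal ((1 + dist x z / r) ^ (-β)) ≤ C := by
  obtain ⟨c, hc, h⟩ := hμ.exists_measure_ball_le
  have hfin := tsum_dyadic_ne_top (n := n) (β := β) hβ (c := c * 6 ^ n)
  set T := ∑' l : ℕ, ENNReal.ofReal (2 ^ (-β * l)) * ENNReal.ofReal (c * 6 ^ n * (2 ^ l) ^ n)
  refine ⟨(ENNReal.ofReal (2 ^ β) * T).toNNReal, fun r hr S hS hdisj x => ?_⟩
  rw [ENNReal.coe_toNNReal (ENNReal.mul_ne_top ENNReal.ofReal_ne_top hfin)]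
  -- A packing argument: the disjoint balls B(z, r/2) lie in B(x, 2·2^l r), and by doubling each
  -- carries a fixed proportion of its measure. The 6 comes from (2·2^l r + 2^l r)/(r/2) = 6·2^l.
  have hcount : ∀ l : ℕ, ∑' z : S, (Metric.ball x (2 ^ l * r)).indicator (1 : X → ℝ≥0∞) z
      ≤ ENNReal.ofReal (c * 6 ^ n * (2 ^ l) ^ n) := by
    intro l
    have h1l : (1 : ℝ) ≤ 2 ^ l := one_le_pow₀ one_le_two
    have hR : 0 < 2 * (2 ^ l * r) := by positivity
    set V := μ (Metric.ball x (2 * (2 ^ l * r)))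
    have hV0 : V ≠ 0 := (hμ.ball_pos x _ hR).ne'
    have hVt : V ≠ ⊤ := (hμ.ball_lt_top x _ hR).ne
    rw [← ENNReal.mul_le_mul_iff_left hV0 hVt, ← ENNReal.tsum_mul_right]
    have : Countable S := hS
    calc ∑' z : S, (Metric.ball x (2 ^ l * r)).indicator (1 : X → ℝ≥0∞) z * V
        ≤ ∑' z : S, ENNReal.ofReal (c * 6 ^ n * (2 ^ l) ^ n)
          * μ (Metric.ball (z : X) (r / 2) ∩ Metric.ball x (2 * (2 ^ l * r))) := by
          refine ENNReal.tsum_le_tsum fun z => ?_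
          by_cases hz : (z : X) ∈ Metric.ball x (2 ^ l * r)
          · rw [indicator_of_mem hz, Pi.one_apply, one_mul, inter_eq_left.2]
            · refine (h x z (r / 2) (2 * (2 ^ l * r)) (by positivity) (by nlinarith)).trans ?_
              refine mul_le_mul_left (ENNReal.ofReal_le_ofReal ?_) _
              rw [mul_assoc, ← Real.mul_rpow (by norm_num) (by positivity)]
              rw [Metric.mem_ball, dist_comm] at hz
              have h0 : 0 ≤ c := zero_le_one.trans hc
              gcongr
              rw [div_le_iff₀ (by positivity)]
              linarith
            · refine Metric.ball_subset_ball' ?_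
              rw [Metric.mem_ball] at hz
              nlinarith
          · rw [indicator_of_notMem hz, zero_mul]; exact zero_le
      _ = ENNReal.ofReal (c * 6 ^ n * (2 ^ l) ^ n)
          * μ (⋃ z : S, Metric.ball (z : X) (r / 2) ∩ Metric.ball x (2 * (2 ^ l * r))) := by
          rw [ENNReal.tsum_mul_left, measure_iUnion]
          · intro a b hab
            refine Disjoint.mono inter_subset_left inter_subset_left ?_
            exact hdisj a.2 b.2 fun h => hab (Subtype.ext h)
          · exact fun z => (Metric.isOpen_ball.inter Metric.isOpen_ball).measurableSet
      _ ≤ _ := by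
          exact mul_le_mul_right (measure_mono (iUnion_subset fun z => inter_subset_right)) _
  calc ∑' z : S, ENNReal.ofReal ((1 + dist x z / r) ^ (-β))
      ≤ ∑' z : S, ENNReal.ofReal (2 ^ β) * ∑' l : ℕ, ENNReal.ofReal (2 ^ (-β * l))
        * (Metric.ball x (2 ^ l * r)).indicator 1 (z : X) := by
        refine ENNReal.tsum_le_tsum fun z => ?_
        refine (one_add_rpow_neg_le_tsum (hn.trans hβ.le) (by positivity)).trans_eq ?_
        simp only [indicator_dist_div_lt hr]
    _ = ENNReal.ofReal (2 ^ β) * ∑' l : ℕ, ENNReal.ofReal (2 ^ (-β * l))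
        * ∑' z : S, (Metric.ball x (2 ^ l * r)).indicator 1 (z : X) := by
        rw [ENNReal.tsum_mul_left, ENNReal.tsum_comm]
        simp only [ENNReal.tsum_mul_left]
    _ ≤ _ := by
        exact mul_le_mul_right (ENNReal.tsum_le_tsum fun l => mul_le_mul_right (hcount l) _) _

/-- A point at distance at least r from all of S could be added to S, against maximality.
Countability holds because disjoint nonempty open sets in a separable space are countable in number.
-/
lemma exists_maximal_net {X : Type*} [MetricSpace X] [TopologicalSpace.SeparableSpace X] {r : ℝ} (hr : 0 < r) :
    ∃ S : Set X, S.Countable ∧ (S.PairwiseDisjoint fun z => Metric.ball z (r / 2)) ∧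
      ∀ x, ∃ z ∈ S, x ∈ Metric.ball z r := by
  obtain ⟨S, hS⟩ := zorn_subset {S : Set X | S.PairwiseDisjoint fun z => Metric.ball z (r / 2)}
    fun c hc hchain => ⟨⋃₀ c, (pairwiseDisjoint_sUnion hchain.directedOn).2 hc,
      fun s hs => subset_sUnion_of_mem hs⟩
  refine ⟨S, hS.1.countable_of_isOpen (fun _ _ => Metric.isOpen_ball)
    fun z _ => ⟨z, Metric.mem_ball_self (by positivity)⟩, hS.1, fun x => ?_⟩
  by_contra! hcon
  have hins : insert x S ∈ {S : Set X | S.PairwiseDisjoint fun z => Metric.ball z (r / 2)} := by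
    refine hS.1.insert fun z hz _ => Metric.ball_disjoint_ball ?_
    have := hcon z hz
    rw [Metric.mem_ball, not_lt] at this
    linarith
  have hx : x ∈ S := hS.le_of_ge hins (subset_insert x S) (mem_insert x S)
  exact hcon x hx (Metric.mem_ball_self hr)

/-- Localization principle: weighted `L^p → L²` bounds for functions supported in balls of radius
`r` give a bound on `L^p`. -/
theorem IsDoubling.exists_localization [TopologicalSpace.SeparableSpace X] [BorelSpace X]
    (hμ : IsDoubling μ n) (hn : 0 ≤ n) {p : ℝ} (hp1 : 1 ≤ p) (hp2 : p < 2) {M : ℕ}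
    (hM : n < M) :
    ∃ C : ℝ≥0, ∀ (r : ℝ), 0 < r → ∀ (S : Lp ℂ 2 μ →L[ℂ] Lp ℂ 2 μ) (K : ℝ≥0∞),
      (∀ (z : X) (f : Lp ℂ 2 μ), (∀ᵐ y ∂μ, y ∉ Metric.ball z r → f y = 0) →
        MemLp f (ENNReal.ofReal p) μ →
        ∫⁻ x, (ENNReal.ofReal ((1 + dist x z / r) ^ M) * ‖S f x‖ₑ) ^ (2 : ℝ) ∂μ
          ≤ (K * μ (Metric.ball z r) ^ (-(1 / p - 1 / 2))
            * eLpNorm f (ENNReal.ofReal p) μ) ^ (2 : ℝ)) →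
      LpOperatorBound μ p S (C * K) := by
  obtain ⟨C1, hC1⟩ := hμ.exists_lintegral_weight_le hn hM
  obtain ⟨C2, hC2⟩ := hμ.exists_tsum_weight_le hn hM
  have hp0 : 0 < p := by linarith
  have hP0 : ENNReal.ofReal p ≠ 0 := by simpa using hp0
  have hPt : ENNReal.ofReal p ≠ ⊤ := ENNReal.ofReal_ne_top
  have hPr : (ENNReal.ofReal p).toReal = p := ENNReal.toReal_ofReal hp0.le
  refine ⟨C2 ^ (1 - 1 / p) * C1 ^ (1 / p - 1 / 2), fun r hr S K hS f hf => ?_⟩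
  obtain ⟨Z, hZc, hZd, hZ⟩ := exists_maximal_net (X := X) hr
  have : Countable Z := hZc
  obtain ⟨e, he⟩ := exists_injective_nat Z
  -- Disjoint cells: each ball of the net, deprived of the balls of smaller index.
  set P : Z → Set X := fun z => Metric.ball (z : X) r \ ⋃ w : {w : Z // e w < e z},
    Metric.ball ((w : Z) : X) r with hP
  have hPm : ∀ z, MeasurableSet (P z) := fun z =>
    Metric.isOpen_ball.measurableSet.diff (MeasurableSet.iUnion fun _ =>
      Metric.isOpen_ball.measurableSet)
  have hPd : Pairwise (Function.onFun Disjoint P) := by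
    intro a b hab
    rcases lt_or_gt_of_ne (fun h => hab (he h)) with h | h
    · refine disjoint_left.2 fun x hx hx' => hx'.2 (mem_iUnion.2 ⟨⟨a, h⟩, hx.1⟩)
    · refine disjoint_left.2 fun x hx hx' => hx.2 (mem_iUnion.2 ⟨⟨b, h⟩, hx'.1⟩)
  have hPU : ∀ x, ∃ z, x ∈ P z := by
    intro x
    have hex : ∃ i, ∃ z : Z, e z = i ∧ x ∈ Metric.ball (z : X) r := by
      obtain ⟨z, hz, hxz⟩ := hZ x
      exact ⟨_, ⟨z, hz⟩, rfl, hxz⟩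
    classical
    obtain ⟨z, hz, hxz⟩ := Nat.find_spec hex
    refine ⟨z, hxz, fun hx => ?_⟩
    obtain ⟨⟨w, hw⟩, hxw⟩ := mem_iUnion.1 hx
    exact Nat.find_min hex (hz ▸ hw) ⟨w, rfl, hxw⟩
  have hfin : ∀ i : ℕ, {z : Z | e z < i}.Finite := fun i =>
    (finite_lt_nat i).preimage he.injOn
  set U : ℕ → Set X := fun i => ⋃ z ∈ (hfin i).toFinset, P z with hU
  have hUm : ∀ i, MeasurableSet (U i) := fun i => Finset.measurableSet_biUnion _ fun z _ => hPm z
  have hUmono : Monotone U := fun i j hij => biUnion_subset_biUnion_left fun z hz => by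
    simp only [Finite.coe_toFinset, Finite.mem_toFinset, mem_ofPred_eq] at *
    exact lt_of_lt_of_le hz hij
  have hUU : ⋃ i, U i = univ := by
    rw [eq_univ_iff_forall]
    intro x
    obtain ⟨z, hz⟩ := hPU x
    refine mem_iUnion.2 ⟨e z + 1, mem_biUnion (x := z) ?_ hz⟩
    simp
  -- It suffices to bound S on the restriction of f to finitely many cells, uniformly in their
  -- number.
  have hlim := (S.continuous.tendsto f).comp (tendsto_restrictOp hUm hUmono hUU f)
  refine eLpNorm_le_of_tendsto_Lp hlim fun i => ?_
  simp only [Function.comp]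
  set s := (hfin i).toFinset with hs
  set g : Z → Lp ℂ 2 μ := fun z => restrictOp μ (P z) (hPm z) f with hg
  have hsum : restrictOp μ (U i) (hUm i) f = ∑ z ∈ s, g z := by
    apply Lp.ext
    have hall : ∀ᵐ x ∂μ, ∀ z : Z, g z x = (P z).indicator f x :=
      ae_all_iff.2 fun z => restrictOp_ae (P z) (hPm z) f
    filter_upwards [restrictOp_ae (U i) (hUm i) f, hall, Lp.coeFn_fun_finsetSum s g]
      with x h1 h2 h3
    rw [h1, h3, Finset.sum_congr rfl fun z _ => h2 z,
      Finset.indicator_biUnion_apply s P fun a _ b _ hab => hPd hab]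
  rw [hsum, map_sum]
  set ω : Z → X → ℝ≥0∞ := fun z x => ENNReal.ofReal ((1 + dist x z / r) ^ M) with hω
  set ν : Z → X → ℝ≥0∞ := fun z x => ENNReal.ofReal ((1 + dist x z / r) ^ (-(M : ℝ))) with hν
  have hων : ∀ z x, ν z x = (ω z x)⁻¹ := fun z x => by
    simp only [hν, hω]
    rw [Real.rpow_neg (by positivity), Real.rpow_natCast, ENNReal.ofReal_inv_of_pos (by positivity)]
  have hω1 : ∀ z x, 1 ≤ ω z x := fun z x => by
    simp only [hω, ENNReal.one_le_ofReal]
    exact one_le_pow₀ (by have : 0 ≤ dist x z / r := by positivity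
                          linarith)
  have hωt : ∀ z x, ω z x ≠ ⊤ := fun z x => ENNReal.ofReal_ne_top
  have hω0 : ∀ z x, ω z x ≠ 0 := fun z x => (zero_lt_one.trans_le (hω1 z x)).ne'
  have hωm : ∀ z, Measurable (ω z) := fun z => by
    have : Continuous fun x : X => (1 + dist x z / r) ^ M := by fun_prop
    exact this.measurable.ennreal_ofReal
  have hνm : ∀ z, Measurable (ν z) := fun z => by
    simp only [funext (hων z)]; exact (hωm z).inv
  -- Hölder's inequality in the sum over the cells with weights ν_z = ω_z⁻¹, whose sum is at most C2
  -- at every point.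
  have hpt : ∀ x, (∑ z ∈ s, ‖S (g z) x‖ₑ) ^ p
      ≤ (C2 : ℝ≥0∞) ^ (p - 1) * ∑ z ∈ s, ν z x * (ω z x * ‖S (g z) x‖ₑ) ^ p := by
    intro x
    have h1 := ENNReal.inner_le_weight_mul_Lp_of_nonneg s hp1 (fun z => ν z x)
      (fun z => ω z x * ‖S (g z) x‖ₑ)
    have h2 : ∀ z, ν z x * (ω z x * ‖S (g z) x‖ₑ) = ‖S (g z) x‖ₑ := fun z => by
      rw [← mul_assoc, hων, ENNReal.inv_mul_cancel (hω0 z x) (hωt z x), one_mul]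
    simp only [h2] at h1
    have h3 : ∑ z ∈ s, ν z x ≤ C2 := (ENNReal.sum_le_tsum s).trans (hC2 r hr Z hZc hZd x)
    calc (∑ z ∈ s, ‖S (g z) x‖ₑ) ^ p
        ≤ ((∑ z ∈ s, ν z x) ^ (1 - p⁻¹)
          * (∑ z ∈ s, ν z x * (ω z x * ‖S (g z) x‖ₑ) ^ p) ^ p⁻¹) ^ p := by gcongr
      _ = (∑ z ∈ s, ν z x) ^ (p - 1) * ∑ z ∈ s, ν z x * (ω z x * ‖S (g z) x‖ₑ) ^ p := by
          rw [ENNReal.mul_rpow_of_nonneg _ _ hp0.le, ← ENNReal.rpow_mul, ← ENNReal.rpow_mul,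
            inv_mul_cancel₀ hp0.ne', ENNReal.rpow_one, sub_mul, inv_mul_cancel₀ hp0.ne', one_mul]
      _ ≤ _ := by
          gcongr
  have hSm : ∀ z, AEMeasurable (fun x => ‖S (g z) x‖ₑ) μ := fun z =>
    (Lp.aestronglyMeasurable _).enorm
  have hpσ : p * (1 / p - 1 / 2) = 1 - p / 2 := by field_simp
  have hterm : ∀ z, ∫⁻ x, ν z x * (ω z x * ‖S (g z) x‖ₑ) ^ p ∂μ
      ≤ (C1 : ℝ≥0∞) ^ (1 - p / 2) * K ^ p * ∫⁻ x in P z, ‖f x‖ₑ ^ p ∂μ := by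
    intro z
    have hsupp : ∀ᵐ y ∂μ, y ∉ Metric.ball (z : X) r → g z y = 0 := by
      filter_upwards [restrictOp_ae (P z) (hPm z) f] with y hy hyz
      simp only [hg]
      rw [hy, indicator_of_notMem fun h => hyz h.1]
    have hgp : MemLp (g z) (ENNReal.ofReal p) μ := memLp_restrictOp _ _ _ hf
    have hN : eLpNorm (g z) (ENNReal.ofReal p) μ ^ p = ∫⁻ x in P z, ‖f x‖ₑ ^ p ∂μ := by
      simp only [hg]
      rw [eLpNorm_restrictOp, eLpNorm_indicator_eq_eLpNorm_restrict (hPm z),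
        eLpNorm_eq_lintegral_rpow_enorm_toReal hP0 hPt, hPr, ← ENNReal.rpow_mul,
        one_div_mul_cancel hp0.ne', ENNReal.rpow_one]
    have hq : 1 ≤ 1 / (1 - p / 2) := by
      rw [le_div_iff₀ (by linarith)]; linarith
    -- Hölder's inequality from L^p to L² with exponents 2/(2-p) and 2/p. As ν ≤ 1, the first factor
    -- is at most (C1 V)^(1-p/2), and V^(1-p/2) cancels V^(-pσ) because pσ = 1 - p/2.
    have h1 := ENNReal.lintegral_mul_norm_pow_le (μ := μ)
      (f := fun x => ν z x ^ (1 / (1 - p / 2)))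
      (g := fun x => (ω z x * ‖S (g z) x‖ₑ) ^ (2 : ℝ))
      ((hνm z).pow_const _).aemeasurable (((hωm z).aemeasurable.mul (hSm z)).pow_const _)
      (p := 1 - p / 2) (q := p / 2) (by linarith) (by linarith) (by ring)
    have e1 : ∀ x, (ν z x ^ (1 / (1 - p / 2))) ^ (1 - p / 2)
        * ((ω z x * ‖S (g z) x‖ₑ) ^ (2 : ℝ)) ^ (p / 2)
        = ν z x * (ω z x * ‖S (g z) x‖ₑ) ^ p := fun x => by
      rw [← ENNReal.rpow_mul, ← ENNReal.rpow_mul, one_div_mul_cancel (by linarith),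
        ENNReal.rpow_one]
      congr 2
      ring
    simp only [e1] at h1
    refine h1.trans ?_
    set V := μ (Metric.ball (z : X) r) with hV
    have hV0 : V ≠ 0 := (hμ.ball_pos z r hr).ne'
    have hVt : V ≠ ⊤ := (hμ.ball_lt_top z r hr).ne
    have h2 : ∫⁻ x, ν z x ^ (1 / (1 - p / 2)) ∂μ ≤ C1 * V := by
      refine le_trans (lintegral_mono fun x => ?_) (hC1 z r hr)
      calc ν z x ^ (1 / (1 - p / 2)) ≤ ν z x ^ (1 : ℝ) := by
            refine ENNReal.rpow_le_rpow_of_exponent_ge ?_ hq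
            rw [hων]
            exact ENNReal.inv_le_one.2 (hω1 z x)
        _ = _ := by rw [ENNReal.rpow_one]; simp only [hν, dist_comm]
    calc _ ≤ (C1 * V) ^ (1 - p / 2) * ((K * V ^ (-(1 / p - 1 / 2))
            * eLpNorm (g z) (ENNReal.ofReal p) μ) ^ (2 : ℝ)) ^ (p / 2) := by
          gcongr
          · linarith
          · exact hS z (g z) hsupp hgp
      _ = (C1 : ℝ≥0∞) ^ (1 - p / 2) * V ^ (1 - p / 2) * (K ^ p * V ^ (-(1 - p / 2))
            * eLpNorm (g z) (ENNReal.ofReal p) μ ^ p) := by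
          rw [ENNReal.mul_rpow_of_nonneg _ _ (by linarith : 0 ≤ 1 - p / 2), ← ENNReal.rpow_mul,
            show 2 * (p / 2) = p by ring, ENNReal.mul_rpow_of_nonneg _ _ hp0.le,
            ENNReal.mul_rpow_of_nonneg _ _ hp0.le, ← ENNReal.rpow_mul V, neg_mul,
            mul_comm (1 / p - 1 / 2) p, hpσ]
      _ = (C1 : ℝ≥0∞) ^ (1 - p / 2) * K ^ p * (V ^ (1 - p / 2) * V ^ (-(1 - p / 2)))
            * eLpNorm (g z) (ENNReal.ofReal p) μ ^ p := by ring
      _ = _ := by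
          rw [← ENNReal.rpow_add _ _ hV0 hVt, add_neg_cancel, ENNReal.rpow_zero, mul_one, hN]
  have hfN : ∫⁻ x, ‖f x‖ₑ ^ p ∂μ = eLpNorm f (ENNReal.ofReal p) μ ^ p := by
    rw [eLpNorm_eq_lintegral_rpow_enorm_toReal hP0 hPt, hPr, ← ENNReal.rpow_mul,
        one_div_mul_cancel hp0.ne', ENNReal.rpow_one]
  have hmain : ∫⁻ x, ‖(∑ z ∈ s, S (g z) : Lp ℂ 2 μ) x‖ₑ ^ p ∂μ
      ≤ (C2 : ℝ≥0∞) ^ (p - 1) * ((C1 : ℝ≥0∞) ^ (1 - p / 2) * K ^ p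
        * eLpNorm f (ENNReal.ofReal p) μ ^ p) := by
    calc ∫⁻ x, ‖(∑ z ∈ s, S (g z) : Lp ℂ 2 μ) x‖ₑ ^ p ∂μ
        ≤ ∫⁻ x, (C2 : ℝ≥0∞) ^ (p - 1) * ∑ z ∈ s, ν z x * (ω z x * ‖S (g z) x‖ₑ) ^ p ∂μ := by
          refine lintegral_mono_ae ?_
          filter_upwards [Lp.coeFn_fun_finsetSum s fun z => S (g z)] with x hx
          rw [hx]
          refine le_trans ?_ (hpt x)
          gcongr
          exact enorm_sum_le s _
      _ = (C2 : ℝ≥0∞) ^ (p - 1) * ∑ z ∈ s, ∫⁻ x, ν z x * (ω z x * ‖S (g z) x‖ₑ) ^ p ∂μ := by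
          have hm : ∀ z, AEMeasurable (fun x => ν z x * (ω z x * ‖S (g z) x‖ₑ) ^ p) μ := fun z =>
            (hνm z).aemeasurable.mul (((hωm z).aemeasurable.mul (hSm z)).pow_const _)
          rw [lintegral_const_mul'' _ (Finset.aemeasurable_fun_sum s fun z _ => hm z),
            lintegral_finsetSum' s fun z _ => hm z]
      _ ≤ (C2 : ℝ≥0∞) ^ (p - 1) * ∑ z ∈ s, ((C1 : ℝ≥0∞) ^ (1 - p / 2) * K ^ p
            * ∫⁻ x in P z, ‖f x‖ₑ ^ p ∂μ) :=
          mul_le_mul_right (Finset.sum_le_sum fun z _ => hterm z) _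
      _ ≤ _ := by
          rw [← Finset.mul_sum, ← hfN, ← lintegral_biUnion_finset (fun a _ b _ hab => hPd hab)
            fun z _ => hPm z]
          refine mul_le_mul_right (mul_le_mul_right ?_ _) _
          exact setLIntegral_le_lintegral _ _
  have hpinv : 0 ≤ 1 / p := by positivity
  rw [eLpNorm_eq_lintegral_rpow_enorm_toReal hP0 hPt, hPr]
  refine (ENNReal.rpow_le_rpow hmain hpinv).trans_eq ?_
  rw [ENNReal.mul_rpow_of_nonneg _ _ hpinv, ENNReal.mul_rpow_of_nonneg _ _ hpinv,
    ENNReal.mul_rpow_of_nonneg _ _ hpinv, ← ENNReal.rpow_mul, ← ENNReal.rpow_mul,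
    ← ENNReal.rpow_mul, ← ENNReal.rpow_mul, mul_one_div_cancel hp0.ne', ENNReal.rpow_one,
    ENNReal.rpow_one, ENNReal.coe_mul, ENNReal.coe_rpow_of_nonneg, ENNReal.coe_rpow_of_nonneg]
  · have a1 : (p - 1) * (1 / p) = 1 - 1 / p := by field_simp
    have a2 : (1 - p / 2) * (1 / p) = 1 / p - 1 / 2 := by field_simp
    rw [a1, a2]
    ring
  · rw [sub_nonneg]
    exact one_div_le_one_div_of_le hp0 hp2.le
  · rw [sub_nonneg, div_le_one hp0]; exact hp1

end Doubling

/-! ### Iterated commutators in a Banach algebra. -/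

section Derivations

variable {𝔸 : Type*} [NormedRing 𝔸] [NormedAlgebra ℂ 𝔸]

/-- The inner derivation `S ↦ E S - S E`. -/
noncomputable def innerDer (E : 𝔸) : 𝔸 →L[ℂ] 𝔸 :=
  ContinuousLinearMap.mul ℂ 𝔸 E - (ContinuousLinearMap.mul ℂ 𝔸).flip E

lemma innerDer_apply (E S : 𝔸) : innerDer E S = E * S - S * E := by
  simp [innerDer]

lemma innerDer_mul (E S T : 𝔸) :
    innerDer E (S * T) = innerDer E S * T + S * innerDer E T := by
  simp only [innerDer_apply]
  noncomm_ring

/-- The iterated commutator `S ↦ [E, [E, …, [E, S]]]`. -/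
noncomputable def adPow (E : 𝔸) : ℕ → 𝔸 →L[ℂ] 𝔸
  | 0 => ContinuousLinearMap.id ℂ 𝔸
  | i + 1 => (adPow E i).comp (innerDer E)

lemma adPow_zero_apply (E S : 𝔸) : adPow E 0 S = S := rfl

lemma adPow_succ_apply (E S : 𝔸) (i : ℕ) : adPow E (i + 1) S = adPow E i (innerDer E S) := rfl

lemma adPow_succ_apply' (E S : 𝔸) (i : ℕ) : adPow E (i + 1) S = innerDer E (adPow E i S) := by
  induction i generalizing S with
  | zero => rfl
  | succ i ih => rw [adPow_succ_apply, ih, adPow_succ_apply]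

/-- Leibniz estimate for iterated commutators of a product; `ν` is a seminorm-like function, such as
the norm or `b ↦ ‖b f‖`. -/
lemma adPow_mul_le (E : 𝔸) {ν : 𝔸 → ℝ} (hadd : ∀ a b, ν (a + b) ≤ ν a + ν b)
    (hmul : ∀ a b, ν (a * b) ≤ ‖a‖ * ν b) (hν : ∀ a, 0 ≤ ν a) {s t : ℝ} (i : ℕ) :
    ∀ {a b : 𝔸} {α β : ℝ}, (∀ j ≤ i, ‖adPow E j a‖ ≤ α * s ^ j) →
      (∀ j ≤ i, ν (adPow E j b) ≤ β * t ^ j) →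
      ν (adPow E i (a * b)) ≤ α * β * (s + t) ^ i := by
  induction i with
  | zero =>
    intro a b α β ha hb
    have h1 := ha 0 le_rfl
    have h2 := hb 0 le_rfl
    simp only [adPow_zero_apply, pow_zero, mul_one] at h1 h2 ⊢
    exact (hmul a b).trans (mul_le_mul h1 h2 (hν b) ((norm_nonneg _).trans h1))
  | succ i ih =>
    intro a b α β ha hb
    rw [adPow_succ_apply, innerDer_mul, map_add]
    have h1 : ν (adPow E i (innerDer E a * b)) ≤ α * s * β * (s + t) ^ i :=
      ih (fun j hj => by
        rw [← adPow_succ_apply]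
        exact (ha (j + 1) (by omega)).trans_eq (by ring)) fun j hj => hb j (by omega)
    have h2 : ν (adPow E i (a * innerDer E b)) ≤ α * (β * t) * (s + t) ^ i :=
      ih (fun j hj => ha j (by omega)) fun j hj => by
        rw [← adPow_succ_apply]
        exact (hb (j + 1) (by omega)).trans_eq (by ring)
    calc _ ≤ α * s * β * (s + t) ^ i + α * (β * t) * (s + t) ^ i :=
          (hadd _ _).trans (add_le_add h1 h2)
      _ = _ := by ring

lemma norm_adPow_mul_le (E : 𝔸) {s t : ℝ} (i : ℕ) {a b : 𝔸} {α β : ℝ}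
    (ha : ∀ j ≤ i, ‖adPow E j a‖ ≤ α * s ^ j)
    (hb : ∀ j ≤ i, ‖adPow E j b‖ ≤ β * t ^ j) :
    ‖adPow E i (a * b)‖ ≤ α * β * (s + t) ^ i :=
  adPow_mul_le E norm_add_le norm_mul_le norm_nonneg i ha hb

lemma adPow_one (E : 𝔸) {i : ℕ} (hi : i ≠ 0) : adPow E i 1 = 0 := by
  obtain ⟨j, rfl⟩ := Nat.exists_eq_succ_of_ne_zero hi
  rw [Nat.succ_eq_add_one, adPow_succ_apply, innerDer_apply, mul_one, one_mul, sub_self,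
    map_zero]

/-- In the Leibniz estimate constants multiply while rates add, so m factors of rate s have rate m
s: the growth in m is polynomial apart from α^m. -/
lemma norm_adPow_pow_le (E : 𝔸) (h1 : ‖(1 : 𝔸)‖ ≤ 1) {s : ℝ} (hs : 0 ≤ s) {M : ℕ} {a : 𝔸}
    {α : ℝ} (ha : ∀ j ≤ M, ‖adPow E j a‖ ≤ α * s ^ j) (m : ℕ) :
    ∀ i ≤ M, ‖adPow E i (a ^ m)‖ ≤ α ^ m * (m * s) ^ i := by
  induction m with
  | zero =>
    intro i _
    rcases eq_or_ne i 0 with rfl | h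
    · simpa [adPow_zero_apply] using h1
    · rw [pow_zero, adPow_one E h, norm_zero]
      positivity
  | succ m ih =>
    intro i hi
    rw [pow_succ]
    refine (norm_adPow_mul_le E i (fun j hj => ih j (hj.trans hi))
      fun j hj => ha j (hj.trans hi)).trans_eq ?_
    push_cast
    ring

/-- In the termwise estimate the factor m^i from the m-th power is absorbed by m^i ≤ i! e^m, which
only replaces α by e α in the exponential. -/
lemma norm_adPow_exp_le [CompleteSpace 𝔸] (E : 𝔸) (h1 : ‖(1 : 𝔸)‖ ≤ 1) {s : ℝ} (hs : 0 ≤ s)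
    {M : ℕ} {a : 𝔸} {α : ℝ} (hα : 0 ≤ α) (ha : ∀ j ≤ M, ‖adPow E j a‖ ≤ α * s ^ j) (i : ℕ)
    (hi : i ≤ M) :
    ‖adPow E i (NormedSpace.exp a)‖
      ≤ i.factorial * Real.exp (Real.exp 1 * α) * s ^ i := by
  have h := (NormedSpace.exp_series_hasSum_exp' (𝕂 := ℂ) a).mapL (adPow E i)
  have hg : HasSum (fun m : ℕ => (Real.exp 1 * α) ^ m / m.factorial * (i.factorial * s ^ i))
      (Real.exp (Real.exp 1 * α) * (i.factorial * s ^ i)) := by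
    have := (NormedSpace.expSeries_div_hasSum_exp (𝔸 := ℝ) (Real.exp 1 * α)).mul_right
      (i.factorial * s ^ i)
    rwa [← Real.exp_eq_exp_ℝ] at this
  refine (h.norm_le_of_bounded hg fun m => ?_).trans_eq (by ring)
  rw [map_smul, norm_smul, norm_inv, Complex.norm_natCast]
  have h2 := norm_adPow_pow_le E h1 hs ha m i hi
  have h3 : (m : ℝ) ^ i ≤ i.factorial * Real.exp 1 ^ m := by
    have := Real.pow_div_factorial_le_exp (m : ℝ) (by positivity) i
    rw [div_le_iff₀ (by positivity)] at this
    rw [← Real.exp_nat_mul, mul_one]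
    linarith
  calc (m.factorial : ℝ)⁻¹ * ‖adPow E i (a ^ m)‖
      ≤ (m.factorial : ℝ)⁻¹ * (α ^ m * (m * s) ^ i) := by gcongr
    _ = (m.factorial : ℝ)⁻¹ * (α ^ m * s ^ i) * (m : ℝ) ^ i := by ring
    _ ≤ (m.factorial : ℝ)⁻¹ * (α ^ m * s ^ i) * (i.factorial * Real.exp 1 ^ m) := by gcongr
    _ = _ := by ring

/-- Iterated commutators with powers of a contraction `exp a` grow polynomially. -/
lemma norm_adPow_exp_nsmul_le [CompleteSpace 𝔸] (E : 𝔸) (h1 : ‖(1 : 𝔸)‖ ≤ 1) {s : ℝ}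
    (hs : 0 ≤ s) {M : ℕ} {a : 𝔸} {α : ℝ} (hα : 0 ≤ α)
    (ha : ∀ j ≤ M, ‖adPow E j a‖ ≤ α * s ^ j) (hexp : ‖NormedSpace.exp a‖ ≤ 1) (m i : ℕ)
    (hi : i ≤ M) :
    ‖adPow E i (NormedSpace.exp (m • a))‖
      ≤ (m * (M.factorial * Real.exp (Real.exp 1 * α) * s)) ^ i := by
  set c := M.factorial * Real.exp (Real.exp 1 * α)
  have hc : 1 ≤ c := by
    have h2 : (1 : ℝ) ≤ M.factorial := by exact_mod_cast M.factorial_pos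
    have h3 : 1 ≤ Real.exp (Real.exp 1 * α) := Real.one_le_exp (by positivity)
    exact one_le_mul_of_one_le_of_one_le h2 h3
  -- The leading constant must be exactly one, since it will be raised to the power m: at j = 0 this
  -- is the contraction property, and for j ≥ 1 the prefactor c ≥ 1 is moved into c^j.
  have hU : ∀ j ≤ M, ‖adPow E j (NormedSpace.exp a)‖ ≤ 1 * (c * s) ^ j := by
    intro j hj
    rcases eq_or_ne j 0 with rfl | h
    · simpa [adPow_zero_apply] using hexp
    · refine (norm_adPow_exp_le E h1 hs hα ha j hj).trans ?_
      rw [one_mul, mul_pow]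
      have h4 : (j.factorial : ℝ) ≤ M.factorial := by exact_mod_cast Nat.factorial_le hj
      calc _ ≤ c * s ^ j :=
            mul_le_mul_of_nonneg_right (mul_le_mul_of_nonneg_right h4 (Real.exp_pos _).le)
              (pow_nonneg hs j)
        _ ≤ c ^ j * s ^ j := by gcongr; exact le_self_pow₀ hc h
  have := norm_adPow_pow_le E h1 (by positivity) hU m i hi
  rw [one_pow, one_mul] at this
  have : NormedAlgebra ℚ 𝔸 := NormedAlgebra.restrictScalars ℚ ℂ 𝔸
  rwa [NormedSpace.exp_nsmul]

end Derivations

/-! ### Commutators with unitary groups. -/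

section HilbertSpace

variable {H : Type*} [NormedAddCommGroup H] [InnerProductSpace ℂ H] [CompleteSpace H]

lemma norm_one_operator_le {H : Type*} [NormedAddCommGroup H] [InnerProductSpace ℂ H] :
    ‖(1 : H →L[ℂ] H)‖ ≤ 1 := ContinuousLinearMap.norm_id_le

lemma norm_exp_I_smul_le {T : H →L[ℂ] H} (hT : IsSelfAdjoint T) (c : ℝ) :
    ‖NormedSpace.exp ((Complex.I * c) • T)‖ ≤ 1 := by
  set U := NormedSpace.exp ((Complex.I * c) • T)
  have h1 : star U * U = 1 := by
    have e : star ((Complex.I * c) • T) = -((Complex.I * c) • T) := by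
      rw [star_smul, hT.star_eq, ← neg_smul]
      congr 1
      simp
    have e' : star U = NormedSpace.exp (-((Complex.I * c) • T)) := by
      rw [← e, NormedSpace.star_exp]
    have : NormedAlgebra ℚ (H →L[ℂ] H) := NormedAlgebra.restrictScalars ℚ ℂ _
    rw [e', ← NormedSpace.exp_add_of_commute (Commute.neg_left rfl), neg_add_cancel,
      NormedSpace.exp_zero]
  have h2 := CStarRing.norm_star_mul_self (x := U)
  rw [h1] at h2
  have := norm_one_operator_le (H := H)
  nlinarith [norm_nonneg U]

lemma norm_adPow_exp_int_le (E : H →L[ℂ] H) {T : H →L[ℂ] H} (hT : IsSelfAdjoint T) {s : ℝ}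
    (hs : 0 ≤ s) {M : ℕ} {α : ℝ} (hα : 0 ≤ α)
    (ha : ∀ j ≤ M, ‖adPow E j T‖ ≤ α * s ^ j) (m : ℤ) (i : ℕ) (hi : i ≤ M) :
    ‖adPow E i (NormedSpace.exp ((Complex.I * m) • T))‖
      ≤ (|(m : ℝ)| * (M.factorial * Real.exp (Real.exp 1 * α) * s)) ^ i := by
  have aux : ∀ c : ℝ, |c| = 1 → ∀ l : ℕ,
      ‖adPow E i (NormedSpace.exp (l • ((Complex.I * c) • T)))‖
      ≤ (l * (M.factorial * Real.exp (Real.exp 1 * α) * s)) ^ i := fun c hc l =>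
    norm_adPow_exp_nsmul_le E norm_one_operator_le hs hα (fun j hj => by
      rw [map_smul, norm_smul, norm_mul, Complex.norm_I, one_mul, Complex.norm_real,
        Real.norm_eq_abs, hc, one_mul]
      exact ha j hj) (norm_exp_I_smul_le hT c) l i hi
  rcases Int.eq_nat_or_neg m with ⟨l, rfl | rfl⟩
  · have := aux 1 abs_one l
    rw [← Nat.cast_smul_eq_nsmul ℂ, smul_smul] at this
    simpa [mul_comm] using this
  · have := aux (-1) (by simp) l
    rw [← Nat.cast_smul_eq_nsmul ℂ, smul_smul] at this
    simpa [mul_comm] using this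

/-- All terms of the commutator with a factor E on the right of S vanish on f. With E the distance
to a ball carrying f, commutator bounds become off-diagonal decay of S f. -/
lemma adPow_apply_of_apply_eq_zero {E : H →L[ℂ] H} {f : H} (hf : E f = 0)
    (S : H →L[ℂ] H) (i : ℕ) : adPow E i S f = (E ^ i) (S f) := by
  induction i with
  | zero => rfl
  | succ i ih =>
    rw [adPow_succ_apply', innerDer_apply, sub_apply, mul_apply_eq_comp, mul_apply_eq_comp, hf, map_zero, sub_zero, ih,
      pow_succ']
    rfl

end HilbertSpace

/-! ### Kernels of commutators and Schur type estimates. -/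

section Kernels

variable {X : Type*} [MeasurableSpace X] {μ : Measure X}

lemma IsKernel.innerDer {T : Lp ℂ 2 μ →L[ℂ] Lp ℂ 2 μ} {K : X → X → ℂ} (hK : IsKernel μ T K)
    {b : X → ℂ} (hb : Measurable b) {C : ℝ} (hC : ∀ x, ‖b x‖ ≤ C) :
    IsKernel μ (innerDer (mulOp μ b hb C hC) T) fun x y => (b x - b y) * K x y := by
  refine ⟨((hb.comp measurable_fst).sub (hb.comp measurable_snd)).mul hK.1, fun f => ?_⟩
  have h0 := mulOp_ae b hb C hC f
  filter_upwards [hK.2 f, hK.2 (mulOp μ b hb C hC f), mulOp_ae b hb C hC (T f),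
    Lp.coeFn_sub (mulOp μ b hb C hC (T f)) (T (mulOp μ b hb C hC f))] with x h1 h2 h3 h4
  have e1 : Integrable (fun y => K x y * (b y * f y)) μ :=
    h2.1.congr (h0.mono fun y hy => by simp only [hy])
  have e2 : T (mulOp μ b hb C hC f) x = ∫ y, K x y * (b y * f y) ∂μ := by
    rw [h2.2]
    exact integral_congr_ae (h0.mono fun y hy => by simp only [hy])
  have e3 : ∀ y, (b x - b y) * K x y * f y = b x * (K x y * f y) - K x y * (b y * f y) :=
    fun y => by ring
  simp only [e3]
  refine ⟨(h1.1.const_mul _).sub e1, ?_⟩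
  rw [integral_sub (h1.1.const_mul _) e1, integral_const_mul, ← h1.2, ← e2, ← h3, innerDer_apply]
  exact h4

lemma IsKernel.adPow {T : Lp ℂ 2 μ →L[ℂ] Lp ℂ 2 μ} {K : X → X → ℂ} (hK : IsKernel μ T K)
    {b : X → ℂ} (hb : Measurable b) {C : ℝ} (hC : ∀ x, ‖b x‖ ≤ C) (i : ℕ) :
    IsKernel μ (adPow (mulOp μ b hb C hC) i T)
      fun x y => (b x - b y) ^ i * K x y := by
  induction i with
  | zero => simpa [adPow_zero_apply] using hK
  | succ i ih =>
    have := ih.innerDer hb hC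
    rw [adPow_succ_apply']
    convert this using 3
    ring

/-- The Hölder step of the Schur type estimate. -/
lemma lintegral_kernel_mul_sq_le {k v g : X → ℝ≥0∞} (hk : Measurable k) (hv : Measurable v)
    (hg : Measurable g) (hkv : ∀ y, v y * k y ≤ 1) {C : ℝ≥0∞} (hC : ∫⁻ y, k y ∂μ ≤ C) {p : ℝ}
    (hp1 : 1 ≤ p) (hp2 : p ≤ 2) :
    (∫⁻ y, k y * (v y ^ (1 / p - 1 / 2) * g y) ∂μ) ^ (2 : ℝ)
      ≤ (∫⁻ y, g y ^ p * k y ∂μ) * ((∫⁻ y, g y ^ p ∂μ) ^ ((2 - p) / p) * C ^ ((2 * p - 2) / p)) := by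
  have hp0 : 0 < p := by linarith
  have hσ0 : 0 ≤ 1 / p - 1 / 2 := by
    rw [sub_nonneg]; exact one_div_le_one_div_of_le hp0 hp2
  have hb0 : 0 ≤ (2 * p - 2) / p := div_nonneg (by linarith) hp0.le
  have ha0 : 0 ≤ (2 - p) / p := div_nonneg (by linarith) hp0.le
  -- Cauchy-Schwarz after splitting k v^σ g as (g^p k)^(1/2) (g^(2-p) v^(2σ) k)^(1/2), with σ = 1/p
  -- - 1/2.
  have h2 := ENNReal.lintegral_mul_norm_pow_le (μ := μ) (f := fun y => g y ^ p * k y)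
    (g := fun y => g y ^ (2 - p) * (v y ^ (2 * (1 / p - 1 / 2)) * k y))
    ((hg.pow_const p).mul hk).aemeasurable
    ((hg.pow_const _).mul ((hv.pow_const _).mul hk)).aemeasurable
    (p := 1 / 2) (q := 1 / 2) (by norm_num) (by norm_num) (by norm_num)
  have e2 : ∀ y, (g y ^ p * k y) ^ (1 / 2 : ℝ)
      * (g y ^ (2 - p) * (v y ^ (2 * (1 / p - 1 / 2)) * k y)) ^ (1 / 2 : ℝ)
      = k y * (v y ^ (1 / p - 1 / 2) * g y) := fun y => by
    rw [ENNReal.mul_rpow_of_nonneg _ _ (by norm_num), ENNReal.mul_rpow_of_nonneg _ _ (by norm_num),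
      ENNReal.mul_rpow_of_nonneg _ _ (by norm_num), ← ENNReal.rpow_mul, ← ENNReal.rpow_mul,
      ← ENNReal.rpow_mul]
    have e3 : g y ^ (p * (1 / 2)) * g y ^ ((2 - p) * (1 / 2)) = g y := by
      rw [← ENNReal.rpow_add_of_nonneg _ _ (by linarith) (by linarith)]
      conv_rhs => rw [← ENNReal.rpow_one (g y)]
      congr 1; ring
    have e4 : k y ^ (1 / 2 : ℝ) * k y ^ (1 / 2 : ℝ) = k y := by
      rw [← ENNReal.rpow_add_of_nonneg _ _ (by norm_num) (by norm_num)]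
      norm_num
    have e5 : 2 * (1 / p - 1 / 2) * (1 / 2) = 1 / p - 1 / 2 := by ring
    rw [e5]
    calc _ = (g y ^ (p * (1 / 2)) * g y ^ ((2 - p) * (1 / 2)))
          * (k y ^ (1 / 2 : ℝ) * k y ^ (1 / 2 : ℝ)) * v y ^ (1 / p - 1 / 2) := by ring
      _ = _ := by rw [e3, e4]; ring
  simp only [e2] at h2
  -- Since v k ≤ 1, v^(2σ) k ≤ k^(1-2σ) with 1 - 2σ = (2p-2)/p; Hölder's inequality then separates
  -- g^p from k.
  have h3 : ∫⁻ y, g y ^ (2 - p) * (v y ^ (2 * (1 / p - 1 / 2)) * k y) ∂μ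
      ≤ (∫⁻ y, g y ^ p ∂μ) ^ ((2 - p) / p) * C ^ ((2 * p - 2) / p) := by
    have h4 := ENNReal.lintegral_mul_norm_pow_le (μ := μ) (f := fun y => g y ^ p)
      (g := fun y => k y) (hg.pow_const p).aemeasurable hk.aemeasurable
      ha0 hb0 (by field_simp; ring)
    refine le_trans (lintegral_mono fun y => ?_) (h4.trans ?_)
    · simp only
      rw [← ENNReal.rpow_mul, mul_div_cancel₀ _ hp0.ne']
      refine mul_le_mul_right ?_ _
      have e6 : k y = k y ^ (2 * (1 / p - 1 / 2)) * k y ^ ((2 * p - 2) / p) := by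
        rw [← ENNReal.rpow_add_of_nonneg _ _ (by linarith) hb0]
        conv_lhs => rw [← ENNReal.rpow_one (k y)]
        congr 1; field_simp; ring
      conv_lhs => rw [e6]
      rw [← mul_assoc, ← ENNReal.mul_rpow_of_nonneg _ _ (by linarith)]
      exact mul_le_of_le_one_left zero_le (ENNReal.rpow_le_one (hkv y) (by linarith))
    · exact mul_le_mul_right (ENNReal.rpow_le_rpow hC hb0) _
  refine (ENNReal.rpow_le_rpow (h2.trans (mul_le_mul_right (ENNReal.rpow_le_rpow h3
    (by norm_num)) _)) zero_le_two).trans_eq ?_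
  rw [ENNReal.mul_rpow_of_nonneg _ _ (by norm_num), ← ENNReal.rpow_mul, ← ENNReal.rpow_mul]
  norm_num

variable [MetricSpace X] {n : ℝ}

/-- Schur type estimate: kernels of order `β > n` at scale `τ` map `V_τ^σ L^p` to `L²`. -/
theorem IsDoubling.exists_kernel_bound [TopologicalSpace.SeparableSpace X] [BorelSpace X]
    (hμ : IsDoubling μ n) (hn : 0 ≤ n) {p : ℝ} (hp1 : 1 ≤ p) (hp2 : p ≤ 2) {β : ℝ} (hβ : n < β) :
    ∃ C : ℝ≥0, ∀ (τ : ℝ), 0 < τ → ∀ (c : ℝ≥0) (S : Lp ℂ 2 μ →L[ℂ] Lp ℂ 2 μ) (L : X → X → ℂ),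
      IsKernel μ S L → (∀ x y, ‖L x y‖ ≤ c * ((1 / max (vol μ x τ) (vol μ y τ))
        * (1 + dist x y / τ) ^ (-β))) →
      ∀ f : Lp ℂ 2 μ, eLpNorm (S f) 2 μ ≤ C * c *
        eLpNorm (fun y => ((vol μ y τ ^ (-(1 / p - 1 / 2)) : ℝ) : ℂ) * f y)
          (ENNReal.ofReal p) μ := by
  obtain ⟨C1, hC1⟩ := hμ.exists_lintegral_weight_le hn hβ
  have : SigmaFinite μ := hμ.sigmaFinite
  have hp0 : 0 < p := by linarith
  refine ⟨C1 ^ ((1 + (2 * p - 2) / p) / 2), fun τ hτ c S L hL hLb f => ?_⟩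
  set V : X → ℝ := fun x => vol μ x τ with hV
  have hVpos : ∀ x, 0 < V x := fun x => hμ.vol_pos x hτ
  have hVm : Measurable V := measurable_vol τ
  set g : X → ℝ≥0∞ := fun y => ‖((V y ^ (-(1 / p - 1 / 2)) : ℝ) : ℂ) * f y‖ₑ with hg
  have hfm : Measurable f := (Lp.stronglyMeasurable f).measurable
  have hgm : Measurable g :=
    ((Complex.measurable_ofReal.comp (hVm.pow_const _)).mul hfm).enorm
  have hfg : ∀ y, ‖f y‖ₑ = ENNReal.ofReal (V y) ^ (1 / p - 1 / 2) * g y := fun y => by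
    simp only [hg]
    have e : ‖((V y ^ (-(1 / p - 1 / 2)) : ℝ) : ℂ)‖ₑ
        = ENNReal.ofReal (V y) ^ (-(1 / p - 1 / 2)) := by
      rw [← ofReal_norm, Complex.norm_real,
        Real.norm_of_nonneg (Real.rpow_nonneg (hVpos y).le _), ENNReal.ofReal_rpow_of_pos (hVpos y)]
    rw [enorm_mul, e, ← mul_assoc, ← ENNReal.rpow_add _ _ (by simpa using hVpos y) ENNReal.ofReal_ne_top,
      add_neg_cancel, ENNReal.rpow_zero, one_mul]
  set k : X → X → ℝ≥0∞ := fun x y => ENNReal.ofReal ((1 / max (V x) (V y))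
    * (1 + dist x y / τ) ^ (-β)) with hk
  have : SecondCountableTopology X := UniformSpace.secondCountable_of_separable X
  have hkm : Measurable (Function.uncurry k) := by
    refine Measurable.ennreal_ofReal (Measurable.mul ?_ ?_)
    · exact measurable_const.div ((hVm.comp measurable_fst).max (hVm.comp measurable_snd))
    · exact (measurable_const.add ((measurable_fst.dist measurable_snd).div_const τ)).pow_const _
  have hksymm : ∀ x y, k x y = k y x := fun x y => by
    simp only [hk, max_comm (V x), dist_comm x y]
  have hθ0 : ∀ x y : X, 0 ≤ (1 + dist x y / τ) ^ (-β) := fun x y => by positivity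
  have hθ1 : ∀ x y : X, (1 + dist x y / τ) ^ (-β) ≤ 1 := fun x y =>
    Real.rpow_le_one_of_one_le_of_nonpos (by have : 0 ≤ dist x y / τ := by positivity
                                             linarith) (by linarith)
  have hkint : ∀ x, ∫⁻ y, k x y ∂μ ≤ C1 := fun x => by
    have hv : ENNReal.ofReal (V x) = μ (Metric.ball x τ) := hμ.ofReal_vol x hτ
    calc ∫⁻ y, k x y ∂μ
        ≤ ∫⁻ y, (ENNReal.ofReal (V x))⁻¹ * ENNReal.ofReal ((1 + dist x y / τ) ^ (-β)) ∂μ := by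
          refine lintegral_mono fun y => ?_
          rw [← ENNReal.ofReal_inv_of_pos (hVpos x), ← ENNReal.ofReal_mul
            (inv_nonneg.2 (hVpos x).le)]
          refine ENNReal.ofReal_le_ofReal (mul_le_mul_of_nonneg_right ?_ (hθ0 x y))
          rw [one_div]
          exact inv_anti₀ (hVpos x) (le_max_left _ _)
      _ ≤ (ENNReal.ofReal (V x))⁻¹ * (C1 * μ (Metric.ball x τ)) := by
          rw [lintegral_const_mul' _ _ (by simpa using hVpos x)]
          gcongr
          exact hC1 x τ hτ
      _ = C1 := by
          rw [hv, mul_left_comm, ENNReal.inv_mul_cancel (hμ.ball_pos x τ hτ).ne'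
            (hμ.ball_lt_top x τ hτ).ne, mul_one]
  set G := ∫⁻ y, g y ^ p ∂μ with hG
  have hσ0 : 0 ≤ 1 / p - 1 / 2 := by
    rw [sub_nonneg]; exact one_div_le_one_div_of_le hp0 hp2
  have hb0 : 0 ≤ (2 * p - 2) / p := div_nonneg (by linarith) hp0.le
  have ha0 : 0 ≤ (2 - p) / p := div_nonneg (by linarith) hp0.le
  have hpt : ∀ x, (∫⁻ y, ‖L x y * f y‖ₑ ∂μ) ^ (2 : ℝ)
      ≤ (c : ℝ≥0∞) ^ (2 : ℝ) * ((∫⁻ y, g y ^ p * k x y ∂μ)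
        * (G ^ ((2 - p) / p) * (C1 : ℝ≥0∞) ^ ((2 * p - 2) / p))) := by
    intro x
    have hkx : Measurable (k x) := hkm.of_uncurry_left
    have h1 : ∫⁻ y, ‖L x y * f y‖ₑ ∂μ
        ≤ c * ∫⁻ y, k x y * (ENNReal.ofReal (V y) ^ (1 / p - 1 / 2) * g y) ∂μ := by
      rw [← lintegral_const_mul' _ _ ENNReal.coe_ne_top]
      refine lintegral_mono fun y => ?_
      simp only
      have hLk : ‖L x y‖ₑ ≤ c * k x y := by
        simp only [hk]
        rw [← ofReal_norm, ← ENNReal.ofReal_coe_nnreal, ← ENNReal.ofReal_mul c.coe_nonneg]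
        exact ENNReal.ofReal_le_ofReal (hLb x y)
      rw [enorm_mul, hfg]
      exact (mul_le_mul_left hLk _).trans_eq (mul_assoc _ _ _)
    -- The maximum in the kernel bound enters here: it gives V(y) k(x,y) ≤ 1, while V(x) was used
    -- for the integral of k in y.
    have h2 := lintegral_kernel_mul_sq_le (μ := μ) hkx hVm.ennreal_ofReal hgm (fun y => by
      simp only [hk]
      rw [← ENNReal.ofReal_mul (hVpos y).le, ← ENNReal.ofReal_one]
      refine ENNReal.ofReal_le_ofReal ?_
      rw [← mul_assoc]
      refine mul_le_one₀ ?_ (hθ0 x y) (hθ1 x y)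
      rw [mul_one_div, div_le_one ((hVpos y).trans_le (le_max_right _ _))]
      exact le_max_right _ _) (hkint x) hp1 hp2
    refine (ENNReal.rpow_le_rpow h1 zero_le_two).trans ?_
    rw [ENNReal.mul_rpow_of_nonneg _ _ zero_le_two]
    exact mul_le_mul_right h2 _
  have hS2 : ∫⁻ x, ‖S f x‖ₑ ^ (2 : ℝ) ∂μ ≤ (c : ℝ≥0∞) ^ (2 : ℝ) *
      ((C1 * G) * (G ^ ((2 - p) / p) * (C1 : ℝ≥0∞) ^ ((2 * p - 2) / p))) := by
    calc ∫⁻ x, ‖S f x‖ₑ ^ (2 : ℝ) ∂μ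
        ≤ ∫⁻ x, (c : ℝ≥0∞) ^ (2 : ℝ) * ((∫⁻ y, g y ^ p * k x y ∂μ)
          * (G ^ ((2 - p) / p) * (C1 : ℝ≥0∞) ^ ((2 * p - 2) / p))) ∂μ := by
          refine lintegral_mono_ae ?_
          filter_upwards [hL.2 f] with x hx
          refine le_trans ?_ (hpt x)
          rw [hx.2]
          gcongr
          exact enorm_integral_le_lintegral_enorm _
      _ = (c : ℝ≥0∞) ^ (2 : ℝ) * ((∫⁻ x, ∫⁻ y, g y ^ p * k x y ∂μ ∂μ)
          * (G ^ ((2 - p) / p) * (C1 : ℝ≥0∞) ^ ((2 * p - 2) / p))) := by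
          have hm : Measurable fun x => ∫⁻ y, g y ^ p * k x y ∂μ :=
            Measurable.lintegral_prod_right'
              (f := fun z : X × X => g z.2 ^ p * k z.1 z.2)
              (((hgm.pow_const p).comp measurable_snd).mul hkm)
          rw [lintegral_const_mul _ (hm.mul_const _), lintegral_mul_const _ hm]
      _ ≤ _ := by
          gcongr
          rw [lintegral_lintegral_swap
            (((hgm.pow_const p).comp measurable_snd).mul hkm).aemeasurable]
          calc ∫⁻ y, ∫⁻ x, g y ^ p * k x y ∂μ ∂μ ≤ ∫⁻ y, C1 * g y ^ p ∂μ := by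
                refine lintegral_mono fun y => ?_
                have hky : Measurable fun x => k x y := hkm.of_uncurry_right
                rw [lintegral_const_mul _ hky, mul_comm]
                gcongr
                simp only [hksymm _ y]
                exact hkint y
            _ = C1 * G := lintegral_const_mul _ (hgm.pow_const p)
  rw [eLpNorm_eq_lintegral_rpow_enorm_toReal two_ne_zero ENNReal.ofNat_ne_top,
    eLpNorm_eq_lintegral_rpow_enorm_toReal (by simpa using hp0) ENNReal.ofReal_ne_top,
    ENNReal.toReal_ofReal hp0.le, ENNReal.toReal_ofNat]
  change _ ≤ _ * G ^ (1 / p)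
  have e7 : (C1 * G) * (G ^ ((2 - p) / p) * (C1 : ℝ≥0∞) ^ ((2 * p - 2) / p))
      = (C1 : ℝ≥0∞) ^ (1 + (2 * p - 2) / p) * G ^ (2 / p) := by
    rw [ENNReal.rpow_add_of_nonneg _ _ zero_le_one hb0, ENNReal.rpow_one]
    have : G ^ (2 / p) = G * G ^ ((2 - p) / p) := by
      conv_rhs => rw [← ENNReal.rpow_one G, ← ENNReal.rpow_mul, one_mul]
      rw [← ENNReal.rpow_add_of_nonneg _ _ zero_le_one ha0]
      congr 1; field_simp; ring
    rw [this]; ring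
  refine (ENNReal.rpow_le_rpow hS2 (by norm_num : (0 : ℝ) ≤ 1 / 2)).trans_eq ?_
  rw [e7, ENNReal.mul_rpow_of_nonneg _ _ (by norm_num), ENNReal.mul_rpow_of_nonneg _ _
    (by norm_num), ← ENNReal.rpow_mul, ← ENNReal.rpow_mul, ← ENNReal.rpow_mul,
    ENNReal.coe_rpow_of_nonneg _ (by linarith)]
  have e8 : (2 : ℝ) * (1 / 2) = 1 := by norm_num
  have e9 : 2 / p * (1 / 2) = 1 / p := by ring
  have e10 : (1 + (2 * p - 2) / p) * (1 / 2) = (1 + (2 * p - 2) / p) / 2 := by ring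
  rw [e8, e9, e10, ENNReal.rpow_one]
  ring

/-- Iterated commutators of an operator with polynomially decaying kernel and a Lipschitz function
map `V_τ^σ L^p` to `L²`. -/
theorem IsDoubling.exists_adPow_bound [TopologicalSpace.SeparableSpace X] [BorelSpace X]
    (hμ : IsDoubling μ n) (hn : 0 < n) {N : ℝ} (hN : n < N) {M : ℕ} (hM : M ≤ 2 * (N - n)) {p : ℝ}
    (hp1 : 1 ≤ p) (hp2 : p ≤ 2) {C : ℝ} (hC : 0 ≤ C) :
    ∃ C' : ℝ≥0, ∀ k l : ℕ, 1 ≤ k → k ≤ l → l ≤ 2 * k → ∀ T : Lp ℂ 2 μ →L[ℂ] Lp ℂ 2 μ,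
      HasPolynomialKernelBound μ T l N C →
      ∀ (b : X → ℂ) (hb : Measurable b) (B : ℝ) (hB : ∀ x, ‖b x‖ ≤ B),
        (∀ x y, ‖b x - b y‖ ≤ dist x y) → ∀ i ≤ M, ∀ f : Lp ℂ 2 μ,
          eLpNorm (adPow (mulOp μ b hb B hB) i T f) 2 μ ≤ C' * ENNReal.ofReal (√k ^ i) *
            eLpNorm (fun y => ((vol μ y √k ^ (-(1 / p - 1 / 2)) : ℝ) : ℂ) * f y)
              (ENNReal.ofReal p) μ := by
  -- The weight (1 + d²/l)^(-N) decays like (1 + d/τ)^(-2N), and at most M powers of d are spent on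
  -- the commutators; the remaining order 2N - M ≥ 2n exceeds n.
  obtain ⟨C1, hC1⟩ := hμ.exists_kernel_bound hn.le hp1 hp2 (β := 2 * N - M) (by linarith)
  have hN0 : 0 < N := hn.trans hN
  refine ⟨C1 * (C * 4 ^ N).toNNReal, fun k l hk hkl hlk T ⟨K, hK, hKb⟩ b hb B hB hlip i hi f => ?_⟩
  have hk0 : (0 : ℝ) < k := by exact_mod_cast hk
  have hl0 : (0 : ℝ) < l := by exact_mod_cast hk.trans hkl
  have hτ : 0 < √(k : ℝ) := Real.sqrt_pos.2 hk0
  set τ := √(k : ℝ) with hτdef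
  have hτ2 : τ ^ 2 = k := Real.sq_sqrt hk0.le
  have hlτ : (l : ℝ) ≤ 2 * τ ^ 2 := by rw [hτ2]; exact_mod_cast hlk
  have hτl : τ ≤ √(l : ℝ) := Real.sqrt_le_sqrt (by exact_mod_cast hkl)
  have hvol : ∀ x, vol μ x τ ≤ vol μ x √(l : ℝ) := fun x =>
    hμ.vol_le_vol (hτ.trans_le hτl) (by rw [dist_self, add_zero]; exact hτl)
  have h := hC1 τ hτ ((C * 4 ^ N).toNNReal * (τ ^ i).toNNReal) _ _ (hK.adPow hb hB i)
    (fun x y => ?_) f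
  · refine h.trans_eq ?_
    rw [ENNReal.coe_mul, ENNReal.coe_mul, ← mul_assoc]
    rfl
  have hd : 0 ≤ dist x y / τ := by positivity
  -- With u = d/τ and l ≤ 2τ², this is (1 + u)²/4 ≤ 1 + u²/2, raised to the power -N.
  have hw : (1 + dist x y ^ 2 / l) ^ (-N) ≤ 4 ^ N * (1 + dist x y / τ) ^ (-(2 * N)) := by
    have h1 : (1 + dist x y / τ) ^ 2 / 4 ≤ 1 + dist x y ^ 2 / l := by
      have h2 : (dist x y / τ) ^ 2 / 2 ≤ dist x y ^ 2 / l := by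
        rw [div_pow, div_div]
        gcongr
        linarith
      nlinarith [sq_nonneg (dist x y / τ - 1)]
    calc (1 + dist x y ^ 2 / l) ^ (-N) ≤ ((1 + dist x y / τ) ^ 2 / 4) ^ (-N) :=
          Real.rpow_le_rpow_of_nonpos (by positivity) h1 (by linarith)
      _ = _ := by
          rw [Real.div_rpow (by positivity) (by norm_num), Real.rpow_neg (by norm_num : (0:ℝ) ≤ 4),
            ← Real.rpow_natCast, ← Real.rpow_mul (by positivity), div_inv_eq_mul, mul_comm]
          congr 2
          push_cast
          ring
  have hmax : 1 / max (vol μ x √(l : ℝ)) (vol μ y √(l : ℝ)) ≤ 1 / max (vol μ x τ) (vol μ y τ) :=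
    one_div_le_one_div_of_le (lt_max_of_lt_left (hμ.vol_pos x hτ))
      (max_le_max (hvol x) (hvol y))
  have hmax0 : 0 ≤ 1 / max (vol μ x √(l : ℝ)) (vol μ y √(l : ℝ)) := by
    have := (hμ.vol_pos x (hτ.trans_le hτl)).le
    have := this.trans (le_max_left _ (vol μ y √(l : ℝ)))
    positivity
  have hmax1 : 0 ≤ 1 / max (vol μ x τ) (vol μ y τ) := hmax0.trans hmax
  have hdi : dist x y ^ i ≤ τ ^ i * (1 + dist x y / τ) ^ (M : ℝ) := by
    calc dist x y ^ i = τ ^ i * (dist x y / τ) ^ i := by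
          rw [← mul_pow, mul_div_cancel₀ _ hτ.ne']
      _ ≤ τ ^ i * (1 + dist x y / τ) ^ M := by
          gcongr
          exact (pow_le_pow_left₀ hd (by linarith) i).trans (pow_le_pow_right₀ (by linarith) hi)
      _ = _ := by rw [Real.rpow_natCast]
  rw [norm_mul, norm_pow, NNReal.coe_mul, Real.coe_toNNReal _ (by positivity),
    Real.coe_toNNReal _ (by positivity)]
  calc ‖b x - b y‖ ^ i * ‖K x y‖
      ≤ (τ ^ i * (1 + dist x y / τ) ^ (M : ℝ)) * (C * (1 / max (vol μ x τ) (vol μ y τ))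
        * (4 ^ N * (1 + dist x y / τ) ^ (-(2 * N)))) := by
        refine mul_le_mul ((pow_le_pow_left₀ (norm_nonneg _) (hlip x y) i).trans hdi) ?_
          (norm_nonneg _) (by positivity)
        refine (hKb x y).trans ?_
        gcongr
    _ = C * 4 ^ N * τ ^ i * ((1 / max (vol μ x τ) (vol μ y τ))
        * ((1 + dist x y / τ) ^ (M : ℝ) * (1 + dist x y / τ) ^ (-(2 * N)))) := by ring
    _ = _ := by
        rw [← Real.rpow_add (by positivity)]
        congr 3
        ring

end Kernels

/-! ### Fourier coefficients of smooth functions supported in [0,1]. -/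

section FourierSeries

lemma sum_range_inv_sq_le {L : ℝ} (hL : 1 ≤ L) (k : ℕ) :
    ∑ m ∈ Finset.range k, ((L + m) ^ 2)⁻¹ ≤ 2 / L - 2 / (L + k) := by
  induction k with
  | zero => simp
  | succ k ih =>
    rw [Finset.sum_range_succ]
    have hk : (0 : ℝ) ≤ k := k.cast_nonneg
    have h1 : ((L + k) ^ 2)⁻¹ ≤ 2 / (L + k) - 2 / (L + (k + 1 : ℕ)) := by
      push_cast
      rw [div_sub_div _ _ (by positivity) (by positivity), inv_eq_one_div,
        div_le_div_iff₀ (by positivity) (by positivity)]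
      nlinarith
    linarith

lemma summable_inv_sq_int {L : ℝ} (hL : 1 ≤ L) :
    Summable (fun m : ℤ => ((L + |(m : ℝ)|) ^ 2)⁻¹) ∧
      ∑' m : ℤ, ((L + |(m : ℝ)|) ^ 2)⁻¹ ≤ 4 / L := by
  have hnn : ∀ m : ℕ, 0 ≤ ((L + m) ^ 2)⁻¹ := fun m => by positivity
  have hb : ∀ k, ∑ m ∈ Finset.range k, ((L + m) ^ 2)⁻¹ ≤ 2 / L := fun k =>
    (sum_range_inv_sq_le hL k).trans (by
      have : (0 : ℝ) ≤ 2 / (L + k) := by positivity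
      linarith)
  have hs : Summable fun m : ℕ => ((L + m) ^ 2)⁻¹ := summable_of_sum_range_le hnn hb
  have ht : ∑' m : ℕ, ((L + m) ^ 2)⁻¹ ≤ 2 / L := Real.tsum_le_of_sum_range_le hnn hb
  obtain ⟨f, hf⟩ : ∃ f : ℤ → ℝ, ∀ m, f m = ((L + |(m : ℝ)|) ^ 2)⁻¹ := ⟨_, fun _ => rfl⟩
  simp only [← hf]
  have e1 : (fun m : ℕ => f m) = fun m : ℕ => ((L + m) ^ 2)⁻¹ := funext fun m => by
    rw [hf, Int.cast_natCast, abs_of_nonneg m.cast_nonneg]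
  have h2 : ∀ m : ℕ, f (-(m + 1)) ≤ ((L + m) ^ 2)⁻¹ := fun m => by
    rw [hf]
    push_cast
    rw [abs_neg, abs_of_nonneg (by positivity)]
    gcongr
    linarith
  have h0 : ∀ m : ℕ, 0 ≤ f (-(m + 1)) := fun m => by rw [hf]; positivity
  have hs1 : Summable fun m : ℕ => f m := e1 ▸ hs
  have hs2 : Summable fun m : ℕ => f (-(m + 1)) := Summable.of_nonneg_of_le h0 h2 hs
  refine ⟨Summable.of_nat_of_neg_add_one hs1 hs2, ?_⟩
  rw [tsum_of_nat_of_neg_add_one hs1 hs2, e1]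
  calc _ ≤ 2 / L + 2 / L := add_le_add ht ((hs2.tsum_le_tsum h2 hs).trans ht)
    _ = 4 / L := by ring

lemma neg_pi_lt : (-Real.pi) < -Real.pi + 2 * Real.pi := by linarith [Real.pi_pos]

lemma norm_fourierCoeffOn_deriv {v w : ℝ → ℂ} (hv : ∀ x, HasDerivAt v (w x) x) (hw : Continuous w)
    (h0 : v (-Real.pi) = 0) (h1 : v (-Real.pi + 2 * Real.pi) = 0) (m : ℤ) :
    |(m : ℝ)| * ‖fourierCoeffOn neg_pi_lt v m‖ ≤ ‖fourierCoeffOn neg_pi_lt w m‖ := by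
  rcases eq_or_ne m 0 with rfl | hm
  · simp
  rw [fourierCoeffOn_of_hasDerivAt neg_pi_lt hm (fun x _ => hv x) (hw.intervalIntegrable _ _),
    h0, h1]
  have hm' : (m : ℂ) ≠ 0 := by exact_mod_cast hm
  have hπ : (Real.pi : ℂ) ≠ 0 := by exact_mod_cast Real.pi_ne_zero
  have e : (1 : ℂ) / (-2 * Real.pi * Complex.I * m) * (fourier (-m) ((-Real.pi : ℝ) :
      AddCircle (-Real.pi + 2 * Real.pi - -Real.pi)) * (0 - 0)
      - ((-Real.pi + 2 * Real.pi : ℝ) - (-Real.pi : ℝ)) * fourierCoeffOn neg_pi_lt w m)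
      = (Complex.I * m)⁻¹ * fourierCoeffOn neg_pi_lt w m := by
    push_cast
    field_simp
    ring
  rw [e, norm_mul, norm_inv, norm_mul, Complex.norm_I, one_mul, Complex.norm_intCast, ← mul_assoc,
    mul_inv_cancel₀ (by simpa using hm), one_mul]

lemma tsum_sq_fourierCoeffOn_le {v : ℝ → ℂ} (hv : Continuous v) {Q : ℝ} (hQ : ∀ x, ‖v x‖ ≤ Q) :
    Summable (fun m => ‖fourierCoeffOn neg_pi_lt v m‖ ^ 2) ∧
      ∑' m, ‖fourierCoeffOn neg_pi_lt v m‖ ^ 2 ≤ Q ^ 2 := by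
  have h2 : MemLp v 2 (volume.restrict (Ioc (-Real.pi) (-Real.pi + 2 * Real.pi))) :=
    MemLp.of_bound hv.aestronglyMeasurable Q (Filter.Eventually.of_forall hQ)
  have h := hasSum_sq_fourierCoeffOn neg_pi_lt h2
  refine ⟨h.summable, h.tsum_eq.trans_le ?_⟩
  rw [smul_eq_mul, inv_mul_le_iff₀ (by linarith [Real.pi_pos])]
  have h3 : ‖∫ x in (-Real.pi)..(-Real.pi + 2 * Real.pi), ‖v x‖ ^ 2‖
      ≤ Q ^ 2 * |(-Real.pi + 2 * Real.pi) - (-Real.pi)| :=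
    intervalIntegral.norm_integral_le_of_norm_le_const fun x _ => by
      rw [Real.norm_of_nonneg (by positivity)]
      exact pow_le_pow_left₀ (norm_nonneg _) (hQ x) 2
  rw [abs_of_pos (by linarith [Real.pi_pos])] at h3
  linarith [le_abs_self (∫ x in (-Real.pi)..(-Real.pi + 2 * Real.pi), ‖v x‖ ^ 2),
    Real.norm_eq_abs (∫ x in (-Real.pi)..(-Real.pi + 2 * Real.pi), ‖v x‖ ^ 2)]

/-- The function vanishes at both ends of an interval of length 2π, so its periodic extension is
continuous. That interval contains [-1,1], where the spectrum lies, and only there is the expansion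
used. -/
lemma hasSum_fourierCoeffOn_exp {v : ℝ → ℂ} (hv : Continuous v) (h0 : v (-Real.pi) = 0)
    (h1 : v (-Real.pi + 2 * Real.pi) = 0)
    (hs : Summable fun m => ‖fourierCoeffOn neg_pi_lt v m‖) {x : ℝ} (hx : |x| ≤ 1) :
    HasSum (fun m : ℤ => fourierCoeffOn neg_pi_lt v m * Complex.exp (Complex.I * m * x)) (v x) := by
  have : Fact (0 < 2 * Real.pi) := ⟨by linarith [Real.pi_pos]⟩
  let f : C(AddCircle (2 * Real.pi), ℂ) := ⟨AddCircle.liftIco (2 * Real.pi) (-Real.pi) v,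
    AddCircle.liftIco_continuous (h0.trans h1.symm) hv.continuousOn⟩
  have hc : ∀ m, fourierCoeff f m = fourierCoeffOn neg_pi_lt v m := fun m =>
    fourierCoeff_liftIco_eq v m
  have h := has_pointwise_sum_fourier_series_of_summable (f := f) (by
    refine Summable.of_norm ?_
    simpa only [hc] using hs) (x : AddCircle (2 * Real.pi))
  have hmem : x ∈ Ico (-Real.pi) (-Real.pi + 2 * Real.pi) := by
    have := abs_le.1 hx
    constructor <;> linarith [Real.pi_gt_three]
  have e : f (x : AddCircle (2 * Real.pi)) = v x := AddCircle.liftIco_coe_apply hmem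
  rw [e] at h
  have e2 : ∀ m : ℤ, fourierCoeff f m • fourier m (x : AddCircle (2 * Real.pi))
      = fourierCoeffOn neg_pi_lt v m * Complex.exp (Complex.I * m * x) := fun m => by
    rw [hc, fourier_coe_apply, smul_eq_mul]
    congr 2
    have hπ : (Real.pi : ℂ) ≠ 0 := by exact_mod_cast Real.pi_ne_zero
    push_cast
    field_simp
  simpa only [e2] using h

lemma iteratedDeriv_eq_zero_of_notMem_Icc {v : ℝ → ℂ} {a b : ℝ}
    (h : ∀ x, x ∉ Icc a b → v x = 0) (j : ℕ) {x : ℝ} (hx : x ∉ Icc a b) :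
    iteratedDeriv j v x = 0 := by
  have : v =ᶠ[nhds x] fun _ => 0 := by
    filter_upwards [isClosed_Icc.isOpen_compl.mem_nhds hx] with y hy
    exact h y hy
  rw [this.iteratedDeriv_eq j]
  simp

/-- The endpoints -π and π lie outside [0,1], so every derivative vanishes there and repeated
integration by parts leaves no boundary terms. -/
lemma norm_fourierCoeffOn_iteratedDeriv {v : ℝ → ℂ} {M : ℕ} (hv : ContDiff ℝ (M : ℕ) v)
    (hsupp : ∀ x, x ∉ Icc (0 : ℝ) 1 → v x = 0) (m : ℤ) :
    |(m : ℝ)| ^ M * ‖fourierCoeffOn neg_pi_lt v m‖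
      ≤ ‖fourierCoeffOn neg_pi_lt (iteratedDeriv M v) m‖ := by
  have ha : (-Real.pi) ∉ Icc (0 : ℝ) 1 := fun h => by linarith [h.1, Real.pi_pos]
  have hb : (-Real.pi + 2 * Real.pi) ∉ Icc (0 : ℝ) 1 := fun h => by
    linarith [h.2, Real.pi_gt_three]
  have key : ∀ j ≤ M, |(m : ℝ)| ^ j * ‖fourierCoeffOn neg_pi_lt v m‖
      ≤ ‖fourierCoeffOn neg_pi_lt (iteratedDeriv j v) m‖ := by
    intro j
    induction j with
    | zero => intro _; simp
    | succ j ih =>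
      intro hj
      have hd : ∀ x, HasDerivAt (iteratedDeriv j v) (iteratedDeriv (j + 1) v x) x := fun x => by
        rw [iteratedDeriv_succ]
        exact ((hv.differentiable_iteratedDeriv j (by exact_mod_cast hj)) x).hasDerivAt
      have hc : Continuous (iteratedDeriv (j + 1) v) :=
        hv.continuous_iteratedDeriv (j + 1) (by exact_mod_cast hj)
      refine le_trans ?_ (norm_fourierCoeffOn_deriv hd hc
        (iteratedDeriv_eq_zero_of_notMem_Icc hsupp j ha)
        (iteratedDeriv_eq_zero_of_notMem_Icc hsupp j hb) m)
      rw [pow_succ', mul_assoc]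
      gcongr
      exact ih (by omega)
  exact key M le_rfl

/-- Weighted summability of the Fourier coefficients of a function with derivative bounds of
frequency `L`. -/
theorem tsum_pow_mul_fourierCoeffOn_le {v : ℝ → ℂ} {M : ℕ} (hv : ContDiff ℝ (M + 1 : ℕ) v)
    (hsupp : ∀ x, x ∉ Icc (0 : ℝ) 1 → v x = 0) {L Q : ℝ} (hL : 1 ≤ L) (hQ : 0 < Q)
    (hv0 : ∀ x, ‖v x‖ ≤ Q) (hvM : ∀ x, ‖iteratedDeriv (M + 1) v x‖ ≤ Q * L ^ (M + 1)) (i : ℕ)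
    (hi : i ≤ M) :
    Summable (fun m : ℤ => |(m : ℝ)| ^ i * ‖fourierCoeffOn neg_pi_lt v m‖) ∧
      ∑' m : ℤ, |(m : ℝ)| ^ i * ‖fourierCoeffOn neg_pi_lt v m‖
        ≤ (2 * 4 ^ (M + 1) + 2) * (Q * √L * L ^ i) := by
  set c := fun m => ‖fourierCoeffOn neg_pi_lt v m‖ with hc
  set d := fun m => ‖fourierCoeffOn neg_pi_lt (iteratedDeriv (M + 1) v) m‖ with hd
  have hL0 : 0 < L := by linarith
  obtain ⟨hcs, hct⟩ := tsum_sq_fourierCoeffOn_le hv.continuous hv0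
  obtain ⟨hds, hdt⟩ := tsum_sq_fourierCoeffOn_le (hv.continuous_iteratedDeriv (M + 1) le_rfl) hvM
  obtain ⟨hls, hlt⟩ := summable_inv_sq_int hL
  have hcd : ∀ m : ℤ, |(m : ℝ)| ^ (M + 1) * c m ≤ d m := norm_fourierCoeffOn_iteratedDeriv hv hsupp
  -- Cauchy-Schwarz in the form 2xy ≤ ε x² + ε⁻¹ y², with x = R^(M+1) c_m, y = R⁻¹ and R = L + |m|.
  -- The sums of x² and y² are O(Q² L^(2(M+1))) and O(1/L); this ε balances them.
  set ε := (Q * L ^ (M + 1) * √L)⁻¹ with hε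
  have hsq : 0 < √L := Real.sqrt_pos.2 hL0
  have hε0 : 0 < ε := by positivity
  set A := (fun m : ℤ => (ε * (2 * 4 ^ (M + 1))) * (L ^ (2 * (M + 1)) * c m ^ 2 + d m ^ 2)
    + ε⁻¹ * ((L + |(m : ℝ)|) ^ 2)⁻¹) with hA
  have hAs : Summable A :=
    (((hcs.mul_left (L ^ (2 * (M + 1)))).add hds).mul_left _).add (hls.mul_left _)
  have hAt : ∑' m, A m ≤ (2 * (2 * 4 ^ (M + 1)) + 4) * (Q * √L * L ^ M) := by
    rw [hA, (((hcs.mul_left (L ^ (2 * (M + 1)))).add hds).mul_left _).tsum_add (hls.mul_left _),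
      tsum_mul_left, tsum_mul_left, (hcs.mul_left _).tsum_add hds, tsum_mul_left]
    calc _ ≤ ε * (2 * 4 ^ (M + 1)) * (L ^ (2 * (M + 1)) * Q ^ 2 + (Q * L ^ (M + 1)) ^ 2)
          + ε⁻¹ * (4 / L) := by gcongr
      _ = _ := by
        rw [hε, inv_inv]
        have h5 : √L * √L = L := Real.mul_self_sqrt hL0.le
        have h6 : L ^ (M + 1) = L ^ M * (√L * √L) := by rw [h5, pow_succ]
        have h7 : L ^ (2 * (M + 1)) = L ^ (M + 1) * L ^ (M + 1) := by ring
        have h8 : (4 : ℝ) / L = 4 / (√L * √L) := by rw [h5]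
        rw [h8, h7, h6]
        field_simp
        ring
  have hle : ∀ m : ℤ, |(m : ℝ)| ^ i * c m ≤ (L ^ i / L ^ M / 2) * A m := by
    intro m
    set R := L + |(m : ℝ)| with hR
    have hm : 0 ≤ |(m : ℝ)| := abs_nonneg _
    have hR0 : 0 < R := by positivity
    have hLR : L ≤ R := by linarith
    have hc0 : 0 ≤ c m := norm_nonneg _
    have h1 : (R ^ (M + 1) * c m) ^ 2
        ≤ (2 * 4 ^ (M + 1)) * (L ^ (2 * (M + 1)) * c m ^ 2 + d m ^ 2) := by
      have h2 : R ^ (M + 1) ≤ 2 ^ (M + 1) * (L ^ (M + 1) + |(m : ℝ)| ^ (M + 1)) := by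
        rcases le_total L |(m : ℝ)| with h | h
        · calc R ^ (M + 1) ≤ (2 * |(m : ℝ)|) ^ (M + 1) := by gcongr; linarith
            _ = 2 ^ (M + 1) * |(m : ℝ)| ^ (M + 1) := mul_pow _ _ _
            _ ≤ _ := by gcongr; linarith [pow_pos hL0 (M + 1)]
        · calc R ^ (M + 1) ≤ (2 * L) ^ (M + 1) := by gcongr; linarith
            _ = 2 ^ (M + 1) * L ^ (M + 1) := mul_pow _ _ _
            _ ≤ _ := by gcongr; linarith [pow_nonneg hm (M + 1)]
      have h3 : R ^ (M + 1) * c m ≤ 2 ^ (M + 1) * (L ^ (M + 1) * c m + d m) := by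
        calc R ^ (M + 1) * c m ≤ 2 ^ (M + 1) * (L ^ (M + 1) + |(m : ℝ)| ^ (M + 1)) * c m := by gcongr
          _ = 2 ^ (M + 1) * (L ^ (M + 1) * c m + |(m : ℝ)| ^ (M + 1) * c m) := by ring
          _ ≤ _ := by gcongr; exact hcd m
      calc (R ^ (M + 1) * c m) ^ 2 ≤ (2 ^ (M + 1) * (L ^ (M + 1) * c m + d m)) ^ 2 := by gcongr
        _ = 4 ^ (M + 1) * (L ^ (M + 1) * c m + d m) ^ 2 := by
            rw [mul_pow, ← pow_mul, mul_comm (M + 1), pow_mul]; norm_num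
        _ ≤ 4 ^ (M + 1) * (2 * ((L ^ (M + 1) * c m) ^ 2 + d m ^ 2)) := by
            gcongr
            nlinarith [sq_nonneg (L ^ (M + 1) * c m - d m)]
        _ = _ := by ring
    have h4 : |(m : ℝ)| ^ i * c m ≤ (L ^ i / L ^ M) * ((R ^ (M + 1) * c m) * R⁻¹) := by
      have e : (L ^ i / L ^ M) * ((R ^ (M + 1) * c m) * R⁻¹) = L ^ i * (R ^ M / L ^ M) * c m := by
        field_simp
        ring
      rw [e]
      gcongr
      -- Lower powers cost nothing extra: (R/L)^i ≤ (R/L)^M because R ≥ L.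
      have h9 : R ^ i ≤ L ^ i * (R ^ M / L ^ M) := by
        rw [← div_le_iff₀' (by positivity), ← div_pow, ← div_pow]
        exact pow_le_pow_right₀ ((one_le_div hL0).2 hLR) hi
      exact (pow_le_pow_left₀ hm (by linarith) i).trans h9
    have h10 : 2 * ((R ^ (M + 1) * c m) * R⁻¹) ≤ ε * (R ^ (M + 1) * c m) ^ 2 + ε⁻¹ * (R ^ 2)⁻¹ := by
      have h11 := sq_nonneg (√ε * (R ^ (M + 1) * c m) - √ε⁻¹ * R⁻¹)
      have h12 : √ε * √ε⁻¹ = 1 := by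
        rw [← Real.sqrt_mul hε0.le, mul_inv_cancel₀ hε0.ne', Real.sqrt_one]
      have h13 : √ε ^ 2 = ε := Real.sq_sqrt hε0.le
      have h14 : √ε⁻¹ ^ 2 = ε⁻¹ := Real.sq_sqrt (inv_pos.2 hε0).le
      have h15 : (√ε * (R ^ (M + 1) * c m) - √ε⁻¹ * R⁻¹) ^ 2
          = √ε ^ 2 * (R ^ (M + 1) * c m) ^ 2 - 2 * (√ε * √ε⁻¹) * ((R ^ (M + 1) * c m) * R⁻¹)
            + √ε⁻¹ ^ 2 * (R ^ 2)⁻¹ := by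
        rw [← inv_pow]; ring
      rw [h15, h12, h13, h14] at h11
      linarith
    calc _ ≤ _ := h4
      _ = (L ^ i / L ^ M / 2) * (2 * ((R ^ (M + 1) * c m) * R⁻¹)) := by ring
      _ ≤ (L ^ i / L ^ M / 2) * (ε * (R ^ (M + 1) * c m) ^ 2 + ε⁻¹ * (R ^ 2)⁻¹) := by gcongr
      _ ≤ _ := by
        simp only [hA]
        rw [mul_assoc ε]
        gcongr
  have hs : Summable fun m : ℤ => |(m : ℝ)| ^ i * c m :=
    Summable.of_nonneg_of_le (fun m => mul_nonneg (by positivity) (norm_nonneg _)) hle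
      (hAs.mul_left _)
  refine ⟨hs, (hs.tsum_le_tsum hle (hAs.mul_left _)).trans ?_⟩
  rw [tsum_mul_left]
  calc (L ^ i / L ^ M / 2) * ∑' m, A m
      ≤ (L ^ i / L ^ M / 2) * ((2 * (2 * 4 ^ (M + 1)) + 4) * (Q * √L * L ^ M)) := by gcongr
    _ = _ := by field_simp; ring

end FourierSeries

/-! ### Commutators with smooth functions of an operator. -/

section FunctionsOfOperators

variable {H : Type*} [NormedAddCommGroup H] [InnerProductSpace ℂ H] [CompleteSpace H]

/-- For a smooth function `v` with derivative bounds of frequency `L`, the iterated commutators of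
`v(T)` grow like powers of `L`. -/
theorem exists_operator_adPow_le {T : H →L[ℂ] H} (hT : IsSelfAdjoint T) (hT1 : ‖T‖ ≤ 1)
    {v : ℝ → ℂ} {M : ℕ} (hv : ContDiff ℝ (M + 1 : ℕ) v)
    (hsupp : ∀ x, x ∉ Icc (0 : ℝ) 1 → v x = 0) {L Q : ℝ} (hL : 1 ≤ L) (hQ : 0 < Q)
    (hv0 : ∀ x, ‖v x‖ ≤ Q) (hvM : ∀ x, ‖iteratedDeriv (M + 1) v x‖ ≤ Q * L ^ (M + 1)) :
    ∃ R : H →L[ℂ] H, (∀ x, ⟪x, (R * T) x⟫ = ∫ t, v t * t ∂(spectralMeasure T x)) ∧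
      ∀ (E : H →L[ℂ] H) (s α : ℝ), 0 ≤ s → 0 ≤ α → (∀ j ≤ M, ‖adPow E j T‖ ≤ α * s ^ j) →
        ∀ i ≤ M, ‖adPow E i R‖ ≤ ((2 * 4 ^ (M + 1) + 2) * (Q * √L))
          * (L * (M.factorial * Real.exp (Real.exp 1 * α) * s)) ^ i := by
  set c := fun m => fourierCoeffOn neg_pi_lt v m with hc
  have hsum := fun i hi => tsum_pow_mul_fourierCoeffOn_le hv hsupp hL hQ hv0 hvM i hi
  have hs0 : Summable fun m => ‖c m‖ := by simpa using (hsum 0 (Nat.zero_le _)).1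
  -- v(T) is realized as the absolutely convergent series of c_m e^{imT}; each commutator is then
  -- estimated term by term.
  set U : ℤ → H →L[ℂ] H := fun m => NormedSpace.exp ((Complex.I * m) • T) with hU
  have hUn : ∀ m, ‖U m‖ ≤ 1 := fun m => by
    have := norm_exp_I_smul_le hT (m : ℝ)
    simpa [hU] using this
  have hsU : Summable fun m => c m • U m := by
    refine Summable.of_norm_bounded hs0 fun m => ?_
    rw [norm_smul]
    exact mul_le_of_le_one_right (norm_nonneg _) (hUn m)
  have ha : v (-Real.pi) = 0 := hsupp _ fun h => by linarith [h.1, Real.pi_pos]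
  have hb : v (-Real.pi + 2 * Real.pi) = 0 := hsupp _ fun h => by
    linarith [h.2, Real.pi_gt_three]
  refine ⟨∑' m, c m • U m, fun x => ?_, fun E s α hs hα hE i hi => ?_⟩
  · have h1 : HasSum (fun m => ⟪x, ((c m • U m) * T) x⟫) ⟪x, ((∑' m, c m • U m) * T) x⟫ := by
      have h := (hsU.hasSum.mul_right T).mapL (ContinuousLinearMap.apply ℂ H x)
      exact h.mapL (innerSL ℂ x)
    have h2 : ∀ m, ⟪x, ((c m • U m) * T) x⟫
        = ∫ t, c m * Complex.exp (Complex.I * m * t) * t ∂(spectralMeasure T x) := fun m => by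
      rw [smul_mul_assoc, smul_apply, inner_smul_right,
        ← integral_exp_mul_spectralMeasure hT x (Complex.I * m), ← integral_const_mul]
      simp only [mul_assoc]
    have hi : ∀ m, Integrable (fun t : ℝ => c m * Complex.exp (Complex.I * m * t) * t)
        (spectralMeasure T x) := fun m =>
      integrable_spectralMeasure_of_continuous hT x (by fun_prop)
    have h3 : Summable fun m => ∫ t, ‖c m * Complex.exp (Complex.I * m * t) * t‖
        ∂(spectralMeasure T x) := by
      refine Summable.of_nonneg_of_le (fun m => integral_nonneg fun t => norm_nonneg _)
        (fun m => ?_) (hs0.mul_right ((spectralMeasure T x).real univ))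
      have : ∫ t, ‖c m * Complex.exp (Complex.I * m * t) * t‖ ∂(spectralMeasure T x)
          ≤ ∫ _, ‖c m‖ ∂(spectralMeasure T x) := by
        refine integral_mono_ae (hi m).norm (integrable_const _) ?_
        filter_upwards [ae_spectralMeasure_abs_le hT x] with t ht
        have e : Complex.I * m * t = ((m * t : ℝ) : ℂ) * Complex.I := by push_cast; ring
        rw [norm_mul, norm_mul, e, Complex.norm_exp_ofReal_mul_I, mul_one, Complex.norm_real]
        exact mul_le_of_le_one_right (norm_nonneg _) (ht.trans hT1)
      refine this.trans_eq ?_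
      rw [integral_const, smul_eq_mul, mul_comm]
    have h4 := hasSum_integral_of_summable_integral_norm hi h3
    simp only [h2] at h1
    rw [h1.unique h4]
    refine integral_congr_ae ?_
    filter_upwards [ae_spectralMeasure_abs_le hT x] with t ht
    have h5 := (hasSum_fourierCoeffOn_exp hv.continuous ha hb hs0 (ht.trans hT1)).mul_right (t : ℂ)
    exact h5.tsum_eq
  · obtain ⟨hsi, hti⟩ := hsum i hi
    set κ := M.factorial * Real.exp (Real.exp 1 * α) * s with hκ
    have hκ0 : 0 ≤ κ := by positivity
    have h1 := hsU.hasSum.mapL (adPow E i)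
    have h2 : HasSum (fun m : ℤ => κ ^ i * (|(m : ℝ)| ^ i * ‖c m‖))
        (κ ^ i * ∑' m : ℤ, |(m : ℝ)| ^ i * ‖c m‖) := hsi.hasSum.mul_left _
    refine (h1.norm_le_of_bounded h2 fun m => ?_).trans ?_
    · rw [map_smul, norm_smul]
      have := norm_adPow_exp_int_le E hT hs hα hE m i hi
      calc ‖c m‖ * ‖adPow E i (U m)‖ ≤ ‖c m‖ * (|(m : ℝ)| * κ) ^ i := by gcongr
        _ = _ := by rw [mul_pow]; ring
    · calc κ ^ i * ∑' m : ℤ, |(m : ℝ)| ^ i * ‖c m‖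
          ≤ κ ^ i * ((2 * 4 ^ (M + 1) + 2) * (Q * √L * L ^ i)) := by gcongr
        _ = _ := by rw [mul_pow]; ring

end FunctionsOfOperators

/-! ### Fourier multipliers with compactly supported symbols. -/

section FourierCutoff

open FourierTransform
open scoped ContDiff

/-- The Fourier multiplier with symbol `a(-ξ)`, as convolution with the Fourier transform of `a`. -/
noncomputable def symbolConv (a F : ℝ → ℂ) (x : ℝ) : ℂ := ∫ y, F y * 𝓕 a (x - y)

lemma besselSymbol_pos (s ξ : ℝ) : 0 < besselSymbol s ξ :=
  Real.rpow_pos_of_pos (by positivity) _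

lemma contDiff_besselSymbol (s : ℝ) : ContDiff ℝ ∞ (besselSymbol s) := by
  unfold besselSymbol
  exact ContDiff.rpow_const_of_ne (by fun_prop) fun ξ => (by positivity)

lemma hasTemperateGrowth_besselSymbol (s : ℝ) : (besselSymbol s).HasTemperateGrowth := by
  have h1 := Function.hasTemperateGrowth_one_add_norm_sq_rpow ℝ (s / 2)
  have h2 : (fun ξ : ℝ => (2 * Real.pi) * ξ).HasTemperateGrowth := by fun_prop
  have h3 := h1.comp h2
  refine (congrArg Function.HasTemperateGrowth ?_).mp h3
  funext ξ
  simp [besselSymbol]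

lemma hasDerivAt_fourier_of_hasCompactSupport {a : ℝ → ℂ} (ha : ContDiff ℝ ∞ a)
    (hc : HasCompactSupport a) (x : ℝ) :
    HasDerivAt (𝓕 a) (𝓕 (fun ξ : ℝ => (-2 * Real.pi * Complex.I * ξ) * a ξ) x) x :=
  Real.hasDerivAt_fourier (ha.continuous.integrable_of_hasCompactSupport hc)
    ((continuous_id.smul ha.continuous).integrable_of_hasCompactSupport hc.smul_left) x

lemma continuous_fourier_of_hasCompactSupport {a : ℝ → ℂ} (ha : ContDiff ℝ ∞ a)
    (hc : HasCompactSupport a) : Continuous (𝓕 a) :=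
  continuous_iff_continuousAt.2 fun x =>
    (hasDerivAt_fourier_of_hasCompactSupport ha hc x).continuousAt

lemma norm_fourier_le (a : ℝ → ℂ) (x : ℝ) : ‖𝓕 a x‖ ≤ ∫ ξ, ‖a ξ‖ :=
  VectorFourier.norm_fourierIntegral_le_integral_norm _ _ _ _ _

lemma hasDerivAt_symbolConv {a F : ℝ → ℂ} (ha : ContDiff ℝ ∞ a) (hc : HasCompactSupport a)
    (hF : Integrable F) (x : ℝ) :
    HasDerivAt (symbolConv a F)
      (symbolConv (fun ξ : ℝ => (-2 * Real.pi * Complex.I * ξ) * a ξ) F x) x := by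
  have hb : ContDiff ℝ ∞ (fun ξ : ℝ => (-2 * Real.pi * Complex.I * ξ) * a ξ) := by
    refine ContDiff.mul ?_ ha
    exact contDiff_const.mul Complex.ofRealCLM.contDiff
  have hbc : HasCompactSupport (fun ξ : ℝ => (-2 * Real.pi * Complex.I * ξ) * a ξ) := hc.mul_left
  have h1 := continuous_fourier_of_hasCompactSupport ha hc
  have h2 := continuous_fourier_of_hasCompactSupport hb hbc
  refine (hasDerivAt_integral_of_dominated_loc_of_deriv_le (s := univ) Filter.univ_mem
    (bound := fun y => ‖F y‖ * ∫ ξ : ℝ, ‖(-2 * Real.pi * Complex.I * ξ) * a ξ‖)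
    (F' := fun x y => F y * 𝓕 (fun ξ : ℝ => (-2 * Real.pi * Complex.I * ξ) * a ξ) (x - y))
    ?_ ?_ ?_ ?_ ?_ ?_).2
  · refine Filter.Eventually.of_forall fun z => ?_
    exact hF.1.mul (h1.comp (continuous_const.sub continuous_id)).aestronglyMeasurable
  · exact hF.mul_bdd (h1.comp (continuous_const.sub continuous_id)).aestronglyMeasurable
      (Filter.Eventually.of_forall fun y => norm_fourier_le a _)
  · exact hF.1.mul (h2.comp (continuous_const.sub continuous_id)).aestronglyMeasurable
  · refine Filter.Eventually.of_forall fun y z _ => ?_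
    rw [norm_mul]
    exact mul_le_mul_of_nonneg_left (norm_fourier_le _ _) (norm_nonneg _)
  · exact hF.norm.mul_const _
  · refine Filter.Eventually.of_forall fun y z _ => ?_
    exact ((hasDerivAt_fourier_of_hasCompactSupport ha hc (z - y)).comp_sub_const z y).const_mul _

lemma iteratedDeriv_symbolConv {a F : ℝ → ℂ} (ha : ContDiff ℝ ∞ a) (hc : HasCompactSupport a)
    (hF : Integrable F) (i : ℕ) :
    iteratedDeriv i (symbolConv a F)
      = symbolConv (fun ξ : ℝ => (-2 * Real.pi * Complex.I * ξ) ^ i * a ξ) F := by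
  induction i with
  | zero => simp
  | succ i ih =>
    have hb : ContDiff ℝ ∞ (fun ξ : ℝ => (-2 * Real.pi * Complex.I * ξ) ^ i * a ξ) :=
      ((contDiff_const.mul Complex.ofRealCLM.contDiff).pow i).mul ha
    rw [iteratedDeriv_succ, ih]
    funext x
    rw [(hasDerivAt_symbolConv hb hc.mul_left hF x).deriv]
    congr 1
    funext ξ
    ring

lemma contDiff_symbolConv {a F : ℝ → ℂ} (ha : ContDiff ℝ ∞ a) (hc : HasCompactSupport a)
    (hF : Integrable F) : ContDiff ℝ ∞ (symbolConv a F) := by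
  refine contDiff_of_differentiable_iteratedDeriv fun m _ => ?_
  have hb : ContDiff ℝ ∞ (fun ξ : ℝ => (-2 * Real.pi * Complex.I * ξ) ^ m * a ξ) :=
    ((contDiff_const.mul Complex.ofRealCLM.contDiff).pow m).mul ha
  rw [iteratedDeriv_symbolConv ha hc hF]
  exact fun x => (hasDerivAt_symbolConv hb hc.mul_left hF x).differentiableAt

/-- Moving the symbol `(1 + (2πξ)²)^(s/2)` from the kernel to the function. -/
lemma symbolConv_eq_of_isBesselDerivative {a F G : ℝ → ℂ} {s : ℝ} (ha : ContDiff ℝ ∞ a)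
    (hc : HasCompactSupport a) (h : IsBesselDerivative s F G) :
    symbolConv a F = symbolConv (fun ξ => a ξ / besselSymbol s ξ) G := by
  funext x
  have hm : ContDiff ℝ ∞ (fun ξ => ((besselSymbol s ξ : ℝ) : ℂ)) :=
    Complex.ofRealCLM.contDiff.comp (contDiff_besselSymbol s)
  have hm0 : ∀ ξ, ((besselSymbol s ξ : ℝ) : ℂ) ≠ 0 := fun ξ => by
    exact_mod_cast (besselSymbol_pos s ξ).ne'
  set e : ℝ → ℂ := fun ξ => Complex.exp ((-2 * Real.pi * x * ξ : ℝ) * Complex.I) with he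
  have hes : ContDiff ℝ ∞ e := by
    refine ContDiff.cexp (ContDiff.mul (Complex.ofRealCLM.contDiff.comp ?_) contDiff_const)
    exact contDiff_const.mul contDiff_id
  have hcs : ContDiff ℝ ∞ (fun ξ => e ξ * (a ξ / besselSymbol s ξ)) := by
    simp_rw [div_eq_mul_inv]
    exact hes.mul (ha.mul (hm.inv hm0))
  have hcc : HasCompactSupport (fun ξ => e ξ * (a ξ / besselSymbol s ξ)) := by
    simp_rw [div_eq_mul_inv]
    exact (hc.mul_right).mul_left
  -- The inverse Fourier transform of c is y ↦ 𝓕(a/m)(x - y), with m the Bessel symbol. Applying (I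
  -- - d²/dx²)^(s/2) to it restores the kernel of a, so it is the right test function.
  set c : 𝓢(ℝ, ℂ) := hcc.toSchwartzMap hcs with hcdef
  have key : ∀ (b : ℝ → ℂ) y, 𝓕⁻ (fun ξ => e ξ * b ξ) y = 𝓕 b (x - y) := fun b y => by
    rw [Real.fourierInv_eq', Real.fourier_eq']
    congr 1
    funext ξ
    simp only [he, smul_eq_mul]
    rw [← mul_assoc, ← Complex.exp_add]
    congr 2
    simp
    ring
  have h1 : ∀ y, (𝓕⁻ c) y = 𝓕 (fun ξ => a ξ / besselSymbol s ξ) (x - y) := fun y => by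
    rw [SchwartzMap.fourierInv_coe, ← key]
    rfl
  have h2 : ∀ y, (SchwartzMap.fourierMultiplierCLM ℂ (besselSymbol s) (𝓕⁻ c)) y = 𝓕 a (x - y) :=
    fun y => by
    rw [SchwartzMap.fourierMultiplierCLM_apply, fourier_fourierInv_eq, SchwartzMap.fourierInv_coe,
      ← key]
    refine congrArg (fun b : ℝ → ℂ => 𝓕⁻ b y) (funext fun ξ => ?_)
    rw [SchwartzMap.smulLeftCLM_apply_apply (hasTemperateGrowth_besselSymbol s), Complex.real_smul]
    change (besselSymbol s ξ : ℂ) * (e ξ * (a ξ / besselSymbol s ξ)) = _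
    have := hm0 ξ
    field_simp
  have h3 := h (𝓕⁻ c)
  simp only [h1, h2] at h3
  exact h3.symm

/-- Kernels of a smooth family of compactly supported symbols decay uniformly. -/
lemma exists_norm_fourier_le {f : ℝ × ℝ → ℂ} (hf : ContDiff ℝ ∞ f) {R : ℝ}
    (hR : ∀ e ξ, R ≤ |ξ| → f (e, ξ) = 0) :
    ∃ C : ℝ≥0, ∀ e ∈ Icc (0 : ℝ) 1, ∀ x, ‖𝓕 (fun ξ => f (e, ξ)) x‖ ≤ C * (1 + x ^ 2)⁻¹ := by
  -- Two derivatives in ξ give the decay (1 + x²)⁻¹. The bounds are uniform in the parameter e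
  -- because the family is smooth on the compact set [0,1] × [-S,S].
  set v : ℝ × ℝ := (0, 1) with hv
  set f1 : ℝ × ℝ → ℂ := fun z => fderiv ℝ f z v with hf1
  set f2 : ℝ × ℝ → ℂ := fun z => fderiv ℝ f1 z v with hf2
  have h1 : ContDiff ℝ ∞ f1 := (hf.fderiv_right (m := ∞) (by simp)).clm_apply contDiff_const
  have h2 : ContDiff ℝ ∞ f2 := (h1.fderiv_right (m := ∞) (by simp)).clm_apply contDiff_const
  have hline : ∀ e ξ : ℝ, HasDerivAt (fun ξ : ℝ => (e, ξ)) v ξ := fun e ξ =>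
    (hasDerivAt_const ξ e).prodMk (hasDerivAt_id ξ)
  have hd : ∀ {g : ℝ × ℝ → ℂ}, ContDiff ℝ ∞ g → ∀ e ξ,
      HasDerivAt (fun ξ => g (e, ξ)) (fderiv ℝ g (e, ξ) v) ξ := fun hg e ξ =>
    ((hg.differentiable (by simp)) (e, ξ)).hasFDerivAt.comp_hasDerivAt ξ (hline e ξ)
  set S := |R| + 1 with hS
  have hsupp0 : ∀ e ξ, ξ ∉ Icc (-S) S → f (e, ξ) = 0 := fun e ξ h => by
    refine hR e ξ ?_
    by_contra hcon
    exact h (abs_le.1 ((not_le.1 hcon).le.trans (by linarith [le_abs_self R])))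
  have hsd : ∀ {g : ℝ × ℝ → ℂ}, ContDiff ℝ ∞ g → (∀ e ξ, ξ ∉ Icc (-S) S → g (e, ξ) = 0) →
      ∀ e ξ, ξ ∉ Icc (-S) S → fderiv ℝ g (e, ξ) v = 0 := fun {g} hg h e ξ hξ => by
    rw [← (hd hg e ξ).deriv]
    have : (fun ξ => g (e, ξ)) =ᶠ[nhds ξ] fun _ => 0 := by
      filter_upwards [isClosed_Icc.isOpen_compl.mem_nhds hξ] with y hy using h e y hy
    rw [this.deriv_eq, deriv_const]
  have hsupp1 := hsd hf hsupp0
  have hsupp2 := hsd h1 hsupp1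
  have hK : IsCompact (Icc (0 : ℝ) 1 ×ˢ Icc (-S) S) := isCompact_Icc.prod isCompact_Icc
  obtain ⟨B0, hB0⟩ := hK.exists_bound_of_continuousOn hf.continuous.continuousOn
  obtain ⟨B2, hB2⟩ := hK.exists_bound_of_continuousOn h2.continuous.continuousOn
  have hint : ∀ {g : ℝ × ℝ → ℂ}, ContDiff ℝ ∞ g → (∀ e ξ, ξ ∉ Icc (-S) S → g (e, ξ) = 0) →
      ∀ e, Integrable (fun ξ => g (e, ξ)) := fun hg h e =>
    (hg.continuous.comp (by fun_prop : Continuous fun ξ : ℝ => (e, ξ))).integrable_of_hasCompactSupport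
      (HasCompactSupport.of_support_subset_isCompact (isCompact_Icc (a := -S) (b := S))
        fun ξ hξ => by
          by_contra hcon
          exact hξ (h e ξ hcon))
  have hnorm : ∀ {g : ℝ × ℝ → ℂ} {B : ℝ}, ContDiff ℝ ∞ g →
      (∀ e ξ, ξ ∉ Icc (-S) S → g (e, ξ) = 0) →
      (∀ z ∈ Icc (0 : ℝ) 1 ×ˢ Icc (-S) S, ‖g z‖ ≤ B) → ∀ e ∈ Icc (0 : ℝ) 1,
      ∀ x, ‖𝓕 (fun ξ => g (e, ξ)) x‖ ≤ |B| * (2 * S) := fun {g B} hg h hB e he x => by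
    refine (norm_fourier_le _ _).trans ?_
    have e1 : ∫ ξ, ‖g (e, ξ)‖ = ∫ ξ in Icc (-S) S, ‖g (e, ξ)‖ :=
      (setIntegral_eq_integral_of_forall_compl_eq_zero fun ξ hξ => by rw [h e ξ hξ, norm_zero]).symm
    rw [e1]
    have e2 := setIntegral_mono_on (hint hg h e).norm.integrableOn
      (integrableOn_const (C := |B|) (s := Icc (-S) S) (μ := volume) (by simp)) measurableSet_Icc
      (fun ξ hξ => (hB (e, ξ) ⟨he, hξ⟩).trans (le_abs_self B))
    refine e2.trans_eq ?_
    have hS0 : 0 ≤ S := by positivity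
    rw [setIntegral_const, smul_eq_mul, Real.volume_real_Icc_of_le (by linarith)]
    ring
  have hD : ∀ e x, ‖𝓕 (fun ξ => f2 (e, ξ)) x‖ = (2 * Real.pi * x) ^ 2 * ‖𝓕 (fun ξ => f (e, ξ)) x‖ := by
    intro e x
    have e1 : (fun ξ => f1 (e, ξ)) = deriv fun ξ => f (e, ξ) :=
      funext fun ξ => (hd hf e ξ).deriv.symm
    have e2 : (fun ξ => f2 (e, ξ)) = deriv fun ξ => f1 (e, ξ) :=
      funext fun ξ => (hd h1 e ξ).deriv.symm
    have i0 := hint hf hsupp0 e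
    have i1 := hint h1 hsupp1 e
    have i2 := hint h2 hsupp2 e
    have g2 := congrFun (Real.fourier_deriv i1 (fun ξ => (hd h1 e ξ).differentiableAt)
      (by rwa [← e2])) x
    have g1 := congrFun (Real.fourier_deriv i0 (fun ξ => (hd hf e ξ).differentiableAt)
      (by rwa [← e1])) x
    have hn : ‖2 * (Real.pi : ℂ) * Complex.I * x‖ ^ 2 = (2 * Real.pi * x) ^ 2 := by
      rw [norm_mul, norm_mul, norm_mul, Complex.norm_I, Complex.norm_real, Complex.norm_real,
        mul_one, Complex.norm_ofNat, Real.norm_of_nonneg Real.pi_pos.le, Real.norm_eq_abs,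
        mul_pow, sq_abs, ← mul_pow]
    rw [e2, g2, e1, g1, norm_smul, norm_smul, ← mul_assoc, ← sq, hn]
  refine ⟨(|B0| * (2 * S) + |B2| * (2 * S)).toNNReal, fun e he x => ?_⟩
  rw [Real.coe_toNNReal _ (by positivity)]
  have n0 := hnorm hf hsupp0 hB0 e he x
  have n2 := hnorm h2 hsupp2 hB2 e he x
  rw [hD] at n2
  rw [← div_eq_mul_inv, le_div_iff₀ (by positivity)]
  have h3 : x ^ 2 ≤ (2 * Real.pi * x) ^ 2 := by
    rw [mul_pow]
    have : 1 ≤ (2 * Real.pi) ^ 2 := by nlinarith [Real.pi_gt_three]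
    nlinarith [sq_nonneg x]
  have h4 := mul_le_mul_of_nonneg_right h3 (norm_nonneg (𝓕 (fun ξ => f (e, ξ)) x))
  nlinarith

end FourierCutoff

/-! ### Averages against a bump at scale 1/L. -/

section PoissonWeight

/-- An `L¹`-normalised (up to a constant) bump at scale `1 / L`. -/
noncomputable def bumpWeight (L x : ℝ) : ℝ≥0∞ := ENNReal.ofReal (L * (1 + (L * x) ^ 2)⁻¹)

lemma measurable_bumpWeight (L : ℝ) : Measurable (bumpWeight L) := by
  unfold bumpWeight; fun_prop

lemma measurable_bumpWeight_sub (L x : ℝ) : Measurable fun y => bumpWeight L (x - y) :=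
  (measurable_bumpWeight L).comp (measurable_const.sub measurable_id)

lemma lintegral_bumpWeight {L : ℝ} (hL : 0 < L) :
    ∫⁻ x, bumpWeight L x = ENNReal.ofReal Real.pi := by
  unfold bumpWeight
  have hi : Integrable fun x : ℝ => (1 + (L * x) ^ 2)⁻¹ :=
    integrable_inv_one_add_sq.comp_mul_left' hL.ne'
  rw [← ofReal_integral_eq_lintegral_ofReal (hi.const_mul L)
    (Filter.Eventually.of_forall fun x => by positivity), integral_const_mul]
  have := Measure.integral_comp_mul_left (fun x : ℝ => (1 + x ^ 2)⁻¹) L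
  rw [this, integral_univ_inv_one_add_sq, abs_of_pos (inv_pos.2 hL), smul_eq_mul, ← mul_assoc,
    mul_inv_cancel₀ hL.ne', one_mul]

lemma bumpWeight_le {L : ℝ} (hL : 0 < L) (x : ℝ) : bumpWeight L x ≤ ENNReal.ofReal L := by
  unfold bumpWeight
  refine ENNReal.ofReal_le_ofReal (mul_le_of_le_one_right hL.le ?_)
  exact inv_le_one_of_one_le₀ (by nlinarith [sq_nonneg (L * x)])

lemma lintegral_bumpWeight_sub {L : ℝ} (hL : 0 < L) (x : ℝ) :
    ∫⁻ y, bumpWeight L (x - y) = ENNReal.ofReal Real.pi := by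
  rw [lintegral_sub_left_eq_self (bumpWeight L) x, lintegral_bumpWeight hL]

/-- Jensen's inequality for the bump as a measure in y, whose total mass is π rather than one; hence
the factor π^(q-1). -/
lemma lintegral_mul_bumpWeight_rpow_le {g : ℝ → ℝ≥0∞} (hg : AEMeasurable g) {L : ℝ} (hL : 0 < L)
    {q : ℝ} (hq : 1 ≤ q) (x : ℝ) :
    (∫⁻ y, g y * bumpWeight L (x - y)) ^ q
      ≤ ENNReal.ofReal Real.pi ^ (q - 1) * ∫⁻ y, g y ^ q * bumpWeight L (x - y) := by
  have hq0 : 0 < q := by linarith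
  have hE : Measurable fun y => bumpWeight L (x - y) :=
    measurable_bumpWeight_sub L x
  have h := ENNReal.lintegral_mul_norm_pow_le (μ := volume) (p := 1 / q) (q := 1 - 1 / q)
    ((hg.pow_const q).mul hE.aemeasurable) hE.aemeasurable (by positivity)
    (sub_nonneg.2 ((div_le_one hq0).2 hq)) (by ring)
  have e : ∀ y, (g y ^ q * bumpWeight L (x - y)) ^ (1 / q) * bumpWeight L (x - y) ^ (1 - 1 / q)
      = g y * bumpWeight L (x - y) := fun y => by
    rw [ENNReal.mul_rpow_of_nonneg _ _ (by positivity), ← ENNReal.rpow_mul, mul_one_div_cancel hq0.ne',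
      ENNReal.rpow_one, mul_assoc, ← ENNReal.rpow_add_of_nonneg _ _ (by positivity)
        (sub_nonneg.2 ((div_le_one hq0).2 hq))]
    simp
  simp only [Pi.mul_apply, e] at h
  rw [lintegral_bumpWeight_sub hL] at h
  refine (ENNReal.rpow_le_rpow h hq0.le).trans_eq ?_
  rw [ENNReal.mul_rpow_of_nonneg _ _ hq0.le, ← ENNReal.rpow_mul, ← ENNReal.rpow_mul,
    one_div_mul_cancel hq0.ne', ENNReal.rpow_one, mul_comm]
  congr 2
  field_simp

lemma lintegral_lintegral_mul_bumpWeight {g : ℝ → ℝ≥0∞} (hg : AEMeasurable g) {L : ℝ}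
    (hL : 0 < L) :
    ∫⁻ x, ∫⁻ y, g y * bumpWeight L (x - y) = ENNReal.ofReal Real.pi * ∫⁻ y, g y := by
  rw [lintegral_lintegral_swap]
  · have : ∀ y, ∫⁻ x, g y * bumpWeight L (x - y) = ENNReal.ofReal Real.pi * g y := fun y => by
      have hm : Measurable fun x => bumpWeight L (x - y) :=
        (measurable_bumpWeight L).comp (measurable_id.sub_const y)
      rw [lintegral_const_mul _ hm, lintegral_sub_right_eq_self (bumpWeight L) y,
        lintegral_bumpWeight hL, mul_comm]
    simp_rw [this]
    rw [lintegral_const_mul' _ _ ENNReal.ofReal_ne_top]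
  · exact (hg.comp_snd).mul ((measurable_bumpWeight L).comp (by fun_prop)).aemeasurable

lemma one_le_pi_ennreal : 1 ≤ ENNReal.ofReal Real.pi := by
  rw [ENNReal.one_le_ofReal]; linarith [Real.pi_gt_three]

lemma lintegral_mul_bumpWeight_le_top (G : ℝ → ℂ) {L : ℝ} (hL : 0 < L) (x : ℝ) :
    ∫⁻ y, ‖G y‖ₑ * bumpWeight L (x - y) ≤ ENNReal.ofReal Real.pi * eLpNorm G ⊤ := by
  have h : ∀ᵐ y, ‖G y‖ₑ * bumpWeight L (x - y) ≤ eLpNorm G ⊤ * bumpWeight L (x - y) := by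
    filter_upwards [ae_le_eLpNormEssSup (f := G) (μ := volume)] with y hy
    rw [eLpNorm_exponent_top]
    exact mul_le_mul_left hy _
  refine (lintegral_mono_ae h).trans_eq ?_
  rw [lintegral_const_mul _ (measurable_bumpWeight_sub L x), lintegral_bumpWeight_sub hL, mul_comm]

/-- The pointwise bound for averages at scale `1 / L` of an `L^q` function, `q ≥ 2`. -/
lemma lintegral_mul_bumpWeight_le {G : ℝ → ℂ} (hG : AEStronglyMeasurable G) {q : ℝ≥0∞}
    (hq : 2 ≤ q) {L : ℝ} (hL : 1 ≤ L) (x : ℝ) :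
    ∫⁻ y, ‖G y‖ₑ * bumpWeight L (x - y)
      ≤ ENNReal.ofReal (Real.pi * √L) * eLpNorm G q := by
  have hL0 : 0 < L := by linarith
  have hsq : 1 ≤ √L := by rw [Real.one_le_sqrt]; exact hL
  rcases eq_or_ne q ⊤ with rfl | hqt
  · refine (lintegral_mul_bumpWeight_le_top G hL0 x).trans ?_
    refine mul_le_mul_left (ENNReal.ofReal_le_ofReal ?_) _
    nlinarith [Real.pi_pos]
  · have hq0 : q ≠ 0 := (lt_of_lt_of_le (by norm_num) hq).ne'
    have hqr : 2 ≤ q.toReal := by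
      have := (ENNReal.toReal_le_toReal (by norm_num) hqt).2 hq
      simpa using this
    have hqp : 0 < q.toReal := by linarith
    have h1 := lintegral_mul_bumpWeight_rpow_le hG.enorm hL0 (by linarith : 1 ≤ q.toReal) x
    -- Bounding the bump by its maximum L costs L^(1/q) after the q-th root, and L^(1/q) ≤ √L
    -- because q ≥ 2.
    have h2 : ∫⁻ y, ‖G y‖ₑ ^ q.toReal * bumpWeight L (x - y)
        ≤ (∫⁻ y, ‖G y‖ₑ ^ q.toReal) * ENNReal.ofReal L := by
      rw [← lintegral_mul_const' _ _ ENNReal.ofReal_ne_top]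
      exact lintegral_mono fun y => mul_le_mul_right (bumpWeight_le hL0 _) _
    rw [← ENNReal.rpow_le_rpow_iff hqp]
    refine (h1.trans (mul_le_mul_right h2 _)).trans ?_
    rw [ENNReal.mul_rpow_of_nonneg _ _ hqp.le, eLpNorm_eq_lintegral_rpow_enorm_toReal hq0 hqt,
      ← ENNReal.rpow_mul, one_div_mul_cancel hqp.ne', ENNReal.rpow_one, mul_comm (∫⁻ y, _) _,
      ← mul_assoc, ENNReal.ofReal_mul Real.pi_pos.le, ENNReal.mul_rpow_of_nonneg _ _ hqp.le]
    refine mul_le_mul_left (mul_le_mul' ?_ ?_) _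
    · exact ENNReal.rpow_le_rpow_of_exponent_le one_le_pi_ennreal (by linarith)
    · rw [ENNReal.ofReal_rpow_of_pos (by linarith)]
      refine ENNReal.ofReal_le_ofReal ?_
      calc L = √L ^ (2 : ℝ) := by norm_cast; exact (Real.sq_sqrt hL0.le).symm
        _ ≤ √L ^ q.toReal := Real.rpow_le_rpow_of_exponent_le hsq hqr

/-- Young's inequality for averages at scale `1 / L`. -/
lemma multiplierNorm_le_of_bumpWeight {G H : ℝ → ℂ} (hG : AEStronglyMeasurable G) {q : ℝ≥0∞}
    (hq : 1 ≤ q) {L : ℝ} (hL : 0 < L) {K : ℝ≥0∞} (hK : K ≠ ⊤)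
    (hH : ∀ x, ‖H x‖ₑ ≤ K * ∫⁻ y, ‖G y‖ₑ * bumpWeight L (x - y)) :
    multiplierNorm q H ≤ K * ENNReal.ofReal Real.pi * eLpNorm G q := by
  unfold multiplierNorm
  split_ifs with hqt
  · subst hqt
    refine iSup_le fun x => (hH x).trans ?_
    rw [mul_assoc]
    exact mul_le_mul_right (lintegral_mul_bumpWeight_le_top G hL x) _
  · have hq0 : q ≠ 0 := (lt_of_lt_of_le one_pos hq).ne'
    have hqr : 1 ≤ q.toReal := by
      have := (ENNReal.toReal_le_toReal (by norm_num) hqt).2 hq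
      simpa using this
    have hqp : 0 < q.toReal := by linarith
    rw [← ENNReal.rpow_le_rpow_iff hqp, ENNReal.mul_rpow_of_nonneg _ _ hqp.le,
      ENNReal.mul_rpow_of_nonneg _ _ hqp.le,
      eLpNorm_eq_lintegral_rpow_enorm_toReal hq0 hqt, eLpNorm_eq_lintegral_rpow_enorm_toReal hq0 hqt,
      ← ENNReal.rpow_mul, ← ENNReal.rpow_mul, one_div_mul_cancel hqp.ne', ENNReal.rpow_one,
      ENNReal.rpow_one]
    have hm : AEMeasurable fun y => ‖G y‖ₑ ^ q.toReal := hG.enorm.pow_const _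
    calc ∫⁻ x, ‖H x‖ₑ ^ q.toReal
        ≤ ∫⁻ x, K ^ q.toReal * (ENNReal.ofReal Real.pi ^ (q.toReal - 1)
            * ∫⁻ y, ‖G y‖ₑ ^ q.toReal * bumpWeight L (x - y)) := by
          refine lintegral_mono fun x => ?_
          refine (ENNReal.rpow_le_rpow (hH x) hqp.le).trans ?_
          rw [ENNReal.mul_rpow_of_nonneg _ _ hqp.le]
          exact mul_le_mul_right (lintegral_mul_bumpWeight_rpow_le hG.enorm hL hqr x) _
      _ ≤ K ^ q.toReal * (ENNReal.ofReal Real.pi ^ (q.toReal - 1)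
            * (ENNReal.ofReal Real.pi * ∫⁻ y, ‖G y‖ₑ ^ q.toReal)) := by
          rw [← lintegral_lintegral_mul_bumpWeight hm hL]
          rw [lintegral_const_mul' _ _ (ENNReal.rpow_ne_top_of_nonneg hqp.le hK),
            lintegral_const_mul' _ _
              (ENNReal.rpow_ne_top_of_nonneg (by linarith) ENNReal.ofReal_ne_top)]
      _ = _ := by
          have hp : ENNReal.ofReal Real.pi ≠ 0 := by simp [Real.pi_pos]
          have e : ENNReal.ofReal Real.pi ^ (q.toReal - 1) * ENNReal.ofReal Real.pi
              = ENNReal.ofReal Real.pi ^ q.toReal := by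
            nth_rewrite 2 [← ENNReal.rpow_one (ENNReal.ofReal Real.pi)]
            rw [← ENNReal.rpow_add _ _ hp ENNReal.ofReal_ne_top]
            simp
          rw [← e]
          ring

end PoissonWeight

/-! ### Dyadic partition of the frequency line. -/

section DyadicDecomposition

open FourierTransform
open scoped ContDiff

lemma exists_fourierCutoff : ∃ θ : ℝ → ℂ, ContDiff ℝ ∞ θ ∧ (∀ x, |x| ≤ 1 → θ x = 1) ∧
    (∀ x, 2 ≤ |x| → θ x = 0) := by
  let f : ContDiffBump (0 : ℝ) := ⟨1, 2, one_pos, one_lt_two⟩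
  refine ⟨fun x => (f x : ℂ), Complex.ofRealCLM.contDiff.comp f.contDiff, fun x hx => ?_,
    fun x hx => ?_⟩
  · change ((f x : ℝ) : ℂ) = 1
    rw [f.one_of_mem_closedBall (by simpa [Metric.mem_closedBall] using hx), Complex.ofReal_one]
  · change ((f x : ℝ) : ℂ) = 0
    rw [f.zero_of_le_dist (by simpa using hx), Complex.ofReal_zero]

/-- The pieces of the dyadic partition of unity on the frequency side built from `θ`. -/
noncomputable def dyadicPiece (θ : ℝ → ℂ) : ℕ → ℝ → ℂ
  | 0 => θ
  | j + 1 => fun ξ => θ (ξ / 2 ^ (j + 1)) - θ (ξ / 2 ^ j)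

variable {θ : ℝ → ℂ}

lemma sum_dyadicPiece (θ : ℝ → ℂ) (J : ℕ) (ξ : ℝ) :
    ∑ j ∈ Finset.range (J + 1), dyadicPiece θ j ξ = θ (ξ / 2 ^ J) := by
  induction J with
  | zero => simp [dyadicPiece]
  | succ J ih => rw [Finset.sum_range_succ, ih]; simp [dyadicPiece]

lemma contDiff_dyadicPiece (hθ : ContDiff ℝ ∞ θ) (j : ℕ) : ContDiff ℝ ∞ (dyadicPiece θ j) := by
  cases j with
  | zero => exact hθ
  | succ j => exact (hθ.comp (contDiff_id.div_const _)).sub (hθ.comp (contDiff_id.div_const _))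

lemma hasCompactSupport_of_abs {θ : ℝ → ℂ} {R : ℝ} (h : ∀ x, R ≤ |x| → θ x = 0) :
    HasCompactSupport θ :=
  HasCompactSupport.of_support_subset_isCompact (isCompact_Icc (a := -R) (b := R)) fun x hx => by
    by_contra hcon
    refine hx (h x ?_)
    by_contra hlt
    exact hcon (abs_le.1 (not_le.1 hlt).le)

lemma dyadicPiece_eq_zero (hθ : ∀ x, 2 ≤ |x| → θ x = 0) (j : ℕ) (ξ : ℝ)
    (hξ : 2 * 2 ^ j ≤ |ξ|) : dyadicPiece θ j ξ = 0 := by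
  cases j with
  | zero => exact hθ ξ (by simpa using hξ)
  | succ j =>
    have h1 : (2 : ℝ) ≤ |ξ / 2 ^ (j + 1)| := by
      rw [abs_div, abs_of_pos (by positivity : (0 : ℝ) < 2 ^ (j + 1)), le_div_iff₀ (by positivity)]
      exact hξ
    have h2 : (2 : ℝ) ≤ |ξ / 2 ^ j| := by
      rw [abs_div, abs_of_pos (by positivity : (0 : ℝ) < 2 ^ j), le_div_iff₀ (by positivity)]
      rw [pow_succ] at hξ
      nlinarith [pow_pos (two_pos : (0 : ℝ) < 2) j]
    simp only [dyadicPiece, hθ _ h1, hθ _ h2, sub_zero]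

lemma fourier_comp_div (h : ℝ → ℂ) (c : ℂ) {L : ℝ} (hL : 0 < L) (x : ℝ) :
    𝓕 (fun ξ => c * h (ξ / L)) x = c * (L * 𝓕 h (L * x)) := by
  rw [Real.fourier_eq', Real.fourier_eq']
  have e := Measure.integral_comp_mul_left
    (fun ξ : ℝ => Complex.exp ((-2 * Real.pi * inner ℝ ξ (L * x) : ℝ) * Complex.I) • h ξ) L⁻¹
  rw [inv_inv, abs_of_pos hL] at e
  rw [← Complex.real_smul, ← e, ← integral_const_mul]
  congr 1
  funext ξ
  have e2 : inner ℝ (L⁻¹ * ξ) (L * x) = inner ℝ ξ x := by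
    simp
    field_simp
  rw [e2, div_eq_inv_mul]
  simp only [smul_eq_mul]
  ring

/-- The kernels of the dyadic pieces, with the symbol `(1 + (2πξ)²)^(s/2)` removed. -/
lemma exists_norm_fourier_dyadicPiece_le (hθ : ContDiff ℝ ∞ θ) (h1 : ∀ x, |x| ≤ 1 → θ x = 1)
    (h2 : ∀ x, 2 ≤ |x| → θ x = 0) (s : ℝ) (i : ℕ) :
    ∃ C : ℝ≥0, ∀ j x, ‖𝓕 (fun ξ : ℝ => (-2 * Real.pi * Complex.I * ξ) ^ i * dyadicPiece θ j ξ
      / besselSymbol s ξ) x‖ₑ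
      ≤ C * ENNReal.ofReal (((2 : ℝ) ^ j) ^ (i - s)) * bumpWeight (2 ^ j) x := by
  have hpoly : ContDiff ℝ ∞ fun z : ℝ × ℝ => (-2 * Real.pi * Complex.I * (z.2 : ℂ)) ^ i :=
    (contDiff_const.mul (Complex.ofRealCLM.contDiff.comp contDiff_snd)).pow i
  obtain ⟨C0, hC0⟩ : ∃ C : ℝ≥0, ∀ e ∈ Icc (0 : ℝ) 1, ∀ x, ‖𝓕 (fun ξ : ℝ =>
      (-2 * Real.pi * Complex.I * ξ) ^ i * θ ξ * (besselSymbol (-s) ξ : ℝ)) x‖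
        ≤ C * (1 + x ^ 2)⁻¹ := by
    refine exists_norm_fourier_le (f := fun z => (-2 * Real.pi * Complex.I * (z.2 : ℂ)) ^ i * θ z.2
      * (besselSymbol (-s) z.2 : ℝ)) (R := 2) ?_ fun e ξ hξ => by simp [h2 ξ hξ]
    exact (hpoly.mul (hθ.comp contDiff_snd)).mul
      (Complex.ofRealCLM.contDiff.comp ((contDiff_besselSymbol _).comp contDiff_snd))
  -- For j ≥ 1 the j-th piece is ψ(ξ/2^j), with ψ vanishing near the origin.
  set ψ : ℝ → ℂ := fun ζ => θ ζ - θ (2 * ζ) with hψ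
  have hψs : ContDiff ℝ ∞ ψ := hθ.sub (hθ.comp (contDiff_const.mul contDiff_id))
  have hψ0 : ∀ ζ, |ζ| ≤ 1 / 2 → ψ ζ = 0 := fun ζ hζ => by
    simp only [hψ]
    rw [h1 ζ (by linarith), h1 (2 * ζ) (by rw [abs_mul, abs_two]; linarith), sub_self]
  have hψ2 : ∀ ζ, 2 ≤ |ζ| → ψ ζ = 0 := fun ζ hζ => by
    simp only [hψ]
    rw [h2 ζ hζ, h2 (2 * ζ) (by rw [abs_mul, abs_two]; linarith), sub_self]
  -- With ξ = Lζ, the inverse Bessel symbol is L^(-s) w(L⁻¹, ζ). The parameter L⁻¹ stays in [0,1],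
  -- and the product with ψ is smooth up to parameter 0: w is singular only at the origin, and ψ
  -- vanishes for ζ near 0.
  set w : ℝ × ℝ → ℝ := fun z => (z.1 ^ 2 + (2 * Real.pi * z.2) ^ 2) ^ (-s / 2) with hw
  have hψw : ContDiff ℝ ∞ fun z : ℝ × ℝ => ψ z.2 * (w z : ℂ) := by
    rw [contDiff_iff_contDiffAt]
    intro z
    rcases eq_or_ne z.2 0 with hz | hz
    · have : (fun z : ℝ × ℝ => ψ z.2 * (w z : ℂ)) =ᶠ[nhds z] fun _ => 0 := by
        have hc : ContinuousAt (fun z : ℝ × ℝ => |z.2|) z := continuous_snd.abs.continuousAt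
        have : ∀ᶠ y in nhds z, |y.2| < 1 / 2 := hc.eventually_lt_const (by simp [hz])
        filter_upwards [this] with y hy
        rw [hψ0 _ hy.le, zero_mul]
      exact contDiffAt_const.congr_of_eventuallyEq this
    · refine ((hψs.comp contDiff_snd).contDiffAt).mul
        (Complex.ofRealCLM.contDiff.contDiffAt.comp z ?_)
      refine ContDiffAt.rpow_const_of_ne (by fun_prop) ?_
      have : 0 < (2 * Real.pi * z.2) ^ 2 := by
        have := Real.pi_ne_zero
        positivity
      positivity
  obtain ⟨C1, hC1⟩ : ∃ C : ℝ≥0, ∀ e ∈ Icc (0 : ℝ) 1, ∀ x, ‖𝓕 (fun ξ : ℝ =>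
      (-2 * Real.pi * Complex.I * ξ) ^ i * (ψ ξ * (w (e, ξ) : ℂ))) x‖ ≤ C * (1 + x ^ 2)⁻¹ :=
    exists_norm_fourier_le (f := fun z => (-2 * Real.pi * Complex.I * (z.2 : ℂ)) ^ i *
      (ψ z.2 * (w z : ℂ))) (R := 2) (hpoly.mul hψw) fun e ξ hξ => by simp [hψ2 ξ hξ]
  have hfin : ∀ {C : ℝ≥0} {c L x a : ℝ}, 0 ≤ c → 0 ≤ L → a ≤ C * c * (L * (1 + (L * x) ^ 2)⁻¹) →
      ENNReal.ofReal a ≤ C * ENNReal.ofReal c * bumpWeight L x := fun {C c L x a} hc hL h => by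
    refine (ENNReal.ofReal_le_ofReal h).trans_eq ?_
    rw [ENNReal.ofReal_mul (by positivity), ENNReal.ofReal_mul C.coe_nonneg, bumpWeight,
      ENNReal.ofReal_coe_nnreal]
  refine ⟨max C0 C1, fun j x => ?_⟩
  rw [← ofReal_norm]
  refine hfin (by positivity) (by positivity) ?_
  cases j with
  | zero =>
    have h := hC0 0 (by simp) x
    have e : (fun ξ : ℝ => (-2 * Real.pi * Complex.I * ξ) ^ i * dyadicPiece θ 0 ξ
        / besselSymbol s ξ) = fun ξ : ℝ => (-2 * Real.pi * Complex.I * ξ) ^ i * θ ξ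
          * (besselSymbol (-s) ξ : ℝ) := by
      funext ξ
      have : besselSymbol (-s) ξ = (besselSymbol s ξ)⁻¹ := by
        unfold besselSymbol
        rw [neg_div, Real.rpow_neg (by positivity)]
      rw [this, Complex.ofReal_inv, div_eq_mul_inv]
      rfl
    rw [e]
    simp only [pow_zero, Real.one_rpow, one_mul, mul_one]
    refine h.trans ?_
    gcongr
    exact le_max_left _ _
  | succ j =>
    set L : ℝ := 2 ^ (j + 1) with hL
    have hL0 : 0 < L := by positivity
    have hL1 : 1 ≤ L := one_le_pow₀ one_le_two
    have e : (fun ξ : ℝ => (-2 * Real.pi * Complex.I * ξ) ^ i * dyadicPiece θ (j + 1) ξ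
        / besselSymbol s ξ) = fun ξ : ℝ => ((L ^ (i - s) : ℝ) : ℂ) *
          (fun ζ : ℝ => (-2 * Real.pi * Complex.I * ζ) ^ i * (ψ ζ * (w (L⁻¹, ζ) : ℂ))) (ξ / L) := by
      funext ξ
      have a1 : dyadicPiece θ (j + 1) ξ = ψ (ξ / L) := by
        simp only [dyadicPiece, hψ]
        congr 2
        rw [hL, pow_succ]
        field_simp
      have a2 : ((besselSymbol s ξ : ℝ))⁻¹ = L ^ (-s) * w (L⁻¹, ξ / L) := by
        simp only [besselSymbol, hw]
        have : 1 + (2 * Real.pi * ξ) ^ 2 = L ^ (2 : ℝ) * (L⁻¹ ^ 2 + (2 * Real.pi * (ξ / L)) ^ 2) := by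
          norm_cast
          field_simp
        rw [this, Real.mul_rpow (by positivity) (by positivity), mul_inv, ← Real.rpow_mul hL0.le,
          ← Real.rpow_neg hL0.le, ← Real.rpow_neg (by positivity)]
        congr 2 <;> ring
      have a3 : L ^ (i - s) = L ^ i * L ^ (-s) := by
        rw [sub_eq_add_neg, Real.rpow_add hL0, Real.rpow_natCast]
      rw [a1, a3, div_eq_mul_inv _ ((besselSymbol s ξ : ℝ) : ℂ), ← Complex.ofReal_inv, a2]
      push_cast
      have : (L : ℂ) ≠ 0 := by exact_mod_cast hL0.ne'
      rw [mul_div_assoc' _ (ξ : ℂ), div_pow]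
      field_simp
    rw [e, fourier_comp_div (fun ζ : ℝ => (-2 * Real.pi * Complex.I * ζ) ^ i *
      (ψ ζ * (w (L⁻¹, ζ) : ℂ))) _ hL0, norm_mul, norm_mul, Complex.norm_real, Complex.norm_real,
      Real.norm_of_nonneg hL0.le, Real.norm_of_nonneg (by positivity)]
    have h := hC1 L⁻¹ ⟨by positivity, inv_le_one_of_one_le₀ hL1⟩ (L * x)
    calc _ ≤ L ^ ((i : ℝ) - s) * (L * (C1 * (1 + (L * x) ^ 2)⁻¹)) := by gcongr
      _ = C1 * L ^ ((i : ℝ) - s) * (L * (1 + (L * x) ^ 2)⁻¹) := by ring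
      _ ≤ _ := by gcongr; exact le_max_right _ _

end DyadicDecomposition

/-! ### Littlewood-Paley decomposition of Sobolev functions. -/

section LittlewoodPaley

open FourierTransform
open scoped ContDiff

lemma integrable_symbolConv {a F : ℝ → ℂ} (ha : ContDiff ℝ ∞ a) (hc : HasCompactSupport a)
    (hF : Integrable F) (x : ℝ) : Integrable fun y => F y * 𝓕 a (x - y) :=
  hF.mul_bdd (((continuous_fourier_of_hasCompactSupport ha hc).comp
    (continuous_const.sub continuous_id)).aestronglyMeasurable)
    (Filter.Eventually.of_forall fun _ => norm_fourier_le a _)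

lemma enorm_symbolConv_le {a : ℝ → ℂ} {K : ℝ≥0∞} {L : ℝ}
    (h : ∀ x, ‖𝓕 a x‖ₑ ≤ K * bumpWeight L x) (hK : K ≠ ⊤) (G : ℝ → ℂ) (x : ℝ) :
    ‖symbolConv a G x‖ₑ ≤ K * ∫⁻ y, ‖G y‖ₑ * bumpWeight L (x - y) := by
  refine (enorm_integral_le_lintegral_enorm _).trans ?_
  rw [← lintegral_const_mul' _ _ hK]
  refine lintegral_mono fun y => ?_
  rw [enorm_mul]
  calc ‖G y‖ₑ * ‖𝓕 a (x - y)‖ₑ ≤ ‖G y‖ₑ * (K * bumpWeight L (x - y)) := mul_le_mul_right (h _) _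
    _ = _ := by ring

lemma symbolConv_sub {a F G : ℝ → ℂ} (ha : ContDiff ℝ ∞ a) (hc : HasCompactSupport a)
    (hF : Integrable F) (hG : Integrable G) (x : ℝ) :
    symbolConv a (fun y => F y - G y) x = symbolConv a F x - symbolConv a G x := by
  unfold symbolConv
  rw [← integral_sub (integrable_symbolConv ha hc hF x) (integrable_symbolConv ha hc hG x)]
  simp only [sub_mul]

lemma symbolConv_finsetSum {F : ℝ → ℂ} (hF : Integrable F) {ι : Type*} (S : Finset ι)
    (a : ι → ℝ → ℂ) (ha : ∀ j, ContDiff ℝ ∞ (a j)) (hc : ∀ j, HasCompactSupport (a j)) (x : ℝ) :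
    ∑ j ∈ S, symbolConv (a j) F x = symbolConv (fun ξ => ∑ j ∈ S, a j ξ) F x := by
  unfold symbolConv
  rw [← integral_finsetSum _ fun j _ => integrable_symbolConv (ha j) (hc j) hF x]
  congr 1
  funext y
  rw [← Finset.mul_sum, Real.fourier_eq]
  congr 1
  simp only [Real.fourier_eq]
  rw [← integral_finsetSum]
  · simp only [Finset.smul_sum]
  · intro j _
    exact (Real.fourierIntegral_convergent_iff _).2
      ((ha j).continuous.integrable_of_hasCompactSupport (hc j))

variable {θ : ℝ → ℂ}

lemma contDiff_comp_div (hθ : ContDiff ℝ ∞ θ) (L : ℝ) : ContDiff ℝ ∞ fun ξ => θ (ξ / L) :=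
  hθ.comp (contDiff_id.div_const _)

lemma hasCompactSupport_comp_div (h2 : ∀ x, 2 ≤ |x| → θ x = 0) {L : ℝ} (hL : 0 < L) :
    HasCompactSupport fun ξ => θ (ξ / L) :=
  hasCompactSupport_of_abs (R := 2 * L) fun x hx => h2 _ (by
    rwa [abs_div, abs_of_pos hL, le_div_iff₀ hL])

lemma exists_norm_fourier_cutoff_le (hθ : ContDiff ℝ ∞ θ) (h2 : ∀ x, 2 ≤ |x| → θ x = 0) :
    ∃ C : ℝ≥0, ∀ L, 0 < L → ∀ x, ‖𝓕 (fun ξ => θ (ξ / L)) x‖ₑ ≤ C * bumpWeight L x := by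
  obtain ⟨C, hC⟩ := exists_norm_fourier_le (f := fun z => θ z.2) (R := 2)
    (hθ.comp contDiff_snd) (fun e ξ h => h2 ξ h)
  refine ⟨C, fun L hL x => ?_⟩
  have e := fourier_comp_div θ 1 hL x
  simp only [one_mul] at e
  rw [e, bumpWeight, ← ENNReal.ofReal_coe_nnreal, ← ENNReal.ofReal_mul C.coe_nonneg, ← ofReal_norm,
    norm_mul, Complex.norm_real, Real.norm_of_nonneg hL.le]
  refine ENNReal.ofReal_le_ofReal ?_
  calc L * ‖𝓕 θ (L * x)‖ ≤ L * (C * (1 + (L * x) ^ 2)⁻¹) := by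
        gcongr
        exact hC 0 (by simp) _
    _ = _ := by ring

/-- Uniform approximation of continuous functions by their low-frequency parts. -/
lemma eventually_norm_symbolConv_sub_le (hθ : ContDiff ℝ ∞ θ) (h1 : ∀ x, |x| ≤ 1 → θ x = 1)
    (h2 : ∀ x, 2 ≤ |x| → θ x = 0) {g : ℝ → ℂ} (hg : Continuous g) (hgc : HasCompactSupport g)
    {ε : ℝ} (hε : 0 < ε) :
    ∀ᶠ J : ℕ in Filter.atTop, ∀ x, ‖g x - symbolConv (fun ξ => θ (ξ / 2 ^ J)) g x‖ ≤ ε := by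
  have hθc : HasCompactSupport θ := hasCompactSupport_of_abs h2
  set κ : 𝓢(ℝ, ℂ) := 𝓕 (hθc.toSchwartzMap hθ) with hκ
  have hκe : ∀ x, κ x = 𝓕 θ x := fun x => rfl
  have hκi : Integrable κ := κ.integrable
  have hκ1 : Integrable fun x => |x| * ‖κ x‖ := by simpa using κ.integrable_pow_mul volume 1
  -- By Fourier inversion the kernel has integral θ(0) = 1.
  have hκint : ∫ x, κ x = 1 := by
    have e : 𝓕⁻ κ = hθc.toSchwartzMap hθ := by rw [hκ, fourierInv_fourier_eq]
    have e2 : (𝓕⁻ κ) 0 = 1 := by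
      rw [e]
      exact h1 0 (by simp)
    rw [← e2, SchwartzMap.fourierInv_coe, Real.fourierInv_eq']
    simp
  obtain ⟨B, hB⟩ := hg.bounded_above_of_compact_support hgc
  have hB0 : 0 ≤ B := (norm_nonneg _).trans (hB 0)
  set A0 := ∫ x, ‖κ x‖ with hA0
  set A1 := ∫ x, |x| * ‖κ x‖ with hA1
  have hA00 : 0 ≤ A0 := integral_nonneg fun x => norm_nonneg _
  have hA10 : 0 ≤ A1 := integral_nonneg fun x => by positivity
  set η := ε / (2 * (A0 + 1)) with hη
  have hη0 : 0 < η := by positivity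
  obtain ⟨δ, hδ, hgδ⟩ := Metric.uniformContinuous_iff.1 (hgc.uniformContinuous_of_continuous hg)
    η hη0
  have hlim : Filter.Tendsto (fun J : ℕ => (2 * B / δ * A1) / (2 : ℝ) ^ J) Filter.atTop (nhds 0) :=
    tendsto_const_nhds.div_atTop (tendsto_pow_atTop_atTop_of_one_lt one_lt_two)
  filter_upwards [hlim.eventually_le_const (half_pos hε)] with J hJ x
  set L : ℝ := 2 ^ J with hL
  have hL0 : 0 < L := by positivity
  have e1 : symbolConv (fun ξ => θ (ξ / L)) g x = ∫ z, g (x - z / L) * κ z := by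
    unfold symbolConv
    have e := fourier_comp_div θ 1 hL0
    simp only [one_mul] at e
    simp only [e]
    have s1 := integral_sub_left_eq_self (fun y : ℝ => g (x - (L * y) / L) * κ (L * y)) volume x
    have s2 := Measure.integral_comp_mul_left (fun z : ℝ => g (x - z / L) * κ z) L
    rw [s2, abs_of_pos (inv_pos.2 hL0), Complex.real_smul] at s1
    have hLC : (L : ℂ) ≠ 0 := by exact_mod_cast hL0.ne'
    have s3 : ∫ z, g (x - z / L) * κ z = L * ∫ y, g (x - (L * (x - y)) / L) * κ (L * (x - y)) := by
      rw [s1]; push_cast; rw [← mul_assoc, mul_inv_cancel₀ hLC, one_mul]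
    rw [s3, ← integral_const_mul]
    congr 1
    funext y
    rw [mul_div_cancel_left₀ _ hL0.ne', sub_sub_cancel, ← hκe]
    ring
  have hgm : Continuous fun z : ℝ => g (x - z / L) := hg.comp (by fun_prop)
  have hi1 : Integrable fun z => g (x - z / L) * κ z :=
    hκi.bdd_mul hgm.aestronglyMeasurable (Filter.Eventually.of_forall fun z => hB _)
  have e2 : g x - ∫ z, g (x - z / L) * κ z = ∫ z, (g x - g (x - z / L)) * κ z := by
    simp only [sub_mul]
    rw [integral_sub (hκi.const_mul _) hi1, integral_const_mul, hκint, mul_one]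
  rw [e1, e2]
  -- If |z/L| < δ, uniform continuity applies; otherwise |z|/(Lδ) ≥ 1 and the first moment of κ
  -- pays, with a factor 1/L.
  have hpt : ∀ z, ‖(g x - g (x - z / L)) * κ z‖
      ≤ η * ‖κ z‖ + (2 * B / δ / L) * (|z| * ‖κ z‖) := fun z => by
    rw [norm_mul]
    have h3 : ‖g x - g (x - z / L)‖ ≤ η + 2 * B / δ / L * |z| := by
      rcases lt_or_ge |z / L| δ with h | h
      · have := hgδ (a := x) (b := x - z / L) (by rw [Real.dist_eq]; simpa using h)
        rw [dist_eq_norm] at this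
        have h5 : 0 ≤ 2 * B / δ / L * |z| := by positivity
        linarith
      · have h4 := (norm_sub_le (g x) (g (x - z / L))).trans (add_le_add (hB _) (hB _))
        rw [abs_div, abs_of_pos hL0] at h
        have : 2 * B ≤ 2 * B / δ / L * |z| := by
          have e : 2 * B / δ / L * |z| = 2 * B * ((|z| / L) / δ) := by field_simp
          rw [e]
          exact le_mul_of_one_le_right (by positivity) ((one_le_div hδ).2 h)
        linarith
    calc _ ≤ (η + 2 * B / δ / L * |z|) * ‖κ z‖ := by gcongr
      _ = _ := by ring
  refine (norm_integral_le_of_norm_le ((hκi.norm.const_mul η).add (hκ1.const_mul _))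
    (Filter.Eventually.of_forall hpt)).trans ?_
  simp only [Pi.add_apply]
  rw [integral_add (hκi.norm.const_mul η) (hκ1.const_mul _), integral_const_mul, integral_const_mul]
  have h6 : η * A0 ≤ ε / 2 := by
    rw [hη, div_mul_eq_mul_div, div_le_div_iff₀ (by positivity) two_pos]
    nlinarith
  have h7 : 2 * B / δ / L * A1 ≤ ε / 2 := by
    refine le_trans (le_of_eq ?_) hJ
    ring
  linarith

/-- Convergence of the low-frequency parts in the multiplier norm, after localization. -/
lemma tendsto_multiplierNorm_sub (hθ : ContDiff ℝ ∞ θ) (h1 : ∀ x, |x| ≤ 1 → θ x = 1)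
    (h2 : ∀ x, 2 ≤ |x| → θ x = 0) {q : ℝ≥0∞} (hq : 1 ≤ q) {F : ℝ → ℂ} (hF : Measurable F)
    {B : ℝ} (hFb : ∀ t, ‖F t‖ ≤ B) (hFc : HasCompactSupport F) (hFq : q = ⊤ → Continuous F)
    {χ : ℝ → ℂ} (hχ : Continuous χ) (hχ1 : ∀ t, ‖χ t‖ ≤ 1) (hχF : ∀ t, χ t * F t = F t)
    (hχ0 : ∀ t, t ∉ Icc (0 : ℝ) 1 → χ t = 0) :
    Filter.Tendsto (fun J : ℕ => multiplierNorm q fun t =>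
      F t - χ t * symbolConv (fun ξ => θ (ξ / 2 ^ J)) F t) Filter.atTop (nhds 0) := by
  have e0 : ∀ J : ℕ, (fun t => F t - χ t * symbolConv (fun ξ => θ (ξ / 2 ^ J)) F t)
      = fun t => χ t * (F t - symbolConv (fun ξ => θ (ξ / 2 ^ J)) F t) := fun J => by
    funext t; rw [mul_sub, hχF]
  simp only [e0]
  have hle : ∀ {z : ℂ} {ε : ℝ} (t : ℝ), 0 ≤ ε → ‖z‖ ≤ ε → ‖χ t * z‖ₑ ≤ ENNReal.ofReal ε :=
    fun {z ε} t hε hz => by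
      rw [← ofReal_norm]
      refine ENNReal.ofReal_le_ofReal ?_
      rw [norm_mul]
      exact (mul_le_of_le_one_left (norm_nonneg _) (hχ1 t)).trans hz
  rcases eq_or_ne q ⊤ with hqt | hqt
  · rw [ENNReal.tendsto_nhds_zero]
    intro ε hε
    rcases eq_or_ne ε ⊤ with rfl | hεt
    · exact Filter.Eventually.of_forall fun _ => le_top
    have hε' : 0 < ε.toReal := ENNReal.toReal_pos hε.ne' hεt
    filter_upwards [eventually_norm_symbolConv_sub_le hθ h1 h2 (hFq hqt) hFc hε'] with J hJ
    rw [multiplierNorm, if_pos hqt]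
    refine iSup_le fun t => (hle t hε'.le (hJ t)).trans_eq (ENNReal.ofReal_toReal hεt)
  · have hq0 : q ≠ 0 := (lt_of_lt_of_le one_pos hq).ne'
    obtain ⟨C, hC⟩ := exists_norm_fourier_cutoff_le hθ h2
    have hFm : ∀ r : ℝ≥0∞, MemLp F r := fun r => by
      have hb : MemLp F ⊤ := memLp_top_of_bound hF.aestronglyMeasurable B
        (Filter.Eventually.of_forall hFb)
      exact hb.mono_exponent_of_measure_support_ne_top
        (fun x hx => image_eq_zero_of_notMem_tsupport hx) hFc.measure_lt_top.ne le_top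
    have hFi : Integrable F := memLp_one_iff_integrable.1 (hFm 1)
    -- F is compared with a C_c function g at L^q distance δ. The errors of F - g, of g - Pg and of
    -- P(g - F) are δ, δ and a multiple of δ; D is the total.
    set D : ℝ≥0∞ := 1 + 1 + C * ENNReal.ofReal Real.pi with hD
    have hDt : D ≠ ⊤ := by
      rw [hD]
      exact ENNReal.add_ne_top.2 ⟨by simp, ENNReal.mul_ne_top ENNReal.coe_ne_top ENNReal.ofReal_ne_top⟩
    have hD0 : D ≠ 0 := by simp [hD]
    rw [ENNReal.tendsto_nhds_zero]
    intro ε hε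
    rcases eq_or_ne ε ⊤ with rfl | hεt
    · exact Filter.Eventually.of_forall fun _ => le_top
    set δ := ε / D with hδ
    have hδ0 : δ ≠ 0 := (ENNReal.div_pos hε.ne' hDt).ne'
    have hδt : δ ≠ ⊤ := ENNReal.div_ne_top hεt hD0
    obtain ⟨g, hgc, hgF, hg, hgm⟩ := (hFm q).exists_hasCompactSupport_eLpNorm_sub_le hqt hδ0
    have hgi : Integrable g := hg.integrable_of_hasCompactSupport hgc
    have hδ' : 0 < δ.toReal := ENNReal.toReal_pos hδ0 hδt
    filter_upwards [eventually_norm_symbolConv_sub_le hθ h1 h2 hg hgc hδ'] with J hJ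
    rw [multiplierNorm, if_neg hqt]
    have hL0 : (0 : ℝ) < 2 ^ J := by positivity
    have has := contDiff_comp_div hθ (2 ^ J)
    have hac := hasCompactSupport_comp_div h2 hL0
    set P := fun H : ℝ → ℂ => symbolConv (fun ξ => θ (ξ / 2 ^ J)) H with hP
    have hsplit : (fun t => χ t * (F t - P F t)) = (fun t => χ t * (F t - g t))
        + (fun t => χ t * (g t - P g t)) + fun t => χ t * P (fun y => g y - F y) t := by
      funext t
      simp only [Pi.add_apply, hP]
      rw [symbolConv_sub has hac hgi hFi]
      ring
    have hχm := hχ.aestronglyMeasurable (μ := volume)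
    have m1 : AEStronglyMeasurable (fun t => χ t * (F t - g t)) volume :=
      hχm.mul (hF.aestronglyMeasurable.sub hg.aestronglyMeasurable)
    have m2 : AEStronglyMeasurable (fun t => χ t * (g t - P g t)) volume :=
      hχm.mul (hg.sub (contDiff_symbolConv has hac hgi).continuous).aestronglyMeasurable
    have m3 : AEStronglyMeasurable (fun t => χ t * P (fun y => g y - F y) t) volume :=
      hχm.mul (contDiff_symbolConv has hac (hgi.sub hFi)).continuous.aestronglyMeasurable
    have hmul : ∀ H : ℝ → ℂ, eLpNorm (fun t => χ t * H t) q volume ≤ eLpNorm H q volume := fun H =>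
      eLpNorm_mono fun t => by
        rw [norm_mul]
        exact mul_le_of_le_one_left (norm_nonneg _) (hχ1 t)
    have n1 : eLpNorm (fun t => χ t * (F t - g t)) q volume ≤ δ := (hmul _).trans hgF
    -- The cutoff χ lives on an interval of length one, so the uniform bound δ is also an L^q bound.
    have n2 : eLpNorm (fun t => χ t * (g t - P g t)) q volume ≤ δ := by
      calc eLpNorm (fun t => χ t * (g t - P g t)) q volume
          ≤ eLpNorm ((Icc (0 : ℝ) 1).indicator fun _ => δ.toReal) q volume := by
            refine eLpNorm_mono_enorm fun t => ?_
            by_cases ht : t ∈ Icc (0 : ℝ) 1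
            · rw [indicator_of_mem ht, Real.enorm_of_nonneg hδ'.le]
              exact hle t hδ'.le (hJ t)
            · rw [hχ0 t ht]; simp
        _ = δ := by
            rw [eLpNorm_indicator_const measurableSet_Icc hq0 hqt, Real.enorm_of_nonneg hδ'.le,
              ENNReal.ofReal_toReal hδt]
            simp
    have n3 : eLpNorm (fun t => χ t * P (fun y => g y - F y) t) q volume
        ≤ C * ENNReal.ofReal Real.pi * δ := by
      refine (hmul _).trans ?_
      have := multiplierNorm_le_of_bumpWeight (q := q) (G := fun y => g y - F y)
        (H := P fun y => g y - F y) (hg.aestronglyMeasurable.sub hF.aestronglyMeasurable) hq hL0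
        (K := C) ENNReal.coe_ne_top
        (fun x => enorm_symbolConv_le (hC _ hL0) ENNReal.coe_ne_top _ x)
      rw [multiplierNorm, if_neg hqt] at this
      refine this.trans (mul_le_mul_right ?_ _)
      have e : (fun y => g y - F y) = g - F := rfl
      rw [e, eLpNorm_sub_comm]
      exact hgF
    change eLpNorm (fun t => χ t * (F t - P F t)) q volume ≤ ε
    rw [hsplit]
    calc _ ≤ δ + δ + C * ENNReal.ofReal Real.pi * δ :=
          (eLpNorm_add_le (m1.add m2) m3 hq).trans
            (add_le_add ((eLpNorm_add_le m1 m2 hq).trans (add_le_add n1 n2)) n3)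
      _ = D * δ := by rw [hD]; ring
      _ = ε := ENNReal.mul_div_cancel hD0 hDt

/-- Littlewood-Paley decomposition of a Sobolev function on the line. -/
theorem exists_littlewoodPaley {q : ℝ≥0∞} (hq : 2 ≤ q) (s : ℝ) (m : ℕ) :
    ∃ C : ℝ≥0, ∀ F G : ℝ → ℂ, Measurable F → (∃ B : ℝ, ∀ t, ‖F t‖ ≤ B) → HasCompactSupport F →
      (q = ⊤ → Continuous F) → MemLp G q → IsBesselDerivative s F G →
      ∃ Fd : ℕ → ℝ → ℂ, (∀ j, ContDiff ℝ ∞ (Fd j)) ∧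
        (∀ j, multiplierNorm q (Fd j)
          ≤ C * ENNReal.ofReal (((2 : ℝ) ^ j) ^ (-s)) * eLpNorm G q) ∧
        (∀ j, ∀ i ≤ m, ∀ x, ‖iteratedDeriv i (Fd j) x‖ₑ
          ≤ C * ENNReal.ofReal (((2 : ℝ) ^ j) ^ (i + 1 / 2 - s)) * eLpNorm G q) ∧
        ∀ χ : ℝ → ℂ, Continuous χ → (∀ t, ‖χ t‖ ≤ 1) → (∀ t, χ t * F t = F t) →
          (∀ t, t ∉ Icc (0 : ℝ) 1 → χ t = 0) →
          Filter.Tendsto (fun J : ℕ => multiplierNorm q fun t =>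
            F t - χ t * ∑ j ∈ Finset.range (J + 1), Fd j t) Filter.atTop (nhds 0) := by
  obtain ⟨θ, hθ, h1, h2⟩ := exists_fourierCutoff
  choose C hC using exists_norm_fourier_dyadicPiece_le hθ h1 h2 s
  set D : ℝ≥0 := ∑ i ∈ Finset.range (m + 1), C i with hD
  have hCD : ∀ i ≤ m, C i ≤ D := fun i hi =>
    Finset.single_le_sum (f := C) (fun _ _ => zero_le) (Finset.mem_range.2 (by omega))
  refine ⟨D * Real.pi.toNNReal, fun F G hF ⟨B, hB⟩ hFc hFq hG hFG => ?_⟩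
  have hq1 : (1 : ℝ≥0∞) ≤ q := one_le_two.trans hq
  have hFi : Integrable F := by
    have hb : MemLp F ⊤ := memLp_top_of_bound hF.aestronglyMeasurable B
      (Filter.Eventually.of_forall hB)
    exact memLp_one_iff_integrable.1 (hb.mono_exponent_of_measure_support_ne_top
      (fun x hx => image_eq_zero_of_notMem_tsupport hx) hFc.measure_lt_top.ne le_top)
  have hs := contDiff_dyadicPiece hθ
  have hc : ∀ j, HasCompactSupport (dyadicPiece θ j) := fun j =>
    hasCompactSupport_of_abs (dyadicPiece_eq_zero h2 j)
  -- Differentiation multiplies the symbol by (-2πiξ)^i, and the Bessel symbol is divided out by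
  -- passing from F to its Bessel derivative G.
  have hpt : ∀ j i x, ‖iteratedDeriv i (symbolConv (dyadicPiece θ j) F) x‖ₑ
      ≤ (C i * ENNReal.ofReal (((2 : ℝ) ^ j) ^ (i - s)))
        * ∫⁻ y, ‖G y‖ₑ * bumpWeight (2 ^ j) (x - y) := fun j i x => by
    have hb : ContDiff ℝ ∞ (fun ξ : ℝ => (-2 * Real.pi * Complex.I * ξ) ^ i * dyadicPiece θ j ξ) :=
      ((contDiff_const.mul Complex.ofRealCLM.contDiff).pow i).mul (hs j)
    rw [iteratedDeriv_symbolConv (hs j) (hc j) hFi,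
      symbolConv_eq_of_isBesselDerivative hb (hc j).mul_left hFG]
    exact enorm_symbolConv_le (hC i j) (ENNReal.mul_ne_top ENNReal.coe_ne_top ENNReal.ofReal_ne_top)
      G x
  have hCπ : ((D * Real.pi.toNNReal : ℝ≥0) : ℝ≥0∞) = D * ENNReal.ofReal Real.pi := by
    rw [ENNReal.coe_mul]; rfl
  refine ⟨fun j => symbolConv (dyadicPiece θ j) F,
    fun j => contDiff_symbolConv (hs j) (hc j) hFi, fun j => ?_, fun j i hi x => ?_,
    fun χ hχ hχ1 hχF hχ0 => ?_⟩
  · refine (multiplierNorm_le_of_bumpWeight hG.1 hq1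
      (pow_pos two_pos j) (ENNReal.mul_ne_top ENNReal.coe_ne_top ENNReal.ofReal_ne_top)
      (fun x => by simpa using hpt j 0 x)).trans ?_
    rw [hCπ, mul_right_comm (C 0 : ℝ≥0∞)]
    refine mul_le_mul_left (mul_le_mul_left (mul_le_mul_left ?_ _) _) _
    exact_mod_cast hCD 0 (Nat.zero_le _)
  · have hL : (1 : ℝ) ≤ 2 ^ j := one_le_pow₀ one_le_two
    refine (hpt j i x).trans ((mul_le_mul_right
      (lintegral_mul_bumpWeight_le hG.1 hq hL x) _).trans ?_)
    rw [hCπ, ENNReal.ofReal_mul Real.pi_pos.le]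
    -- The extra 1/2 in the exponent is the √L lost in passing from the L^q norm of G to a pointwise
    -- bound.
    have e : ENNReal.ofReal (((2 : ℝ) ^ j) ^ ((i : ℝ) + 1 / 2 - s))
        = ENNReal.ofReal (((2 : ℝ) ^ j) ^ ((i : ℝ) - s)) * ENNReal.ofReal √(2 ^ j) := by
      rw [← ENNReal.ofReal_mul (by positivity), Real.sqrt_eq_rpow, ← Real.rpow_add (by positivity)]
      congr 2
      ring
    have hCi : (C i : ℝ≥0∞) ≤ D := by exact_mod_cast hCD i hi
    rw [e]
    generalize ENNReal.ofReal (((2 : ℝ) ^ j) ^ ((i : ℝ) - s)) = u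
    generalize ENNReal.ofReal √(2 ^ j) = v
    generalize ENNReal.ofReal Real.pi = w
    calc _ = C i * (w * (u * v) * eLpNorm G q) := by ring
      _ ≤ D * (w * (u * v) * eLpNorm G q) := by gcongr
      _ = _ := by ring
  · have := tendsto_multiplierNorm_sub hθ h1 h2 hq1 hF hB hFc hFq hχ hχ1
      hχF hχ0
    refine this.congr fun J => ?_
    congr 1
    funext t
    rw [symbolConv_finsetSum hFi _ _ hs hc]
    simp only [sum_dyadicPiece]

end LittlewoodPaley

/-! ### Calculus of derivative bounds. -/

section DerivativeBounds

open scoped ContDiff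

/-- `f` is smooth on `s`, with derivatives up to order `m` growing at most like `A * a ^ i`. -/
structure HasDerivBound {E : Type*} [NormedAddCommGroup E] [NormedSpace ℝ E] (m : ℕ) (f : ℝ → E)
    (s : Set ℝ) (A a : ℝ) : Prop where
  contDiffOn : ContDiffOn ℝ ∞ f s
  bound : ∀ i ≤ m, ∀ x ∈ s, ‖iteratedFDerivWithin ℝ i f s x‖ ≤ A * a ^ i

variable {m : ℕ} {s : Set ℝ} {f g : ℝ → ℂ} {A B a b : ℝ}

lemma HasDerivBound.mul (hf : HasDerivBound m f s A a) (hg : HasDerivBound m g s B b)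
    (hs : IsOpen s) (hA : 0 ≤ A) (ha : 0 ≤ a) :
    HasDerivBound m (fun x => f x * g x) s (A * B) (a + b) := by
  refine ⟨hf.contDiffOn.mul hg.contDiffOn, fun i hi x hx => ?_⟩
  refine (norm_iteratedFDerivWithin_mul_le hf.contDiffOn hg.contDiffOn hs.uniqueDiffOn hx
    (n := i) (by exact_mod_cast le_top)).trans ?_
  rw [add_pow, Finset.mul_sum]
  refine Finset.sum_le_sum fun j hj => ?_
  have hji : j ≤ i := Nat.lt_succ_iff.1 (Finset.mem_range.1 hj)
  calc (i.choose j : ℝ) * ‖iteratedFDerivWithin ℝ j f s x‖ * ‖iteratedFDerivWithin ℝ (i - j) g s x‖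
      ≤ (i.choose j : ℝ) * (A * a ^ j) * (B * b ^ (i - j)) := by
        gcongr
        · exact hf.bound j (by omega) x hx
        · exact hg.bound (i - j) (by omega) x hx
    _ = _ := by ring

/-- The chain rule of order i involves f^(j) for all j ≤ i; the condition 1 ≤ a bounds every a^j by
a^i, so only the rate is multiplied by D. -/
lemma HasDerivBound.comp {φ : ℝ → ℝ} {D : ℝ} {t : Set ℝ} (hf : HasDerivBound m f t A a)
    (ht : IsOpen t) (hs : IsOpen s) (hst : MapsTo φ s t) (hφ : ContDiffOn ℝ ∞ φ s) (hA : 0 ≤ A)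
    (ha : 1 ≤ a) (hD : 0 ≤ D)
    (hφD : ∀ i, 1 ≤ i → i ≤ m → ∀ x ∈ s, ‖iteratedFDerivWithin ℝ i φ s x‖ ≤ D ^ i) :
    HasDerivBound m (fun x => f (φ x)) s (m.factorial * A) (a * D) := by
  refine ⟨hf.contDiffOn.comp hφ hst, fun i hi x hx => ?_⟩
  refine (norm_iteratedFDerivWithin_comp_le hf.contDiffOn hφ (n := i) (by exact_mod_cast le_top)
    ht.uniqueDiffOn hs.uniqueDiffOn hst hx (C := A * a ^ i) (D := D) (fun j hj => ?_)
    (fun j hj hji => hφD j hj (hji.trans hi) x hx)).trans ?_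
  · refine (hf.bound j (hj.trans hi) _ (hst hx)).trans ?_
    gcongr
  · rw [mul_pow, ← mul_assoc, ← mul_assoc]
    gcongr

lemma hasDerivBound_univ (hf : ContDiff ℝ ∞ f)
    (h : ∀ i ≤ m, ∀ x, ‖iteratedDeriv i f x‖ ≤ A * a ^ i) : HasDerivBound m f univ A a := by
  refine ⟨hf.contDiffOn, fun i hi x _ => ?_⟩
  rw [iteratedFDerivWithin_univ, norm_iteratedFDeriv_eq_norm_iteratedDeriv]
  exact h i hi x

lemma exists_hasDerivBound_of_hasCompactSupport (m : ℕ) (hf : ContDiff ℝ ∞ f)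
    (hc : HasCompactSupport f) : ∃ A : ℝ, 0 ≤ A ∧ HasDerivBound m f univ A 1 := by
  have h : ∀ i : ℕ, ∃ A : ℝ, ∀ x, ‖iteratedFDeriv ℝ i f x‖ ≤ A := fun i =>
    (hf.continuous_iteratedFDeriv (m := i) (by exact_mod_cast le_top)).bounded_above_of_compact_support
      (hc.iteratedFDeriv i)
  choose A hA using h
  have hA0 : ∀ i, 0 ≤ A i := fun i => (norm_nonneg _).trans (hA i 0)
  refine ⟨∑ i ∈ Finset.range (m + 1), A i, Finset.sum_nonneg fun i _ => hA0 i,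
    hf.contDiffOn, fun i hi x _ => ?_⟩
  rw [iteratedFDerivWithin_univ, one_pow, mul_one]
  exact (hA i x).trans (Finset.single_le_sum (fun j _ => hA0 j) (Finset.mem_range.2 (by omega)))

/-- The factor |a| is retained on purpose: with a = 1/l it offsets the factor k in k(1 - u^(1/l)),
so that the derivative bounds are uniform in k. -/
lemma abs_descPochhammer_eval_le {a : ℝ} (ha : |a| ≤ 1) (i : ℕ) :
    |(descPochhammer ℝ (i + 1)).eval a| ≤ |a| * (i + 1).factorial := by
  induction i with
  | zero => simp
  | succ i ih =>
    rw [descPochhammer_succ_eval, abs_mul, Nat.factorial_succ (i + 1)]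
    have h : |a - (i + 1 : ℕ)| ≤ (i + 1 + 1 : ℕ) := by
      refine (abs_sub _ _).trans ?_
      rw [Nat.abs_cast]
      push_cast
      linarith
    calc _ ≤ (|a| * (i + 1).factorial) * ((i + 1 + 1 : ℕ) : ℝ) := by gcongr
      _ = _ := by push_cast; ring

lemma abs_iteratedDeriv_rpow_le {a : ℝ} (ha : |a| ≤ 1) {i : ℕ} (hi : 1 ≤ i) {x : ℝ}
    (hx : 1 / 16 < x) :
    |iteratedDeriv i (fun u : ℝ => u ^ a) x| ≤ |a| * i.factorial * (16 ^ i * 16) := by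
  obtain ⟨i, rfl⟩ := Nat.exists_eq_add_of_le' hi
  rw [iteratedDeriv_eq_iterate, Real.iter_deriv_rpow_const, abs_mul]
  have hx0 : 0 < x := by linarith
  have h2 : |x ^ (a - (i + 1 : ℕ))| ≤ 16 ^ (i + 1) * 16 := by
    rw [abs_of_pos (Real.rpow_pos_of_pos hx0 _)]
    have hle := abs_le.1 ha
    have e : a - (i + 1 : ℕ) ≤ 0 := by push_cast; linarith [i.cast_nonneg (α := ℝ)]
    calc x ^ (a - (i + 1 : ℕ)) ≤ (1 / 16 : ℝ) ^ (a - (i + 1 : ℕ)) :=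
          Real.rpow_le_rpow_of_nonpos (by norm_num) hx.le e
      _ = (16 : ℝ) ^ (((i + 1 : ℕ) : ℝ) - a) := by
          rw [one_div, Real.inv_rpow (by norm_num), ← Real.rpow_neg (by norm_num)]
          congr 1
          ring
      _ ≤ (16 : ℝ) ^ (((i + 1 : ℕ) : ℝ) + 1) :=
          Real.rpow_le_rpow_of_exponent_le (by norm_num) (by linarith)
      _ = _ := by rw [Real.rpow_add (by norm_num), Real.rpow_natCast, Real.rpow_one]
  exact mul_le_mul (abs_descPochhammer_eval_le ha i) h2 (abs_nonneg _) (by positivity)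

lemma norm_iteratedFDerivWithin_of_isOpen {E : Type*} [NormedAddCommGroup E] [NormedSpace ℝ E]
    (hs : IsOpen s) (f : ℝ → E) (i : ℕ) {x : ℝ} (hx : x ∈ s) :
    ‖iteratedFDerivWithin ℝ i f s x‖ = ‖iteratedDeriv i f x‖ := by
  rw [iteratedFDerivWithin_of_isOpen i hs hx, norm_iteratedFDeriv_eq_norm_iteratedDeriv]

lemma factorial_mul_pow_le {i m : ℕ} (hi : 1 ≤ i) (him : i ≤ m) :
    (i.factorial : ℝ) * (16 ^ i * 16) ≤ (256 * m : ℝ) ^ i := by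
  have h1 : (i.factorial : ℝ) ≤ (m : ℝ) ^ i := by
    have := (Nat.factorial_le_pow i).trans (Nat.pow_le_pow_left him i)
    exact_mod_cast this
  have h2 : (16 : ℝ) ≤ 16 ^ i := by
    simpa using pow_le_pow_right₀ (by norm_num : (1 : ℝ) ≤ 16) hi
  calc (i.factorial : ℝ) * (16 ^ i * 16) ≤ (m : ℝ) ^ i * (16 ^ i * 16 ^ i) := by gcongr
    _ = _ := by rw [← mul_pow, ← mul_pow]; congr 1; ring

lemma contDiffOn_rpow_Ioi (a : ℝ) : ContDiffOn ℝ ∞ (fun u : ℝ => u ^ a) (Ioi (1 / 16)) :=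
  fun x hx => (Real.contDiffAt_rpow_const_of_ne
    (by have := mem_Ioi.1 hx; linarith : x ≠ 0)).contDiffWithinAt

lemma norm_iteratedFDerivWithin_rpow_le {a : ℝ} (ha : |a| ≤ 1) (m : ℕ) :
    ∀ i, 1 ≤ i → i ≤ m → ∀ x ∈ Ioi (1 / 16 : ℝ),
      ‖iteratedFDerivWithin ℝ i (fun u : ℝ => u ^ a) (Ioi (1 / 16)) x‖ ≤ (256 * m : ℝ) ^ i := by
  intro i hi him x hx
  rw [norm_iteratedFDerivWithin_of_isOpen isOpen_Ioi _ _ hx, Real.norm_eq_abs]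
  refine (abs_iteratedDeriv_rpow_le ha hi hx).trans ((factorial_mul_pow_le hi him).trans' ?_)
  rw [mul_assoc]
  exact mul_le_of_le_one_left (by positivity) ha

lemma norm_iteratedFDerivWithin_const_mul_one_sub_rpow_le {a c : ℝ} (ha : |a| ≤ 1)
    (hc : |c| * |a| ≤ 1) (m : ℕ) :
    ∀ i, 1 ≤ i → i ≤ m → ∀ x ∈ Ioi (1 / 16 : ℝ),
      ‖iteratedFDerivWithin ℝ i (fun u : ℝ => c * (1 - u ^ a)) (Ioi (1 / 16)) x‖
        ≤ (256 * m : ℝ) ^ i := by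
  intro i hi him x hx
  rw [norm_iteratedFDerivWithin_of_isOpen isOpen_Ioi _ _ hx, Real.norm_eq_abs,
    iteratedDeriv_const_mul_field, iteratedDeriv_const_sub hi, iteratedDeriv_neg, abs_mul, abs_neg]
  calc |c| * |iteratedDeriv i (fun u : ℝ => u ^ a) x|
      ≤ |c| * (|a| * i.factorial * (16 ^ i * 16)) := by
        gcongr
        exact abs_iteratedDeriv_rpow_le ha hi hx
    _ = (|c| * |a|) * (i.factorial * (16 ^ i * 16)) := by ring
    _ ≤ i.factorial * (16 ^ i * 16) := mul_le_of_le_one_left (by positivity) hc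
    _ ≤ _ := factorial_mul_pow_le hi him

lemma hasDerivBound_inv (m : ℕ) :
    HasDerivBound m (fun u : ℝ => ((u ^ (-1 : ℝ) : ℝ) : ℂ)) (Ioi (1 / 16)) 16
      (256 * m + 1) := by
  have hc := contDiffOn_rpow_Ioi (-1)
  refine ⟨Complex.ofRealCLM.contDiff.comp_contDiffOn hc, fun i hi x hx => ?_⟩
  have e : ‖iteratedFDerivWithin ℝ i (fun u : ℝ => ((u ^ (-1 : ℝ) : ℝ) : ℂ)) (Ioi (1 / 16)) x‖
      = ‖iteratedFDerivWithin ℝ i (fun u : ℝ => u ^ (-1 : ℝ)) (Ioi (1 / 16)) x‖ :=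
    Complex.ofRealLI.norm_iteratedFDerivWithin_comp_left
      ((hc x hx).of_le (by exact_mod_cast le_top)) isOpen_Ioi.uniqueDiffOn hx
      (le_refl (i : ℕ∞ω))
  rw [e]
  rcases Nat.eq_zero_or_pos i with rfl | hi0
  · have hx' := mem_Ioi.1 hx
    simp only [norm_iteratedFDerivWithin_zero, pow_zero, mul_one]
    rw [Real.rpow_neg_one, norm_inv, Real.norm_eq_abs, abs_of_pos (by linarith),
      inv_le_comm₀ (by linarith) (by norm_num)]
    linarith
  · refine (norm_iteratedFDerivWithin_rpow_le (by simp) m i hi0 hi x hx).trans ?_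
    calc (256 * m : ℝ) ^ i ≤ (256 * m + 1 : ℝ) ^ i := by gcongr; linarith
      _ ≤ _ := le_mul_of_one_le_left (by positivity) (by norm_num)

end DerivativeBounds

/-! ### Smooth profiles in the variable u = λ^l. -/

section SpectralProfile

open scoped ContDiff

/-- The pull-back of a smooth function under `t = k (1 - λ)`, `u = λ ^ ℓ`, divided by `u`. -/
theorem exists_smooth_profile {w ψ : ℝ → ℂ} (hw : ContDiff ℝ ∞ w) (hwc : HasCompactSupport w)
    (hψ : ContDiff ℝ ∞ ψ) (hψ0 : ∀ t, t ∉ Icc (1 / 8 : ℝ) (5 / 8) → ψ t = 0) (m : ℕ) :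
    ∃ C : ℝ, 0 < C ∧ ∀ k l : ℕ, 1 ≤ k → k ≤ l → l ≤ k + 1 → ∀ f : ℝ → ℂ, ContDiff ℝ ∞ f →
      ∀ L Q : ℝ, 1 ≤ L → 0 ≤ Q → (∀ i ≤ m, ∀ x, ‖iteratedDeriv i f x‖ ≤ Q * L ^ i) →
      ∃ v : ℝ → ℂ, ContDiff ℝ ∞ v ∧ (∀ x, x ∉ Icc (0 : ℝ) 1 → v x = 0) ∧
        (∀ i ≤ m, ∀ x, ‖iteratedDeriv i v x‖ ≤ C * Q * L ^ i) ∧ (∀ x ≤ 0, v x = 0) ∧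
        ∀ x, 0 < x → v (x ^ l) * ((x ^ l : ℝ) : ℂ)
          = f (k * (1 - x)) * (w (x ^ k) * ψ (k * (1 - x))) := by
  have hψc : HasCompactSupport ψ :=
    HasCompactSupport.of_support_subset_isCompact (isCompact_Icc (a := 1 / 8) (b := 5 / 8))
      fun x hx => by
        by_contra hcon
        exact hx (hψ0 x hcon)
  obtain ⟨A1, hA1, hb1⟩ := exists_hasDerivBound_of_hasCompactSupport m hw hwc
  obtain ⟨A2, hA2, hb2⟩ := exists_hasDerivBound_of_hasCompactSupport m hψ hψc
  set D : ℝ := 256 * m with hD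
  have hD0 : 0 ≤ D := by positivity
  -- The sum of the rates of the factors of W, apart from L: D each for f, w and ψ after
  -- composition, and D + 1 for 1/u. Only f carries the frequency L ≥ 1, so the total rate is at
  -- most L P.
  set P : ℝ := D + (1 * D + 1 * D + (D + 1)) with hP
  have hP1 : 1 ≤ P := by linarith
  set A : ℝ := m.factorial * ((m.factorial * A1) * (m.factorial * A2) * 16) with hA
  have hA0 : 0 ≤ A := by positivity
  refine ⟨A * P ^ m + 1, by positivity, ?_⟩
  intro k l hk hkl hlk f hf L Q hL hQ hfb
  have hk0 : (1 : ℝ) ≤ k := by exact_mod_cast hk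
  have hl0 : (1 : ℝ) ≤ l := by exact_mod_cast hk.trans hkl
  have hkl' : (k : ℝ) ≤ l := by exact_mod_cast hkl
  set s : Set ℝ := Ioi (1 / 16) with hs
  have hso : IsOpen s := isOpen_Ioi
  set g : ℝ → ℝ := fun u => k * (1 - u ^ (1 / l : ℝ)) with hg
  set h : ℝ → ℝ := fun u => u ^ (k / l : ℝ) with hh
  have ha1 : |(1 / l : ℝ)| ≤ 1 := by
    rw [abs_of_nonneg (by positivity), div_le_one (by linarith)]; exact hl0
  have ha2 : |(k / l : ℝ)| ≤ 1 := by
    rw [abs_of_nonneg (by positivity), div_le_one (by linarith)]; exact hkl'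
  have hgc : ContDiffOn ℝ ∞ g s := contDiffOn_const.mul (contDiffOn_const.sub (contDiffOn_rpow_Ioi _))
  have hgb := norm_iteratedFDerivWithin_const_mul_one_sub_rpow_le (a := 1 / l) (c := k) ha1
    (by rw [← abs_mul, mul_one_div]; exact ha2) m
  have hhb := norm_iteratedFDerivWithin_rpow_le ha2 m
  have B0 := (hasDerivBound_univ hf hfb).comp isOpen_univ hso (mapsTo_univ _ _) hgc hQ hL hD0 hgb
  have B1 := hb1.comp isOpen_univ hso (mapsTo_univ _ _) (contDiffOn_rpow_Ioi _) hA1 le_rfl hD0 hhb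
  have B2 := hb2.comp isOpen_univ hso (mapsTo_univ _ _) hgc hA2 le_rfl hD0 hgb
  set W : ℝ → ℂ := fun u => f (g u) * ((w (h u) * ψ (g u)) * ((u ^ (-1 : ℝ) : ℝ) : ℂ)) with hW
  have BW : HasDerivBound m W s (m.factorial * Q * ((m.factorial * A1) * (m.factorial * A2) * 16))
      (L * D + (1 * D + 1 * D + (D + 1))) :=
    B0.mul (((B1.mul B2 hso (by positivity) (by positivity))).mul (hasDerivBound_inv m) hso
      (by positivity) (by positivity)) hso (by positivity) (by positivity)
  -- By Bernoulli's inequality, g(u) ≤ 5/8 forces u ≥ (1 - 5/(8k))^(k+1) ≥ (3/8)² = 9/64 > 1/8.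
  have hgle : ∀ u, 0 < u → g u ≤ 5 / 8 → 1 / 8 < u := fun u hu hgu => by
    have h1 : 1 - 5 / 8 / (k : ℝ) ≤ u ^ (1 / l : ℝ) := by
      have : 1 - u ^ (1 / l : ℝ) ≤ 5 / 8 / k := by
        rw [le_div_iff₀ (by linarith)]
        linarith [mul_comm (k : ℝ) (1 - u ^ (1 / l : ℝ))]
      linarith
    have h2 : (5 : ℝ) / 8 / k ≤ 5 / 8 := div_le_self (by norm_num) hk0
    have h3 : (u ^ (1 / l : ℝ)) ^ l = u := by
      rw [one_div, Real.rpow_inv_natCast_pow hu.le (by omega)]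
    have h4 : (1 - 5 / 8 / (k : ℝ)) ^ (k + 1) ≤ u := by
      calc (1 - 5 / 8 / (k : ℝ)) ^ (k + 1) ≤ (1 - 5 / 8 / (k : ℝ)) ^ l :=
            pow_le_pow_of_le_one (by linarith) (by
              have : (0 : ℝ) ≤ 5 / 8 / k := by positivity
              linarith) hlk
        _ ≤ (u ^ (1 / l : ℝ)) ^ l := pow_le_pow_left₀ (by linarith) h1 l
        _ = u := h3
    have h5 : 1 + (k : ℝ) * (-(5 / 8 / k)) ≤ (1 + -(5 / 8 / (k : ℝ))) ^ k :=
      one_add_mul_le_pow (by linarith) k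
    have h6 : (k : ℝ) * (-(5 / 8 / k)) = -(5 / 8) := by field_simp
    rw [h6] at h5
    rw [pow_succ] at h4
    have h7 : (3 / 8 : ℝ) * (3 / 8) ≤ (1 - 5 / 8 / (k : ℝ)) ^ k * (1 - 5 / 8 / (k : ℝ)) := by
      refine mul_le_mul ?_ (by linarith) (by norm_num) (by positivity)
      rw [sub_eq_add_neg]; linarith
    norm_num at h7
    linarith
  have hW0 : ∀ u, 0 < u → u ≤ 1 / 8 → W u = 0 := fun u hu hu8 => by
    have : ψ (g u) = 0 := hψ0 _ fun hmem => absurd (hgle u hu hmem.2) (not_lt.2 hu8)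
    simp [hW, this]
  have hW1 : ∀ u, 1 ≤ u → W u = 0 := fun u hu => by
    have h1 : 1 ≤ u ^ (1 / l : ℝ) := Real.one_le_rpow hu (by positivity)
    have : ψ (g u) = 0 := hψ0 _ fun hmem => by
      have : g u ≤ 0 := mul_nonpos_of_nonneg_of_nonpos (by positivity) (by linarith)
      linarith [hmem.1]
    simp [hW, this]
  -- W already vanishes on (0, 1/8], so the cut at 1/16 loses nothing, and the open sets u < 1/8 and
  -- u > 1/16 overlap, which makes smoothness a local matter.
  set v : ℝ → ℂ := fun u => if u ≤ 1 / 16 then 0 else W u with hv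
  have hvs : ∀ u ∈ s, v u = W u := fun u hu => if_neg (not_le.2 hu)
  have hv8 : ∀ u < 1 / 8, v u = 0 := fun u hu => by
    by_cases h16 : u ≤ 1 / 16
    · exact if_pos h16
    · rw [hvs u (not_le.1 h16)]
      exact hW0 u (by linarith [not_le.1 h16]) hu.le
  have hv8n : ∀ u < 1 / 8, v =ᶠ[nhds u] fun _ => 0 := fun u hu => by
    filter_upwards [isOpen_Iio.mem_nhds hu] with y hy using hv8 y hy
  have hvsn : ∀ u ∈ s, v =ᶠ[nhds u] W := fun u hu => by
    filter_upwards [hso.mem_nhds hu] with y hy using hvs y hy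
  refine ⟨v, contDiff_iff_contDiffAt.2 fun u => ?_, fun u hu => ?_, fun i hi u => ?_,
    fun u hu => hv8 u (by linarith), fun x hx => ?_⟩
  · rcases lt_or_ge u (1 / 8) with hu | hu
    · exact contDiffAt_const.congr_of_eventuallyEq (hv8n u hu)
    · have hus : u ∈ s := by rw [hs, mem_Ioi]; linarith
      exact (BW.contDiffOn.contDiffAt (hso.mem_nhds hus)).congr_of_eventuallyEq (hvsn u hus)
  · rcases lt_or_ge u (1 / 8) with hu8 | hu8
    · exact hv8 u hu8
    · have hu1 : 1 < u := by
        by_contra hcon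
        exact hu ⟨by linarith, not_lt.1 hcon⟩
      rw [hvs u (by rw [hs, mem_Ioi]; linarith), hW1 u hu1.le]
  · have hLi : 0 ≤ L ^ i := by positivity
    rcases lt_or_ge u (1 / 8) with hu8 | hu8
    · rw [(hv8n u hu8).iteratedDeriv_eq i]
      simp only [iteratedDeriv_fun_const_zero, norm_zero]
      positivity
    · have hus : u ∈ s := by rw [hs, mem_Ioi]; linarith
      rw [(hvsn u hus).iteratedDeriv_eq i, ← norm_iteratedFDerivWithin_of_isOpen hso W i hus]
      refine (BW.bound i hi u hus).trans ?_
      have h1 : L * D + (1 * D + 1 * D + (D + 1)) ≤ L * P := by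
        rw [hP, mul_add]
        gcongr
        exact le_mul_of_one_le_left (by positivity) hL
      calc _ ≤ (m.factorial * Q * ((m.factorial * A1) * (m.factorial * A2) * 16)) * (L * P) ^ i := by
            gcongr
        _ = (A * P ^ i) * Q * L ^ i := by rw [hA, mul_pow]; ring
        _ ≤ (A * P ^ m + 1) * Q * L ^ i := by
            gcongr
            have : P ^ i ≤ P ^ m := pow_le_pow_right₀ hP1 hi
            nlinarith
  · have hxl : (x ^ l) ^ (1 / l : ℝ) = x := by
      rw [one_div, Real.pow_rpow_inv_natCast hx.le (by omega)]
    have hxk : (x ^ l) ^ (k / l : ℝ) = x ^ k := by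
      rw [← Real.rpow_natCast, ← Real.rpow_mul hx.le, mul_div_cancel₀ _ (by linarith : (l : ℝ) ≠ 0),
        Real.rpow_natCast]
    have hxl0 : 0 < x ^ l := by positivity
    have e : v (x ^ l) = W (x ^ l) := by
      rcases lt_or_ge (x ^ l) (1 / 8) with hu | hu
      · rw [hv8 _ hu, hW0 _ hxl0 hu.le]
      · exact hvs _ (by rw [hs, mem_Ioi]; linarith)
    rw [e]
    simp only [hW, hg, hh]
    rw [hxl, hxk, Real.rpow_neg_one, Complex.ofReal_inv]
    have : ((x ^ l : ℝ) : ℂ) ≠ 0 := by exact_mod_cast hxl0.ne'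
    field_simp

end SpectralProfile

/-! ### The substitution u = (1 - t/k)^k in multiplier norms. -/

section ChangeOfVariables

/-- The function `u ↦ Φ(k (1 - u^(1/k))) / u` on `(0, ∞)`, extended by zero. -/
noncomputable def powerPullback (k : ℕ) (Φ : ℝ → ℂ) (u : ℝ) : ℂ :=
  if 0 < u then Φ (k * (1 - u ^ (1 / k : ℝ))) / u else 0

variable {k : ℕ} {Φ : ℝ → ℂ}

lemma measurable_powerPullback (hΦ : Measurable Φ) : Measurable (powerPullback k Φ) := by
  unfold powerPullback
  refine Measurable.ite measurableSet_Ioi ?_ measurable_const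
  exact (hΦ.comp (by fun_prop)).div Complex.measurable_ofReal

lemma powerPullback_pow (hk : 1 ≤ k) {x : ℝ} (hx : 0 < x) :
    powerPullback k Φ (x ^ k) = Φ (k * (1 - x)) / (x ^ k : ℝ) := by
  rw [powerPullback, if_pos (by positivity), one_div, Real.pow_rpow_inv_natCast hx.le (by omega)]

/-- Bernoulli's inequality gives (1 - t/k)^k ≥ 1 - t ≥ 3/8, so division by u costs at most 8/3 < 3,
uniformly in k. -/
lemma one_sub_div_pow_ge (hk : 1 ≤ k) {t : ℝ} (ht : t ∈ Icc (1 / 8 : ℝ) (5 / 8)) :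
    3 / 8 ≤ (1 - t / k) ^ k := by
  have hk0 : (1 : ℝ) ≤ k := by exact_mod_cast hk
  have h1 : t / k ≤ 5 / 8 := (div_le_self (by linarith [ht.1]) hk0).trans ht.2
  have h2 := one_add_mul_le_pow (by linarith : (-2 : ℝ) ≤ -(t / k)) k
  have h3 : (k : ℝ) * (-(t / k)) = -t := by field_simp
  rw [h3, ← sub_eq_add_neg, ← sub_eq_add_neg] at h2
  linarith [ht.2]

lemma exists_of_powerPullback_ne_zero (hk : 1 ≤ k) (hΦ0 : ∀ t, t ∉ Icc (1 / 8 : ℝ) (5 / 8) → Φ t = 0)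
    {u : ℝ} (hu : powerPullback k Φ u ≠ 0) :
    ∃ t ∈ Icc (1 / 8 : ℝ) (5 / 8), Φ t ≠ 0 ∧ u = (1 - t / k) ^ k ∧ powerPullback k Φ u = Φ t / u := by
  have hu0 : 0 < u := by
    by_contra h
    exact hu (if_neg h)
  have hk0 : (k : ℝ) ≠ 0 := by
    have : k ≠ 0 := by omega
    exact_mod_cast this
  have e : powerPullback k Φ u = Φ (k * (1 - u ^ (1 / k : ℝ))) / u := if_pos hu0
  have h1 : Φ (k * (1 - u ^ (1 / k : ℝ))) ≠ 0 := fun h => hu (by rw [e, h, zero_div])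
  refine ⟨k * (1 - u ^ (1 / k : ℝ)), by_contra fun h => h1 (hΦ0 _ h), h1, ?_, e⟩
  rw [mul_div_cancel_left₀ _ hk0, sub_sub_cancel, one_div,
    Real.rpow_inv_natCast_pow hu0.le (by omega)]

lemma enorm_powerPullback_le (hk : 1 ≤ k) {t : ℝ} (ht : t ∈ Icc (1 / 8 : ℝ) (5 / 8)) :
    ‖Φ t / (((1 - t / k) ^ k : ℝ) : ℂ)‖ₑ ≤ 3 * ‖Φ t‖ₑ := by
  have h := one_sub_div_pow_ge hk ht
  have e : (3 : ℝ≥0∞) = ENNReal.ofReal 3 := by simp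
  rw [← ofReal_norm, ← ofReal_norm, e, ← ENNReal.ofReal_mul (by norm_num)]
  refine ENNReal.ofReal_le_ofReal ?_
  rw [norm_div, Complex.norm_real, Real.norm_of_nonneg (by linarith), div_le_iff₀ (by linarith)]
  nlinarith [norm_nonneg (Φ t)]

lemma norm_powerPullback_le (hk : 1 ≤ k) (hΦ0 : ∀ t, t ∉ Icc (1 / 8 : ℝ) (5 / 8) → Φ t = 0)
    (hb : ∃ B : ℝ, ∀ t, ‖Φ t‖ ≤ B) : ∃ B : ℝ, ∀ u, ‖powerPullback k Φ u‖ ≤ B := by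
  obtain ⟨B, hB⟩ := hb
  have hB0 : 0 ≤ B := (norm_nonneg _).trans (hB 0)
  refine ⟨3 * B, fun u => ?_⟩
  by_cases hu : powerPullback k Φ u = 0
  · rw [hu, norm_zero]; positivity
  · obtain ⟨t, ht, -, rfl, e⟩ := exists_of_powerPullback_ne_zero hk hΦ0 hu
    have h := one_sub_div_pow_ge hk ht
    rw [e, norm_div, Complex.norm_real, Real.norm_of_nonneg (by linarith), div_le_iff₀ (by linarith)]
    nlinarith [hB t]

/-- The map t ↦ (1 - t/k)^k has derivative -(1 - t/k)^(k-1), of modulus at most one on the support,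
so the change of variables costs nothing and the division by u at most 3. -/
lemma multiplierNorm_powerPullback_le (hk : 1 ≤ k)
    (hΦ0 : ∀ t, t ∉ Icc (1 / 8 : ℝ) (5 / 8) → Φ t = 0) {q : ℝ≥0∞} (hq : q ≠ 0) :
    multiplierNorm q (powerPullback k Φ) ≤ 3 * multiplierNorm q Φ := by
  unfold multiplierNorm
  split_ifs with hqt
  · refine iSup_le fun u => ?_
    by_cases hu : powerPullback k Φ u = 0
    · rw [hu, enorm_zero]; exact zero_le
    · obtain ⟨t, ht, -, rfl, e⟩ := exists_of_powerPullback_ne_zero hk hΦ0 hu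
      rw [e]
      exact (enorm_powerPullback_le hk ht).trans
        (mul_le_mul_right (le_iSup (fun t => ‖Φ t‖ₑ) t) _)
  · have hqp : 0 < q.toReal := ENNReal.toReal_pos hq hqt
    have hk0 : (1 : ℝ) ≤ k := by exact_mod_cast hk
    rw [← ENNReal.rpow_le_rpow_iff hqp, ENNReal.mul_rpow_of_nonneg _ _ hqp.le,
      eLpNorm_eq_lintegral_rpow_enorm_toReal hq hqt, eLpNorm_eq_lintegral_rpow_enorm_toReal hq hqt,
      ← ENNReal.rpow_mul, ← ENNReal.rpow_mul, one_div_mul_cancel hqp.ne', ENNReal.rpow_one,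
      ENNReal.rpow_one]
    set s := Icc (1 / 8 : ℝ) (5 / 8) with hs
    set φ : ℝ → ℝ := fun t => (1 - t / k) ^ k with hφ
    have hpos : ∀ t ∈ s, 3 / 8 ≤ 1 - t / k := fun t ht => by
      have : t / k ≤ 5 / 8 := (div_le_self (by linarith [ht.1]) hk0).trans ht.2
      linarith
    have hd : ∀ t ∈ s, HasDerivWithinAt φ (k * (1 - t / k) ^ (k - 1) * (-(1 / k))) s t :=
      fun t _ => ((((hasDerivAt_id t).div_const (k : ℝ)).const_sub 1).pow k).hasDerivWithinAt
    have hinj : InjOn φ s := fun x hx y hy hxy => by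
      have h : 1 - x / k = 1 - y / k := (pow_left_inj₀ (by linarith [hpos x hx])
        (by linarith [hpos y hy]) (by omega)).1 hxy
      have h2 : x / k = y / k := by linarith
      exact (div_left_inj' (by linarith)).1 h2
    have hφm : MeasurableSet (φ '' s) :=
      (isCompact_Icc.image (by fun_prop : Continuous φ)).measurableSet
    calc ∫⁻ u, ‖powerPullback k Φ u‖ₑ ^ q.toReal
        ≤ ∫⁻ u in φ '' s, ‖powerPullback k Φ u‖ₑ ^ q.toReal := by
          rw [← lintegral_indicator hφm]
          refine lintegral_mono fun u => ?_
          by_cases hu : powerPullback k Φ u = 0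
          · rw [hu, enorm_zero, ENNReal.zero_rpow_of_pos hqp]; exact zero_le
          · obtain ⟨t, ht, -, e, -⟩ := exists_of_powerPullback_ne_zero hk hΦ0 hu
            have hmem : u ∈ φ '' s := ⟨t, ht, e.symm⟩
            rw [indicator_of_mem hmem]
      _ = ∫⁻ t in s, ENNReal.ofReal |k * (1 - t / k) ^ (k - 1) * (-(1 / k))|
            * ‖powerPullback k Φ (φ t)‖ₑ ^ q.toReal :=
          lintegral_image_eq_lintegral_abs_deriv_mul measurableSet_Icc hd hinj _
      _ ≤ ∫⁻ t in s, 3 ^ q.toReal * ‖Φ t‖ₑ ^ q.toReal := by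
          refine setLIntegral_mono' measurableSet_Icc fun t ht => ?_
          have h1 : ENNReal.ofReal |k * (1 - t / k) ^ (k - 1) * (-(1 / k))| ≤ 1 := by
            rw [ENNReal.ofReal_le_one, abs_mul, abs_mul, abs_neg, abs_of_pos (by positivity),
              abs_of_pos (by positivity : (0 : ℝ) < 1 / k),
              abs_of_pos (pow_pos (by linarith [hpos t ht]) _)]
            have : (1 - t / k) ^ (k - 1) ≤ 1 := pow_le_one₀ (by linarith [hpos t ht]) (by
              have : 0 ≤ t / k := div_nonneg (by linarith [ht.1]) (by linarith)
              linarith)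
            calc (k : ℝ) * (1 - t / k) ^ (k - 1) * (1 / k) = (1 - t / k) ^ (k - 1) := by field_simp
              _ ≤ 1 := this
          have h2 : ‖powerPullback k Φ (φ t)‖ₑ ≤ 3 * ‖Φ t‖ₑ := by
            have h3 := hpos t ht
            rw [hφ, powerPullback_pow hk (by linarith), sub_sub_cancel,
              mul_div_cancel₀ _ (by linarith : (k : ℝ) ≠ 0)]
            exact enorm_powerPullback_le hk ht
          rw [← ENNReal.mul_rpow_of_nonneg _ _ hqp.le]
          exact (mul_le_mul' h1 (ENNReal.rpow_le_rpow h2 hqp.le)).trans_eq (one_mul _)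
      _ ≤ ∫⁻ t, 3 ^ q.toReal * ‖Φ t‖ₑ ^ q.toReal := setLIntegral_le_lintegral _ _
      _ = _ := lintegral_const_mul' _ _ (ENNReal.rpow_ne_top_of_nonneg hqp.le (by norm_num))

end ChangeOfVariables

/-! ### Restriction estimates for functions of k(1 - A). -/

section Restriction

variable {H : Type*} [NormedAddCommGroup H] [InnerProductSpace ℂ H] [CompleteSpace H]

lemma enorm_sq_borelCalculus_smul_one_sub {A : H →L[ℂ] H} (hA : IsSelfAdjoint A) (k : ℕ)
    {Φ : ℝ → ℂ} (hΦ : Measurable Φ) (hb : ∃ B : ℝ, ∀ t, ‖Φ t‖ ≤ B) (x : H) :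
    ‖borelCalculus ((k : ℂ) • (1 - A)) Φ x‖ₑ ^ 2
      = ∫⁻ t, ‖Φ (k * (1 - t))‖ₑ ^ 2 ∂(spectralMeasure A x) := by
  have e : (k : ℂ) • (1 - A) = cfc (fun t : ℝ => k * (1 - t)) A := by
    rw [cfc_mul_sub_self hA]; simp
  have hs : IsSelfAdjoint ((k : ℂ) • (1 - A)) := by
    rw [e]; exact cfc_predicate _ _
  have hc : Continuous fun t : ℝ => (k : ℝ) * (1 - t) := by fun_prop
  rw [enorm_sq_borelCalculus hs hΦ hb, e, spectralMeasure_cfc hA x hc,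
    lintegral_map (hΦ.enorm.pow_const 2) hc.measurable]

lemma borelCalculus_smul_one_sub_inner {A : H →L[ℂ] H} (hA : IsSelfAdjoint A) (k : ℕ)
    {Φ : ℝ → ℂ} (hΦ : Measurable Φ) (hb : ∃ B : ℝ, ∀ t, ‖Φ t‖ ≤ B) (x : H) :
    ⟪x, borelCalculus ((k : ℂ) • (1 - A)) Φ x⟫
      = ∫ t, Φ (k * (1 - t)) ∂(spectralMeasure A x) := by
  have e : (k : ℂ) • (1 - A) = cfc (fun t : ℝ => k * (1 - t)) A := by
    rw [cfc_mul_sub_self hA]; simp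
  have hc : Continuous fun t : ℝ => (k : ℝ) * (1 - t) := by fun_prop
  rw [inner_borelCalculus _ hΦ hb, e, spectralMeasure_cfc hA x hc,
    integral_map hc.aemeasurable hΦ.aestronglyMeasurable]

/-- `‖Φ(k(1-A)) x‖ ≤ ‖G(A^k) A^k x‖` for the pull-back `G` of `Φ`. -/
lemma enorm_borelCalculus_le_powerPullback {A : H →L[ℂ] H} (hA : IsSelfAdjoint A) {k : ℕ}
    (hk : 1 ≤ k) {Φ : ℝ → ℂ} (hΦ : Measurable Φ) (hb : ∃ B : ℝ, ∀ t, ‖Φ t‖ ≤ B)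
    (hΦ0 : ∀ t, t ∉ Icc (1 / 8 : ℝ) (5 / 8) → Φ t = 0) (x : H) :
    ‖borelCalculus ((k : ℂ) • (1 - A)) Φ x‖ₑ
      ≤ ‖borelCalculus (A ^ k) (powerPullback k Φ) ((A ^ k) x)‖ₑ := by
  have hk0 : (1 : ℝ) ≤ k := by exact_mod_cast hk
  have hG := measurable_powerPullback (k := k) hΦ
  have hpow : Measurable fun t : ℝ => t ^ k := by fun_prop
  have hm : Measurable fun t : ℝ => ENNReal.ofReal (t ^ 2) * ‖powerPullback k Φ t‖ₑ ^ 2 :=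
    (by fun_prop : Measurable fun t : ℝ => ENNReal.ofReal (t ^ 2)).mul (hG.enorm.pow_const 2)
  rw [← ENNReal.pow_le_pow_left_iff two_ne_zero, enorm_sq_borelCalculus_smul_one_sub hA k hΦ hb,
    enorm_sq_borelCalculus (hA.pow k) hG (norm_powerPullback_le hk hΦ0 hb),
    lintegral_spectralMeasure_apply (hA.pow k) x (hG.enorm.pow_const 2), spectralMeasure_pow hA,
    lintegral_map hm hpow]
  refine lintegral_mono fun t => ?_
  -- For t > 0 the integrands agree. For t ≤ 0, k(1 - t) ≥ 1 lies outside the support of Φ; an even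
  -- power folds negative spectrum onto positive, which can only enlarge the right-hand side.
  rcases lt_or_ge 0 t with ht | ht
  · have htk : 0 < t ^ k := by positivity
    have e : (ENNReal.ofReal ((t ^ k) ^ 2)) = ‖((t ^ k : ℝ) : ℂ)‖ₑ ^ 2 := by
      rw [← ofReal_norm, Complex.norm_real, Real.norm_of_nonneg htk.le, ENNReal.ofReal_pow htk.le]
    have hne : ((t ^ k : ℝ) : ℂ) ≠ 0 := by exact_mod_cast htk.ne'
    rw [e, ← mul_pow, ← enorm_mul, powerPullback_pow hk ht, mul_div_cancel₀ _ hne]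
  · have : Φ (k * (1 - t)) = 0 := hΦ0 _ fun h => by nlinarith [h.2]
    rw [this, enorm_zero]
    simp

variable {X : Type*} [MetricSpace X] [MeasurableSpace X] {μ : Measure X} {n : ℝ}

/-- The restriction estimate for multipliers of `k (1 - A)`. -/
theorem RestrictionBound.eLpNorm_borelCalculus_le (hμ : IsDoubling μ n)
    {A : Lp ℂ 2 μ →L[ℂ] Lp ℂ 2 μ} (hA : IsSelfAdjoint A) {k : ℕ} (hk : 1 ≤ k) {p : ℝ} {q : ℝ≥0∞}
    (hq : q ≠ 0) {R₁ R₂ : ℝ} {C : ℝ≥0} (hST : RestrictionBound μ p q √k R₁ R₂ (A ^ k) C)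
    {Φ : ℝ → ℂ} (hΦ : Measurable Φ) (hb : ∃ B : ℝ, ∀ t, ‖Φ t‖ ≤ B)
    (hΦ0 : ∀ t, t ∉ Icc (1 / 8 : ℝ) (5 / 8) → Φ t = 0) {K : Set ℝ} (hK : IsClosed K)
    (hKR : K ⊆ Ioo R₁ R₂) (hΦK : ∀ t, Φ t ≠ 0 → (1 - t / k) ^ k ∈ K) (f : Lp ℂ 2 μ)
    (hf : MemLp (fun y => ((vol μ y √k ^ (-(1 / p - 1 / 2)) : ℝ) : ℂ) * f y)
      (ENNReal.ofReal p) μ) :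
    eLpNorm (borelCalculus ((k : ℂ) • (1 - A) : Lp ℂ 2 μ →L[ℂ] Lp ℂ 2 μ) Φ f) 2 μ
      ≤ C * (3 * multiplierNorm q Φ) *
        eLpNorm (fun y => ((vol μ y √k ^ (-(1 / p - 1 / 2)) : ℝ) : ℂ) * f y)
          (ENNReal.ofReal p) μ := by
  have hk0 : (0 : ℝ) < √k := Real.sqrt_pos.2 (by exact_mod_cast hk)
  have hsupp : tsupport (powerPullback k Φ) ⊆ Ioo R₁ R₂ := by
    refine (closure_minimal (fun u hu => ?_) hK).trans hKR
    obtain ⟨t, -, ht, rfl, -⟩ := exists_of_powerPullback_ne_zero hk hΦ0 hu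
    exact hΦK t ht
  -- The restriction bound is applied to V_τ^(-σ) f, whose product with V_τ^σ is f.
  have h1 := hST (powerPullback k Φ) (measurable_powerPullback hΦ) (norm_powerPullback_le hk hΦ0 hb)
    hsupp _ hf f (Filter.Eventually.of_forall fun y => by
      have hv := hμ.vol_pos y hk0
      rw [← mul_assoc, ← Complex.ofReal_mul, ← Real.rpow_add hv]
      simp)
  refine le_trans ?_ (h1.trans (mul_le_mul_left (mul_le_mul_right
    (multiplierNorm_powerPullback_le hk hΦ0 hq) _) _))
  have h2 := enorm_borelCalculus_le_powerPullback hA hk hΦ hb hΦ0 f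
  rwa [Lp.enorm_def, Lp.enorm_def] at h2

end Restriction

/-! ### Uniform operator bounds and comparison of weights. -/

section WeightedEstimates

variable {X : Type*} [MeasurableSpace X] {μ : Measure X}

lemma mulOp_pow_ae (b : X → ℂ) (hb : Measurable b) (C : ℝ) (hC : ∀ x, ‖b x‖ ≤ C) (i : ℕ)
    (f : Lp ℂ 2 μ) : ∀ᵐ x ∂μ, (mulOp μ b hb C hC ^ i) f x = b x ^ i * f x := by
  induction i with
  | zero => exact Filter.Eventually.of_forall fun x => by simp
  | succ i ih =>
    rw [pow_succ', mul_apply_eq_comp]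
    filter_upwards [mulOp_ae b hb C hC ((mulOp μ b hb C hC ^ i) f), ih] with x h1 h2
    rw [h1, h2, pow_succ', mul_assoc]

lemma norm_le_of_forall_eLpNorm_le {T : Lp ℂ 2 μ →L[ℂ] Lp ℂ 2 μ} {C : ℝ} (hC : 0 ≤ C)
    (h : ∀ f : Lp ℂ 2 μ, eLpNorm (T f) 2 μ ≤ ENNReal.ofReal C * eLpNorm f 2 μ) : ‖T‖ ≤ C := by
  refine T.opNorm_le_bound hC fun f => ?_
  rw [Lp.norm_def, Lp.norm_def]
  refine (ENNReal.toReal_mono (ENNReal.mul_ne_top ENNReal.ofReal_ne_top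
    (Lp.eLpNorm_ne_top f)) (h f)).trans_eq ?_
  rw [ENNReal.toReal_mul, ENNReal.toReal_ofReal hC]

/-- Self-adjointness gives ‖A^(2^m)‖ = ‖A‖^(2^m), which would be unbounded if ‖A‖ > 1. -/
lemma norm_le_one_of_powers {A : Lp ℂ 2 μ →L[ℂ] Lp ℂ 2 μ} (hA : IsSelfAdjoint A) {C : ℝ}
    (h : ∀ k : ℕ, 1 ≤ k → ‖A ^ k‖ ≤ C) : ‖A‖ ≤ 1 := by
  by_contra hcon
  obtain ⟨m, hm⟩ := pow_unbounded_of_one_lt C (not_le.1 hcon)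
  have h1 : ‖A ^ 2 ^ m‖ = ‖A‖ ^ 2 ^ m := by
    exact IsSelfAdjoint.norm_pow_two_pow (E := Lp ℂ 2 μ →L[ℂ] Lp ℂ 2 μ) hA m
  have h2 := h (2 ^ m) Nat.one_le_two_pow
  rw [h1] at h2
  have h3 : ‖A‖ ^ m ≤ ‖A‖ ^ 2 ^ m :=
    pow_le_pow_right₀ (not_le.1 hcon).le (Nat.lt_two_pow_self).le
  linarith

variable [MetricSpace X] {n : ℝ}

/-- Operator norm bounds for the iterated commutators of the powers of `A`. -/
lemma IsDoubling.exists_norm_adPow_le [TopologicalSpace.SeparableSpace X] [BorelSpace X]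
    (hμ : IsDoubling μ n) (hn : 0 < n) {N : ℝ} (hN : n < N) {M : ℕ} (hM : M ≤ 2 * (N - n))
    {C : ℝ} (hC : 0 ≤ C) :
    ∃ C' : ℝ≥0, ∀ k l : ℕ, 1 ≤ k → k ≤ l → l ≤ 2 * k → ∀ T : Lp ℂ 2 μ →L[ℂ] Lp ℂ 2 μ,
      HasPolynomialKernelBound μ T l N C →
      ∀ (b : X → ℂ) (hb : Measurable b) (B : ℝ) (hB : ∀ x, ‖b x‖ ≤ B),
        (∀ x y, ‖b x - b y‖ ≤ dist x y) → ∀ i ≤ M, ‖adPow (mulOp μ b hb B hB) i T‖ ≤ C' * √k ^ i := by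
  -- At p = 2 the weight has exponent zero and disappears.
  obtain ⟨C', h⟩ := hμ.exists_adPow_bound hn hN hM one_le_two le_rfl hC
  refine ⟨C', fun k l hk hkl hlk T hT b hb B hB hlip i hi =>
    norm_le_of_forall_eLpNorm_le (by positivity) fun f => ?_⟩
  have h1 := h k l hk hkl hlk T hT b hb B hB hlip i hi f
  rw [ENNReal.ofReal_mul C'.coe_nonneg, ENNReal.ofReal_coe_nnreal]
  simpa using h1

/-- Comparison of the weight `V_τ^(-σ)` with `μ(B)^(-σ)` on a ball `B` of radius `r ≥ τ`. -/
lemma IsDoubling.exists_eLpNorm_weight_le [TopologicalSpace.SeparableSpace X] [BorelSpace X]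
    (hμ : IsDoubling μ n) (hn : 0 ≤ n) {σ : ℝ} (hσ : 0 ≤ σ) :
    ∃ C : ℝ≥0, ∀ (τ r : ℝ), 0 < τ → τ ≤ r → ∀ (z : X) (f : X → ℂ) (P : ℝ≥0∞),
      (∀ᵐ y ∂μ, y ∉ Metric.ball z r → f y = 0) → MemLp f P μ →
      MemLp (fun y => ((vol μ y τ ^ (-σ) : ℝ) : ℂ) * f y) P μ ∧
        eLpNorm (fun y => ((vol μ y τ ^ (-σ) : ℝ) : ℂ) * f y) P μ
          ≤ C * ENNReal.ofReal ((r / τ) ^ (n * σ)) * μ (Metric.ball z r) ^ (-σ) * eLpNorm f P μ := by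
  obtain ⟨C, hC1, hC⟩ := hμ.exists_vol_le
  have := hμ.sigmaFinite
  have hC0 : 0 < C := by linarith
  refine ⟨(C ^ σ * 2 ^ (n * σ)).toNNReal, fun τ r hτ hτr z f P hfz hf => ?_⟩
  have hr : 0 < r := hτ.trans_le hτr
  have hV : 0 < vol μ z r := hμ.vol_pos z hr
  set c : ℝ := C ^ σ * 2 ^ (n * σ) * (r / τ) ^ (n * σ) * vol μ z r ^ (-σ) with hc
  have hpt : ∀ᵐ y ∂μ, ‖((vol μ y τ ^ (-σ) : ℝ) : ℂ) * f y‖ ≤ c * ‖f y‖ := by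
    filter_upwards [hfz] with y hy
    by_cases hyb : y ∈ Metric.ball z r
    · rw [norm_mul, Complex.norm_real]
      have hVy : 0 < vol μ y τ := hμ.vol_pos y hτ
      rw [Real.norm_of_nonneg (by positivity)]
      gcongr
      have h1 := hC z y τ r hτ hτr
      have hd : dist z y ≤ r := by rw [dist_comm]; exact (Metric.mem_ball.1 hyb).le
      -- For y in B(z, r), r + d(z,y) ≤ 2r, whence the factor 2 next to r/τ.
      have h2 : vol μ z r ≤ (C * (2 * (r / τ)) ^ n) * vol μ y τ := by
        refine h1.trans ?_
        have hle : (r + dist z y) / τ ≤ 2 * (r / τ) := by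
          rw [← mul_div_assoc]
          gcongr
          linarith
        gcongr
      have h3 : vol μ z r ^ σ ≤ (C * (2 * (r / τ)) ^ n) ^ σ * vol μ y τ ^ σ := by
        rw [← Real.mul_rpow (by positivity) hVy.le]
        exact Real.rpow_le_rpow hV.le h2 hσ
      have e : (C * (2 * (r / τ)) ^ n) ^ σ = C ^ σ * 2 ^ (n * σ) * (r / τ) ^ (n * σ) := by
        rw [Real.mul_rpow hC0.le (by positivity), ← Real.rpow_mul (by positivity),
          Real.mul_rpow (by norm_num) (by positivity), mul_assoc]
      rw [hc, ← e, Real.rpow_neg hVy.le, Real.rpow_neg hV.le, ← div_eq_mul_inv, inv_eq_one_div,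
        div_le_div_iff₀ (by positivity) (by positivity), one_mul]
      exact h3
    · rw [hy hyb]; simp
  have hm : AEStronglyMeasurable (fun y => ((vol μ y τ ^ (-σ) : ℝ) : ℂ) * f y) μ :=
    (Complex.measurable_ofReal.comp ((measurable_vol τ).pow_const _)).aestronglyMeasurable.mul hf.1
  refine ⟨hf.of_le_mul hm hpt, (eLpNorm_le_mul_eLpNorm_of_ae_le_mul hpt P).trans_eq ?_⟩
  rw [hc, ENNReal.ofReal_mul (by positivity), ENNReal.ofReal_mul (by positivity),
    ← ENNReal.ofReal_rpow_of_pos hV, hμ.ofReal_vol z hr]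
  rfl

end WeightedEstimates

/-! ### Off-diagonal decay by commutators. -/

section OffDiagonal

variable {X : Type*} [MetricSpace X]

/-- The distance to the ball `B(z, r)` (up to a constant), truncated at height `R`. -/
noncomputable def truncDist (z : X) (r R : ℝ) (x : X) : ℝ := min (max (dist x z - r) 0) R

lemma truncDist_nonneg (z : X) (r : ℝ) {R : ℝ} (hR : 0 ≤ R) (x : X) : 0 ≤ truncDist z r R x :=
  le_min (le_max_right _ _) hR

lemma abs_truncDist_sub_le (z : X) (r R : ℝ) (x y : X) :
    |truncDist z r R x - truncDist z r R y| ≤ dist x y := by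
  unfold truncDist
  refine (abs_min_sub_min_le_max _ _ _ _).trans ?_
  rw [sub_self R, abs_zero]
  refine max_le ((abs_max_sub_max_le_max _ _ _ _).trans ?_) dist_nonneg
  rw [sub_self (0 : ℝ), abs_zero]
  refine max_le ?_ dist_nonneg
  rw [sub_sub_sub_cancel_right]
  exact abs_dist_sub_le x y z

lemma truncDist_eq_zero {z x : X} {r R : ℝ} (hR : 0 ≤ R) (hx : x ∈ Metric.ball z r) :
    truncDist z r R x = 0 := by
  unfold truncDist
  rw [max_eq_right (by linarith [Metric.mem_ball.1 hx]), min_eq_left hR]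

lemma tendsto_truncDist (z x : X) (r : ℝ) :
    ∀ᶠ m : ℕ in Filter.atTop, truncDist z r m x = max (dist x z - r) 0 := by
  obtain ⟨m0, hm0⟩ := exists_nat_ge (max (dist x z - r) 0)
  filter_upwards [Filter.eventually_ge_atTop m0] with m hm
  exact min_eq_left (hm0.trans (by exact_mod_cast hm))

variable [MeasurableSpace X] {μ : Measure X} {n : ℝ}

lemma measurable_truncDist [BorelSpace X] (z : X) (r R : ℝ) :
    Measurable (truncDist z r R) := by
  have : Continuous (truncDist z r R) := by unfold truncDist; fun_prop
  exact this.measurable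

/-- Polynomial off-diagonal decay of `v(T) T` for smooth `v`, relative to a ball carrying `f`. -/
theorem IsDoubling.exists_offDiagonal_bound [TopologicalSpace.SeparableSpace X] [BorelSpace X]
    (hμ : IsDoubling μ n) (hn : 0 < n) {N : ℝ} (hN : n < N) {M : ℕ} (hM : M ≤ 2 * (N - n)) {p : ℝ}
    (hp1 : 1 ≤ p) (hp2 : p ≤ 2) {C : ℝ} (hC : 0 ≤ C) :
    ∃ C' : ℝ≥0, ∀ k l : ℕ, 1 ≤ k → k ≤ l → l ≤ 2 * k → ∀ T : Lp ℂ 2 μ →L[ℂ] Lp ℂ 2 μ,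
      IsSelfAdjoint T → ‖T‖ ≤ 1 → HasPolynomialKernelBound μ T l N C →
      ∀ v : ℝ → ℂ, ContDiff ℝ (M + 1 : ℕ) v → (∀ x, x ∉ Icc (0 : ℝ) 1 → v x = 0) →
      ∀ L Q : ℝ, 1 ≤ L → 0 < Q → (∀ x, ‖v x‖ ≤ Q) →
      (∀ x, ‖iteratedDeriv (M + 1) v x‖ ≤ Q * L ^ (M + 1)) →
      ∀ S : Lp ℂ 2 μ →L[ℂ] Lp ℂ 2 μ, (∀ x, ⟪x, S x⟫ = ∫ t, v t * t ∂(spectralMeasure T x)) →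
      ∀ (z : X) (r : ℝ) (f : Lp ℂ 2 μ), (∀ᵐ y ∂μ, y ∉ Metric.ball z r → f y = 0) →
        eLpNorm (fun y => ((vol μ y √k ^ (-(1 / p - 1 / 2)) : ℝ) : ℂ) * f y)
          (ENNReal.ofReal p) μ ≠ ⊤ →
        eLpNorm (fun x => max (dist x z - r) 0 ^ M * ‖S f x‖) 2 μ
          ≤ C' * ENNReal.ofReal (Q * √L * (L * √k) ^ M) *
            eLpNorm (fun y => ((vol μ y √k ^ (-(1 / p - 1 / 2)) : ℝ) : ℂ) * f y)
              (ENNReal.ofReal p) μ := by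
  obtain ⟨C1, hC1⟩ := hμ.exists_norm_adPow_le hn hN hM hC
  obtain ⟨C2, hC2⟩ := hμ.exists_adPow_bound hn hN hM hp1 hp2 hC
  set κ : ℝ := M.factorial * Real.exp (Real.exp 1 * C1) with hκ
  have hκ0 : 0 ≤ κ := by positivity
  refine ⟨((2 * 4 ^ (M + 1) + 2) * C2 * (κ + 1) ^ M).toNNReal, ?_⟩
  intro k l hk hkl hlk T hT hT1 hTK v hv hv0 L Q hL hQ hvQ hvM S hS z r f hfz hfin
  set N1 := eLpNorm (fun y => ((vol μ y √k ^ (-(1 / p - 1 / 2)) : ℝ) : ℂ) * f y)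
    (ENNReal.ofReal p) μ with hN1
  obtain ⟨R, hR, hRad⟩ := exists_operator_adPow_le hT hT1 hv hv0 hL hQ hvQ hvM
  have hSR : S = R * T := ext_inner_self fun x => by rw [hS, hR]
  set τ := √(k : ℝ) with hτ
  have hτ0 : 0 ≤ τ := Real.sqrt_nonneg _
  set Z := ((2 * 4 ^ (M + 1) + 2) * C2 * (κ + 1) ^ M) * (Q * √L * (L * τ) ^ M) * N1.toReal with hZ
  have hZ0 : 0 ≤ Z := by positivity
  have hgoal : ((((2 * 4 ^ (M + 1) + 2) * C2 * (κ + 1) ^ M).toNNReal : ℝ≥0) : ℝ≥0∞)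
      * ENNReal.ofReal (Q * √L * (L * τ) ^ M) * N1 = ENNReal.ofReal Z := by
    generalize Q * √L * (L * τ) ^ M = W at hZ
    rw [hZ, ENNReal.ofReal_mul' ENNReal.toReal_nonneg, ENNReal.ofReal_mul (by positivity),
      ENNReal.ofReal_toReal hfin]
    rfl
  rw [hgoal]
  -- Truncation at height m makes E a bounded operator; the bound does not depend on m, and Fatou's
  -- lemma removes the truncation.
  have key : ∀ m : ℕ, eLpNorm (fun x => truncDist z r m x ^ M * ‖S f x‖) 2 μ ≤ ENNReal.ofReal Z := by
    intro m
    set b : X → ℂ := fun x => (truncDist z r m x : ℂ) with hb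
    have hbm : Measurable b := Complex.measurable_ofReal.comp (measurable_truncDist z r m)
    have hm0 : (0 : ℝ) ≤ m := m.cast_nonneg
    have hbn : ∀ x, ‖b x‖ = truncDist z r m x := fun x => by
      rw [hb, Complex.norm_real, Real.norm_of_nonneg (truncDist_nonneg z r hm0 x)]
    have hbB : ∀ x, ‖b x‖ ≤ m := fun x => by rw [hbn]; exact min_le_right _ _
    have hlip : ∀ x y, ‖b x - b y‖ ≤ dist x y := fun x y => by
      simp only [hb]
      rw [← Complex.ofReal_sub, Complex.norm_real]
      exact abs_truncDist_sub_le z r m x y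
    set E := mulOp μ b hbm m hbB with hE
    have hEf : E f = 0 := by
      rw [Lp.ext_iff]
      filter_upwards [mulOp_ae b hbm m hbB f, hfz, Lp.coeFn_zero ℂ 2 μ] with x h1 h2 h3
      rw [h1, h3, Pi.zero_apply]
      by_cases hx : x ∈ Metric.ball z r
      · simp [hb, truncDist_eq_zero hm0 hx]
      · rw [h2 hx, mul_zero]
    have hadT := hC1 k l hk hkl hlk T hTK b hbm m hbB hlip
    have hadR := hRad E τ C1 hτ0 C1.coe_nonneg hadT
    have hadTf : ∀ j ≤ M, ‖adPow E j T f‖ ≤ (C2 * N1.toReal) * τ ^ j := fun j hj => by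
      have h := hC2 k l hk hkl hlk T hTK b hbm m hbB hlip j hj f
      rw [Lp.norm_def]
      refine (ENNReal.toReal_mono (ENNReal.mul_ne_top (ENNReal.mul_ne_top ENNReal.coe_ne_top
        ENNReal.ofReal_ne_top) hfin) h).trans_eq ?_
      rw [ENNReal.toReal_mul, ENNReal.toReal_mul, ENNReal.toReal_ofReal (by positivity),
        ENNReal.coe_toReal]
      ring
    -- Leibniz estimate for R T with operator norms on R but the seminorm a ↦ ‖a f‖ on T, so that
    -- the gain from L^p to L² is kept in the rightmost factor.
    have hprod := adPow_mul_le E (ν := fun a : Lp ℂ 2 μ →L[ℂ] Lp ℂ 2 μ => ‖a f‖)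
      (fun a b => by rw [add_apply]; exact norm_add_le _ _)
      (fun a b => by rw [mul_apply_eq_comp]; exact a.le_opNorm _) (fun a => norm_nonneg _)
      M hadR hadTf
    rw [← hSR, adPow_apply_of_apply_eq_zero hEf] at hprod
    have hle : ‖(E ^ M) (S f)‖ ≤ Z := by
      refine hprod.trans ?_
      have e : L * (M.factorial * Real.exp (Real.exp 1 * C1) * τ) + τ ≤ (κ + 1) * (L * τ) := by
        rw [← hκ]
        nlinarith
      calc _ ≤ ((2 * 4 ^ (M + 1) + 2) * (Q * √L)) * (C2 * N1.toReal) * ((κ + 1) * (L * τ)) ^ M := by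
            gcongr
        _ = Z := by rw [hZ, mul_pow]; ring
    rw [Lp.norm_def] at hle
    refine (le_of_eq ?_).trans (ENNReal.le_ofReal_iff_toReal_le (Lp.eLpNorm_ne_top _) hZ0 |>.2 hle)
    refine eLpNorm_congr_norm_ae ?_
    filter_upwards [mulOp_pow_ae b hbm m hbB M (S f)] with x hx
    rw [hx, norm_mul, norm_mul, norm_pow, norm_pow, hbn, norm_norm,
      Real.norm_of_nonneg (truncDist_nonneg z r hm0 x)]
  have hlim := Lp.eLpNorm_lim_le_liminf_eLpNorm (p := 2) (μ := μ)
    (f := fun (m : ℕ) x => truncDist z r m x ^ M * ‖S f x‖) (fun m =>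
      ((measurable_truncDist z r m).pow_const M).aestronglyMeasurable.mul (Lp.aestronglyMeasurable _).norm)
    (fun x => max (dist x z - r) 0 ^ M * ‖S f x‖) (Filter.Eventually.of_forall fun x => by
      refine tendsto_const_nhds.congr' ?_
      filter_upwards [tendsto_truncDist z x r] with m hm
      rw [hm])
  exact hlim.trans (Filter.liminf_le_of_le (by isBoundedDefault) fun b hb => by
    obtain ⟨m, hm⟩ := hb.exists
    exact hm.trans (key m))

end OffDiagonal

open scoped ContDiff

/-! ### The bound for one frequency-localized piece. -/

section SmoothPiece

variable {X : Type*} [MetricSpace X]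

lemma one_add_dist_div_pow_le (x z : X) {r : ℝ} (hr : 0 < r) (M : ℕ) :
    (1 + dist x z / r) ^ M ≤ 2 ^ M * (2 ^ M + (r ^ M)⁻¹ * max (dist x z - r) 0 ^ M) := by
  set η := max (dist x z - r) 0 with hη
  have hη0 : 0 ≤ η := le_max_right _ _
  have h1 : 1 + dist x z / r ≤ 2 + η / r := by
    have : dist x z ≤ η + r := by linarith [le_max_left (dist x z - r) 0]
    calc 1 + dist x z / r ≤ 1 + (η + r) / r := by gcongr
      _ = 2 + η / r := by field_simp; ring
  have hη1 : 0 ≤ η / r := by positivity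
  calc (1 + dist x z / r) ^ M ≤ (2 * max 2 (η / r)) ^ M := by
        gcongr
        exact h1.trans (by linarith [le_max_left 2 (η / r), le_max_right 2 (η / r)])
    _ = 2 ^ M * max 2 (η / r) ^ M := mul_pow _ _ _
    _ ≤ 2 ^ M * (2 ^ M + (r ^ M)⁻¹ * η ^ M) := by
        gcongr
        have e : (η / r) ^ M = (r ^ M)⁻¹ * η ^ M := by rw [div_pow]; ring
        have e0 : 0 ≤ (η / r) ^ M := by positivity
        have e2 : (0 : ℝ) ≤ 2 ^ M := by positivity
        rw [← e]
        rcases max_cases 2 (η / r) with ⟨h, -⟩ | ⟨h, -⟩ <;> rw [h] <;> linarith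

variable [MeasurableSpace X] {μ : Measure X} {n : ℝ}

/-- A weighted `L²` bound from a bound near the ball `B(z, r)` and one away from it. -/
lemma lintegral_weight_sq_le [BorelSpace X] {g : X → ℂ} (hg : AEStronglyMeasurable g μ) (z : X)
    {r : ℝ} (hr : 0 < r) (M : ℕ) {a b : ℝ≥0∞} (ha : eLpNorm g 2 μ ≤ a)
    (hb : eLpNorm (fun x => max (dist x z - r) 0 ^ M * ‖g x‖) 2 μ ≤ ENNReal.ofReal (r ^ M) * b) :
    ∫⁻ x, (ENNReal.ofReal ((1 + dist x z / r) ^ M) * ‖g x‖ₑ) ^ (2 : ℝ) ∂μ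
      ≤ (ENNReal.ofReal (2 ^ M) * (ENNReal.ofReal (2 ^ M) * a + b)) ^ (2 : ℝ) := by
  have hr' : (0 : ℝ) < r ^ M := by positivity
  have h1 : ∫⁻ x, (ENNReal.ofReal ((1 + dist x z / r) ^ M) * ‖g x‖ₑ) ^ (2 : ℝ) ∂μ
      = eLpNorm (fun x => (1 + dist x z / r) ^ M * ‖g x‖) 2 μ ^ (2 : ℝ) := by
    have := eLpNorm_nnreal_pow_eq_lintegral (μ := μ) (p := 2)
      (f := fun x => (1 + dist x z / r) ^ M * ‖g x‖) two_ne_zero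
    simp only [NNReal.coe_ofNat, ENNReal.coe_ofNat] at this
    rw [this]
    refine lintegral_congr fun x => ?_
    rw [enorm_mul, enorm_norm, Real.enorm_of_nonneg (by positivity)]
  rw [h1]
  gcongr
  set η : X → ℝ := fun x => max (dist x z - r) 0 ^ M with hη
  have hηm : Measurable η := by
    have : Continuous η := by rw [hη]; fun_prop
    exact this.measurable
  have hηg : AEStronglyMeasurable (fun x => η x * ‖g x‖) μ :=
    hηm.aestronglyMeasurable.mul hg.norm
  calc eLpNorm (fun x => (1 + dist x z / r) ^ M * ‖g x‖) 2 μ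
      ≤ eLpNorm ((2 : ℝ) ^ M • ((2 : ℝ) ^ M • (fun x => ‖g x‖)
          + (r ^ M)⁻¹ • fun x => η x * ‖g x‖)) 2 μ := by
        refine eLpNorm_mono_real fun x => ?_
        rw [Real.norm_of_nonneg (by positivity)]
        simp only [Pi.smul_apply, Pi.add_apply, smul_eq_mul]
        have := one_add_dist_div_pow_le x z hr M
        calc _ ≤ (2 ^ M * (2 ^ M + (r ^ M)⁻¹ * η x)) * ‖g x‖ := by gcongr
          _ = _ := by ring
    _ ≤ ENNReal.ofReal (2 ^ M) * (ENNReal.ofReal (2 ^ M) * eLpNorm g 2 μ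
          + ENNReal.ofReal (r ^ M)⁻¹ * eLpNorm (fun x => η x * ‖g x‖) 2 μ) := by
        rw [eLpNorm_const_smul, Real.enorm_of_nonneg (by positivity)]
        gcongr
        refine (eLpNorm_add_le (hg.norm.const_smul _) (hηg.const_smul _) one_le_two).trans ?_
        rw [eLpNorm_const_smul, eLpNorm_const_smul, Real.enorm_of_nonneg (by positivity),
          Real.enorm_of_nonneg (by positivity), eLpNorm_norm]
    _ ≤ _ := by
        refine mul_le_mul_right (add_le_add (mul_le_mul_right ha _) ?_) _
        refine (mul_le_mul_right hb _).trans_eq ?_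
        rw [← mul_assoc, ← ENNReal.ofReal_mul (by positivity), inv_mul_cancel₀ hr'.ne',
          ENNReal.ofReal_one, one_mul]

/-- The `L^p` bound for one smooth frequency-localized piece of a spectral multiplier. -/
theorem IsDoubling.exists_smoothPiece_bound [TopologicalSpace.SeparableSpace X] [BorelSpace X]
    (hμ : IsDoubling μ n) (hn : 0 < n) {N : ℝ} (hN : n < N) {M : ℕ} (hM : M ≤ 2 * (N - n))
    (hnM : n < M) {p : ℝ} (hp1 : 1 ≤ p) (hp2 : p < 2) {q : ℝ≥0∞} (hq : q ≠ 0)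
    {A : Lp ℂ 2 μ →L[ℂ] Lp ℂ 2 μ} (hA : IsSelfAdjoint A) (hA1 : ‖A‖ ≤ 1) {C₁ : ℝ} (hC₁ : 0 ≤ C₁)
    (hker : ∀ k : ℕ, 1 ≤ k → HasPolynomialKernelBound μ (A ^ k) k N C₁) {R₁ R₂ : ℝ} {C₂ : ℝ≥0}
    (hST : ∀ k : ℕ, 1 ≤ k → RestrictionBound μ p q √k R₁ R₂ (A ^ k) C₂)
    {w ψ : ℝ → ℂ} (hw : ContDiff ℝ ∞ w) (hwc : HasCompactSupport w) (hψ : ContDiff ℝ ∞ ψ)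
    (hψ0 : ∀ t, t ∉ Icc (1 / 8 : ℝ) (5 / 8) → ψ t = 0) {K : Set ℝ} (hK : IsClosed K)
    (hKR : K ⊆ Ioo R₁ R₂) (hwK : ∀ x, w x ≠ 0 → x ∈ K) :
    ∃ C : ℝ≥0, ∀ k : ℕ, 1 ≤ k → ∀ f : ℝ → ℂ, ContDiff ℝ ∞ f → ∀ L P : ℝ, 1 ≤ L → 0 < P →
      multiplierNorm q (fun t => f t * (w ((1 - t / k) ^ k) * ψ t)) ≤ ENNReal.ofReal P →
      (∀ i ≤ M + 1, ∀ x, ‖iteratedDeriv i f x‖ ≤ P * √L * L ^ i) →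
      LpOperatorBound μ p (borelCalculus ((k : ℂ) • (1 - A) : Lp ℂ 2 μ →L[ℂ] Lp ℂ 2 μ)
        fun t => f t * (w ((1 - t / k) ^ k) * ψ t))
        (C * ENNReal.ofReal (P * (L ^ (1 + 1 / (M : ℝ))) ^ (n * (1 / p - 1 / 2)))) := by
  have hσ : 0 ≤ 1 / p - 1 / 2 := by
    rw [sub_nonneg]; exact one_div_le_one_div_of_le (by linarith) hp2.le
  obtain ⟨C3, hC3⟩ := hμ.exists_localization hn.le hp1 hp2 hnM
  obtain ⟨C4, hC4⟩ := hμ.exists_offDiagonal_bound hn hN hM hp1 hp2.le hC₁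
  obtain ⟨C5, hC5⟩ := hμ.exists_eLpNorm_weight_le hn.le hσ
  obtain ⟨C6, hC6, hprof⟩ := exists_smooth_profile hw hwc hψ hψ0 (M + 1)
  have hM0 : (0 : ℝ) < M := hn.trans hnM
  refine ⟨C3 * (2 ^ M * (2 ^ M * (C₂ * 3) + C4 * C6.toNNReal) * C5), ?_⟩
  intro k hk f hf L P hL hP hmult hfd
  have hk0 : (0 : ℝ) < k := by exact_mod_cast hk
  have hL0 : 0 < L := by linarith
  set Φ : ℝ → ℂ := fun t => f t * (w ((1 - t / k) ^ k) * ψ t) with hΦ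
  have hΦcont : Continuous Φ := by
    have := hf.continuous
    have := hw.continuous
    have := hψ.continuous
    rw [hΦ]; fun_prop
  have hΦ0 : ∀ t, t ∉ Icc (1 / 8 : ℝ) (5 / 8) → Φ t = 0 := fun t ht => by
    simp only [hΦ]; rw [hψ0 t ht, mul_zero, mul_zero]
  have hΦb : ∃ B : ℝ, ∀ t, ‖Φ t‖ ≤ B :=
    (HasCompactSupport.intro isCompact_Icc hΦ0).exists_bound_of_continuous hΦcont
  have hΦK : ∀ t, Φ t ≠ 0 → (1 - t / k) ^ k ∈ K := fun t ht =>
    hwK _ fun h => ht (by simp only [hΦ]; rw [h, zero_mul, mul_zero])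
  set S : Lp ℂ 2 μ →L[ℂ] Lp ℂ 2 μ := borelCalculus ((k : ℂ) • (1 - A)) Φ with hS
  -- An odd power preserves the sign of λ: the negative spectrum is sent to u ≤ 0, where v vanishes,
  -- and S = v(A^l) A^l holds as an identity. An even k would fold it onto u > 0.
  obtain ⟨l, hkl, hlk, hodd⟩ : ∃ l, k ≤ l ∧ l ≤ k + 1 ∧ Odd l := by
    rcases Nat.even_or_odd k with h | h
    · exact ⟨k + 1, k.le_succ, le_rfl, h.add_one⟩
    · exact ⟨k, le_rfl, k.le_succ, h⟩
  have hl1 : 1 ≤ l := hk.trans hkl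
  obtain ⟨v, hv, hv01, hvd, hvneg, hvpos⟩ := hprof k l hk hkl hlk f hf L (P * √L) hL
    (by positivity) hfd
  have hSl : ∀ x, ⟪x, S x⟫ = ∫ t, v t * t ∂(spectralMeasure (A ^ l) x) := fun x => by
    rw [hS, borelCalculus_smul_one_sub_inner hA k hΦcont.measurable hΦb, spectralMeasure_pow hA,
      integral_map (f := fun t => v t * (t : ℂ)) (by fun_prop)
        (hv.continuous.mul Complex.continuous_ofReal).aestronglyMeasurable]
    refine integral_congr_ae (Filter.Eventually.of_forall fun t => ?_)
    rcases lt_or_ge 0 t with ht | ht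
    · simp only [hΦ]
      rw [hvpos t ht]
      congr 4
      field_simp
      ring
    · simp only
      rw [hvneg _ (hodd.pow_nonpos ht), zero_mul]
      refine hΦ0 _ fun h => ?_
      have : (1 : ℝ) ≤ k := by exact_mod_cast hk
      nlinarith [h.2]
  have hA1l : ‖A ^ l‖ ≤ 1 := (norm_pow_le' A hl1).trans (pow_le_one₀ (norm_nonneg _) hA1)
  set τ := √(k : ℝ) with hτ
  have hτ0 : 0 < τ := Real.sqrt_pos.2 hk0
  -- The localization radius is r = τ Y. The exponent is chosen so that r^M = τ^M L^(M+1): the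
  -- surplus L is the product of two losses √L, one from the sup bound of f and one from the Fourier
  -- series.
  set Y := L ^ (1 + 1 / (M : ℝ)) with hY
  have hY1 : 1 ≤ Y := Real.one_le_rpow hL (by positivity)
  have hr0 : 0 < τ * Y := by positivity
  have hrM : (τ * Y) ^ M = τ ^ M * L ^ (M + 1) := by
    rw [mul_pow, hY, ← Real.rpow_natCast (L ^ _), ← Real.rpow_mul hL0.le, ← Real.rpow_natCast L]
    congr 2
    push_cast
    field_simp
  have hQ : C6 * (P * √L) * √L * (L * τ) ^ M = (τ * Y) ^ M * (C6 * P) := by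
    rw [hrM, mul_pow, pow_succ]
    linear_combination (C6 * P * L ^ M * τ ^ M) * Real.mul_self_sqrt hL0.le
  have hYY : τ * Y / τ = Y := by field_simp
  have hloc := hC3 (τ * Y) hr0 S ((2 ^ M * (2 ^ M * (C₂ * 3) + C4 * C6.toNNReal) * C5 : ℝ≥0)
    * ENNReal.ofReal (P * Y ^ (n * (1 / p - 1 / 2)))) ?_
  · rw [ENNReal.coe_mul, mul_assoc]
    exact hloc
  intro z g hgz hgp
  -- Passing from V_τ^(-σ) to μ(B)^(-σ) on a ball of radius r = τ Y costs Y^(nσ), the only loss at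
  -- this scale.
  obtain ⟨hg1, hg2⟩ := hC5 τ (τ * Y) hτ0 (le_mul_of_one_le_right hτ0.le hY1) z g _ hgz hgp
  set N1 := eLpNorm (fun y => ((vol μ y τ ^ (-(1 / p - 1 / 2)) : ℝ) : ℂ) * g y)
    (ENNReal.ofReal p) μ with hN1
  have hnear := (hST k hk).eLpNorm_borelCalculus_le hμ hA hk hq hΦcont.measurable hΦb hΦ0 hK hKR
    hΦK g hg1
  have hfar := hC4 k l hk hkl (by omega) (A ^ l) (hA.pow l) hA1l (hker l hl1) v
    (hv.of_le (by exact_mod_cast le_top)) hv01 L (C6 * (P * √L)) hL (by positivity)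
    (fun x => by simpa using hvd 0 (Nat.zero_le _) x) (hvd (M + 1) le_rfl) S hSl z (τ * Y) g hgz
    hg1.eLpNorm_ne_top
  rw [← hτ, ← hN1, hQ, ENNReal.ofReal_mul (by positivity)] at hfar
  refine (lintegral_weight_sq_le (Lp.aestronglyMeasurable (S g)) z hr0 M
    (a := C₂ * (3 * ENNReal.ofReal P) * N1) (b := C4 * ENNReal.ofReal (C6 * P) * N1)
    (hnear.trans (mul_le_mul_left (mul_le_mul_right (mul_le_mul_right hmult _) _) _))
    (hfar.trans_eq (by ring))).trans ?_
  refine ENNReal.rpow_le_rpow ?_ (by norm_num)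
  rw [hYY] at hg2
  have h2 : ENNReal.ofReal (2 ^ M) = 2 ^ M := by
    rw [ENNReal.ofReal_pow (by norm_num)]; simp
  calc _ = (2 ^ M * (2 ^ M * (C₂ * 3) + C4 * (C6.toNNReal : ℝ≥0∞))) * ENNReal.ofReal P * N1 := by
        rw [h2, ENNReal.ofReal_mul hC6.le]
        simp only [ENNReal.ofReal]
        ring
    _ ≤ (2 ^ M * (2 ^ M * (C₂ * 3) + C4 * (C6.toNNReal : ℝ≥0∞))) * ENNReal.ofReal P * _ :=
        mul_le_mul_right hg2 _
    _ = _ := by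
        rw [ENNReal.ofReal_mul hP.le]
        push_cast
        ring

end SmoothPiece

/-! ### Cutoffs, finite sums and limits of operator bounds. -/

open scoped ContDiff

lemma exists_contDiff_bump (c : ℝ) {a b : ℝ} (ha : 0 < a) (hab : a < b) :
    ∃ w : ℝ → ℂ, ContDiff ℝ ∞ w ∧ HasCompactSupport w ∧ (∀ x, ‖w x‖ ≤ 1) ∧
      (∀ x, w x ≠ 0 → x ∈ Icc (c - b) (c + b)) ∧ ∀ x ∈ Icc (c - a) (c + a), w x = 1 := by
  let φ : ContDiffBump c := ⟨a, b, ha, hab⟩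
  refine ⟨fun x => (φ x : ℂ), Complex.ofRealCLM.contDiff.comp φ.contDiff,
    φ.hasCompactSupport.comp_left Complex.ofReal_zero, fun x => ?_, fun x hx => ?_, fun x hx => ?_⟩
  · rw [Complex.norm_real, Real.norm_of_nonneg φ.nonneg]
    exact φ.le_one
  · rw [← Real.closedBall_eq_Icc]
    by_contra h
    exact hx (by simp only [φ.zero_of_le_dist (not_le.1 h).le, Complex.ofReal_zero])
  · rw [← Real.closedBall_eq_Icc] at hx
    simp only [φ.one_of_mem_closedBall hx, Complex.ofReal_one]

lemma multiplierNorm_mul_le {q : ℝ≥0∞} (F : ℝ → ℂ) {χ : ℝ → ℂ} (hχ : ∀ t, ‖χ t‖ ≤ 1) :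
    multiplierNorm q (fun t => F t * χ t) ≤ multiplierNorm q F := by
  have h : ∀ t, ‖F t * χ t‖ ≤ ‖F t‖ := fun t => by
    rw [norm_mul]; exact mul_le_of_le_one_right (norm_nonneg _) (hχ t)
  unfold multiplierNorm
  split_ifs
  · exact iSup_mono fun t => enorm_le_iff_norm_le.2 (h t)
  · exact eLpNorm_mono h

lemma tsum_rpow_two_pow_ne_top {e : ℝ} (he : e < 0) :
    ∑' j : ℕ, ENNReal.ofReal (((2 : ℝ) ^ j) ^ e) ≠ ⊤ := by
  have h : ∀ j : ℕ, ENNReal.ofReal (((2 : ℝ) ^ j) ^ e) = ENNReal.ofReal ((2 : ℝ) ^ e) ^ j :=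
    fun j => by
      rw [← ENNReal.ofReal_pow (by positivity), ← Real.rpow_natCast 2 j, ← Real.rpow_natCast (2 ^ e),
        ← Real.rpow_mul (by norm_num), ← Real.rpow_mul (by norm_num), mul_comm]
  rw [tsum_congr h, ENNReal.tsum_geometric]
  refine ENNReal.inv_ne_top.2 (tsub_pos_of_lt ?_).ne'
  rw [ENNReal.ofReal_lt_one]
  exact Real.rpow_lt_one_of_one_lt_of_neg one_lt_two he

section FiniteSums

variable {H : Type*} [NormedAddCommGroup H] [InnerProductSpace ℂ H] [CompleteSpace H]

lemma exists_bound_finsetSum {Φ : ℕ → ℝ → ℂ} (hb : ∀ j, ∃ B : ℝ, ∀ t, ‖Φ j t‖ ≤ B) (J : ℕ) :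
    ∃ B : ℝ, ∀ t, ‖∑ j ∈ Finset.range J, Φ j t‖ ≤ B := by
  choose B hB using hb
  exact ⟨∑ j ∈ Finset.range J, B j, fun t => norm_sum_le_of_le _ fun j _ => hB j t⟩

lemma borelCalculus_finsetSum (A : H →L[ℂ] H) {Φ : ℕ → ℝ → ℂ} (hΦ : ∀ j, Measurable (Φ j))
    (hb : ∀ j, ∃ B : ℝ, ∀ t, ‖Φ j t‖ ≤ B) (J : ℕ) :
    borelCalculus A (fun t => ∑ j ∈ Finset.range J, Φ j t)
      = ∑ j ∈ Finset.range J, borelCalculus A (Φ j) := by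
  induction J with
  | zero =>
    simp only [Finset.range_zero, Finset.sum_empty]
    exact (eq_borelCalculus A measurable_const ⟨0, fun _ => by simp⟩ fun x => by simp).symm
  | succ J ih =>
    simp only [Finset.sum_range_succ]
    rw [borelCalculus_add A (Finset.measurable_fun_sum _ fun j _ => hΦ j)
      (exists_bound_finsetSum hb J) (hΦ J) (hb J), ih]

end FiniteSums

lemma exists_besselDerivative_of_sobolevNorm_lt {s : ℝ} {q : ℝ≥0∞} {F : ℝ → ℂ} {b : ℝ≥0∞}
    (h : sobolevNorm s q F < b) :
    ∃ G : ℝ → ℂ, MemLp G q ∧ IsBesselDerivative s F G ∧ eLpNorm G q < b := by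
  simp only [sobolevNorm, iInf_lt_iff] at h
  obtain ⟨G, -, hG, hFG, hlt⟩ := h
  exact ⟨G, hG, hFG, hlt⟩

section Multiplier

variable {X : Type*} [MeasurableSpace X] {μ : Measure X}

lemma LpOperatorBound.finsetSum {p : ℝ} (hp : 1 ≤ p) {S : ℕ → Lp ℂ 2 μ →L[ℂ] Lp ℂ 2 μ}
    {B : ℕ → ℝ≥0∞} (h : ∀ j, LpOperatorBound μ p (S j) (B j)) (J : ℕ) :
    LpOperatorBound μ p (∑ j ∈ Finset.range J, S j) (∑ j ∈ Finset.range J, B j) := by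
  intro f hf
  induction J with
  | zero =>
    simp only [Finset.range_zero, Finset.sum_empty, zero_apply, zero_mul, nonpos_iff_eq_zero]
    rw [eLpNorm_congr_ae (Lp.coeFn_zero ℂ 2 μ), eLpNorm_zero]
  | succ J ih =>
    rw [Finset.sum_range_succ, Finset.sum_range_succ, add_apply, add_mul,
      eLpNorm_congr_ae (Lp.coeFn_add _ _)]
    exact (eLpNorm_add_le (Lp.aestronglyMeasurable _) (Lp.aestronglyMeasurable _)
      (by rw [← ENNReal.ofReal_one]; exact ENNReal.ofReal_le_ofReal hp)).trans
      (add_le_add ih (h J f hf))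

/-- The Sobolev norm is an infimum and may be zero, whereas the estimates for the pieces start from
one function G and a positive bound g on its norm. The exact constant is reached by letting g
decrease to the infimum. -/
lemma LpOperatorBound.of_forall_gt {p : ℝ} {T : Lp ℂ 2 μ →L[ℂ] Lp ℂ 2 μ} {C : ℝ≥0} {I : ℝ≥0∞}
    (hI : I ≠ ⊤)
    (h : ∀ g : ℝ, 0 < g → I < ENNReal.ofReal g → LpOperatorBound μ p T (C * ENNReal.ofReal g)) :
    LpOperatorBound μ p T (C * I) := by
  intro f hf
  have hlim : Filter.Tendsto (fun m : ℕ => (C : ℝ≥0∞) * ENNReal.ofReal (I.toReal + 1 / (m + 1))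
      * eLpNorm f (ENNReal.ofReal p) μ) Filter.atTop
      (nhds (C * I * eLpNorm f (ENNReal.ofReal p) μ)) := by
    refine ENNReal.Tendsto.mul_const (ENNReal.Tendsto.const_mul ?_ (Or.inr ENNReal.coe_ne_top))
      (Or.inr hf.eLpNorm_ne_top)
    have h1 := (tendsto_one_div_add_atTop_nhds_zero_nat (𝕜 := ℝ)).const_add I.toReal
    rw [add_zero] at h1
    have h2 := ENNReal.tendsto_ofReal h1
    rwa [ENNReal.ofReal_toReal hI] at h2
  refine ge_of_tendsto' hlim fun m => ?_
  have hm : (0 : ℝ) < 1 / (m + 1) := by positivity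
  refine h _ (add_pos_of_nonneg_of_pos ENNReal.toReal_nonneg hm) ?_ f hf
  rw [ENNReal.lt_ofReal_iff_toReal_lt hI]
  exact lt_add_of_pos_right _ hm

end Multiplier

/-! ### Summation of the pieces and the multiplier theorem. -/

section Multiplier

variable {X : Type*} [MetricSpace X] [MeasurableSpace X] {μ : Measure X} {n : ℝ}

lemma HasPolynomialKernelBound.mono {T : Lp ℂ 2 μ →L[ℂ] Lp ℂ 2 μ} {k : ℕ} {N C C' : ℝ}
    (h : HasPolynomialKernelBound μ T k N C) (hC : C ≤ C') :
    HasPolynomialKernelBound μ T k N C' := by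
  obtain ⟨K, hK, hKb⟩ := h
  refine ⟨K, hK, fun x y => (hKb x y).trans ?_⟩
  have : 0 ≤ 1 / max (vol μ x √k) (vol μ y √k) :=
    one_div_nonneg.2 (le_max_of_le_left measureReal_nonneg)
  gcongr

/-- `L^p` bounds on the pieces of a spectral multiplier sum to an `L^p` bound of the multiplier:
the restriction bound makes the sum converge in `L²` on functions with bounded support. -/
theorem RestrictionBound.lpOperatorBound_of_tendsto [TopologicalSpace.SeparableSpace X]
    [BorelSpace X] (hμ : IsDoubling μ n) (hn : 0 ≤ n) {A : Lp ℂ 2 μ →L[ℂ] Lp ℂ 2 μ}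
    (hA : IsSelfAdjoint A) {k : ℕ} (hk : 1 ≤ k) {p : ℝ} (hp1 : 1 ≤ p) (hp2 : p < 2) {q : ℝ≥0∞}
    (hq : q ≠ 0) {R₁ R₂ : ℝ} {C : ℝ≥0} (hST : RestrictionBound μ p q √k R₁ R₂ (A ^ k) C)
    {F χ : ℝ → ℂ} (hF : Measurable F) (hFb : ∃ B : ℝ, ∀ t, ‖F t‖ ≤ B) (hχ : Continuous χ)
    (hχF : ∀ t, χ t * F t = F t) (hχ0 : ∀ t, t ∉ Icc (1 / 8 : ℝ) (5 / 8) → χ t = 0)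
    {K : Set ℝ} (hK : IsClosed K) (hKR : K ⊆ Ioo R₁ R₂)
    (hχK : ∀ t, χ t ≠ 0 → (1 - t / k) ^ k ∈ K) {Fd : ℕ → ℝ → ℂ} (hFd : ∀ j, Continuous (Fd j))
    (hlim : Filter.Tendsto (fun J : ℕ => multiplierNorm q fun t =>
      F t - χ t * ∑ j ∈ Finset.range (J + 1), Fd j t) Filter.atTop (nhds 0)) {B : ℕ → ℝ≥0∞}
    (hB : ∀ j, LpOperatorBound μ p
      (borelCalculus ((k : ℂ) • (1 - A) : Lp ℂ 2 μ →L[ℂ] Lp ℂ 2 μ) fun t => Fd j t * χ t) (B j)) :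
    LpOperatorBound μ p (borelCalculus ((k : ℂ) • (1 - A)) F) (∑' j, B j) := by
  have hσ : 0 ≤ 1 / p - 1 / 2 := by
    rw [sub_nonneg]; exact one_div_le_one_div_of_le (by linarith) hp2.le
  rcases isEmpty_or_nonempty X with hX | ⟨⟨z⟩⟩
  · intro f _
    rw [eLpNorm_congr_ae (g := 0) (Filter.Eventually.of_forall hX.elim), eLpNorm_zero]
    exact bot_le
  set W : Lp ℂ 2 μ →L[ℂ] Lp ℂ 2 μ := (k : ℂ) • (1 - A) with hW
  have hΦm : ∀ j, Measurable fun t => Fd j t * χ t := fun j => ((hFd j).mul hχ).measurable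
  have hΦb : ∀ j, ∃ B : ℝ, ∀ t, ‖Fd j t * χ t‖ ≤ B := fun j =>
    (HasCompactSupport.intro isCompact_Icc fun t ht => by
      rw [hχ0 t ht, mul_zero]).exists_bound_of_continuous ((hFd j).mul hχ)
  -- For f carried by a ball, V_τ^(-σ) f is in L^p, so the restriction bound controls the remainder
  -- in L² by its multiplier norm, which tends to zero.
  have hbdd : ∀ (r : ℝ) (f : Lp ℂ 2 μ), √(k : ℝ) ≤ r → (∀ᵐ y ∂μ, y ∉ Metric.ball z r → f y = 0) →
      MemLp f (ENNReal.ofReal p) μ → eLpNorm (borelCalculus W F f) (ENNReal.ofReal p) μ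
        ≤ (∑' j, B j) * eLpNorm f (ENNReal.ofReal p) μ := by
    intro r f hr hfz hf
    obtain ⟨C5, hC5⟩ := hμ.exists_eLpNorm_weight_le hn hσ
    have hw := (hC5 √k r (Real.sqrt_pos.2 (by exact_mod_cast hk)) hr z f _ hfz hf).1
    refine eLpNorm_le_of_tendsto_Lp
      (g := fun J => (∑ j ∈ Finset.range (J + 1), borelCalculus W fun t => Fd j t * χ t) f) ?_
      fun J => (LpOperatorBound.finsetSum hp1 hB (J + 1) f hf).trans
        (mul_le_mul_left (ENNReal.sum_le_tsum _) _)
    rw [tendsto_iff_edist_tendsto_0]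
    refine tendsto_of_tendsto_of_tendsto_of_le_of_le tendsto_const_nhds
      (h := fun J => C * (3 * multiplierNorm q fun t =>
        F t - χ t * ∑ j ∈ Finset.range (J + 1), Fd j t) *
        eLpNorm (fun y => ((vol μ y √k ^ (-(1 / p - 1 / 2)) : ℝ) : ℂ) * f y) (ENNReal.ofReal p) μ)
      ?_ (fun _ => bot_le) fun J => ?_
    · have := ENNReal.Tendsto.mul_const (b := eLpNorm (fun y =>
        ((vol μ y √k ^ (-(1 / p - 1 / 2)) : ℝ) : ℂ) * f y) (ENNReal.ofReal p) μ)
        (ENNReal.Tendsto.const_mul (a := (C : ℝ≥0∞)) (ENNReal.Tendsto.const_mul (a := 3) hlim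
          (Or.inr (by norm_num))) (Or.inr ENNReal.coe_ne_top)) (Or.inr hw.eLpNorm_ne_top)
      simpa using this
    · have hsum : (fun t => F t - χ t * ∑ j ∈ Finset.range (J + 1), Fd j t)
          = fun t => F t - ∑ j ∈ Finset.range (J + 1), Fd j t * χ t := by
        funext t
        rw [mul_comm, Finset.sum_mul]
      have hop : borelCalculus W (fun t => F t - χ t * ∑ j ∈ Finset.range (J + 1), Fd j t)
          = borelCalculus W F
            - ∑ j ∈ Finset.range (J + 1), borelCalculus W fun t => Fd j t * χ t := by
        rw [hsum, borelCalculus_sub W hF hFb (Finset.measurable_fun_sum _ fun j _ => hΦm j)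
          (exists_bound_finsetSum hΦb _), borelCalculus_finsetSum W hΦm hΦb]
      have hDb : ∃ B : ℝ, ∀ t, ‖F t - χ t * ∑ j ∈ Finset.range (J + 1), Fd j t‖ ≤ B := by
        obtain ⟨B1, h1⟩ := hFb
        obtain ⟨B2, h2⟩ := exists_bound_finsetSum hΦb (J + 1)
        refine ⟨B1 + B2, fun t => ?_⟩
        rw [congrFun hsum t]
        exact (norm_sub_le _ _).trans (add_le_add (h1 t) (h2 t))
      -- Both F and the subtracted sum carry the factor χ, so the remainder inherits the support
      -- conditions of χ.
      have hD0 : ∀ t, χ t = 0 → F t - χ t * ∑ j ∈ Finset.range (J + 1), Fd j t = 0 := fun t ht => by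
        rw [← hχF t, ht, zero_mul, zero_mul, sub_zero]
      have := hST.eLpNorm_borelCalculus_le hμ hA hk hq
        (Φ := fun t => F t - χ t * ∑ j ∈ Finset.range (J + 1), Fd j t)
        (hF.sub (hχ.measurable.mul (Finset.measurable_fun_sum _ fun j _ => (hFd j).measurable)))
        hDb (fun t ht => hD0 t (hχ0 t ht)) hK hKR (fun t ht => hχK t fun h => ht (hD0 t h)) f hw
      rw [← hW, hop, sub_apply] at this
      rw [edist_comm, edist_eq_enorm_sub, Lp.enorm_def]
      exact this
  intro f hf
  have hmeas : ∀ m : ℕ, MeasurableSet (Metric.ball z (√(k : ℝ) + m)) := fun _ =>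
    Metric.isOpen_ball.measurableSet
  refine eLpNorm_le_of_tendsto_Lp (((borelCalculus W F).continuous.tendsto f).comp
    (tendsto_restrictOp (s := fun m : ℕ => Metric.ball z (√(k : ℝ) + m)) hmeas
      (fun a b hab => Metric.ball_subset_ball (by gcongr)) ?_ f)) fun m => ?_
  · refine eq_univ_of_forall fun x => ?_
    obtain ⟨m, hm⟩ := exists_nat_gt (dist x z)
    exact mem_iUnion.2 ⟨m, Metric.mem_ball.2 (by linarith [Real.sqrt_nonneg (k : ℝ)])⟩
  · refine (hbdd (√k + m) _ (le_add_of_nonneg_right m.cast_nonneg) ?_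
      (memLp_restrictOp _ _ f hf)).trans (mul_le_mul_right ?_ _)
    · filter_upwards [restrictOp_ae _ (hmeas m) f] with y hy hyz
      rw [hy, indicator_of_notMem hyz]
    · rw [eLpNorm_restrictOp]
      exact eLpNorm_indicator_le _

/-- Sharp spectral multipliers from restriction estimates, with `M` controlling the off-diagonal
decay of the kernels: `s > (1 + 1/M) n (1/p - 1/2)` derivatives in `L^q` suffice. -/
theorem IsDoubling.exists_multiplier_bound [TopologicalSpace.SeparableSpace X] [BorelSpace X]
    (hμ : IsDoubling μ n) (hn : 0 < n) {N : ℝ} (hN : n < N) {M : ℕ} (hM : M ≤ 2 * (N - n))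
    (hnM : n < M) {p : ℝ} (hp1 : 1 ≤ p) (hp2 : p < 2) {q : ℝ≥0∞} (hq : 2 ≤ q)
    {A : Lp ℂ 2 μ →L[ℂ] Lp ℂ 2 μ} (hA : IsSelfAdjoint A) {C₁ : ℝ} (hC₁ : 0 ≤ C₁)
    (hker : ∀ k : ℕ, 1 ≤ k → HasPolynomialKernelBound μ (A ^ k) k N C₁) {R₁ R₂ : ℝ} {C₂ : ℝ≥0}
    (hR : R₁ < R₂) (hST : ∀ k : ℕ, 1 ≤ k → RestrictionBound μ p q √k R₁ R₂ (A ^ k) C₂)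
    {s : ℝ} (hs : (1 + 1 / (M : ℝ)) * (n * (1 / p - 1 / 2)) < s) {γ : ℝ} (hγ : 0 < γ) :
    ∃ C : ℝ≥0, ∀ k : ℕ, 1 ≤ k → ∀ F G : ℝ → ℂ, Measurable F → (∃ B : ℝ, ∀ t, ‖F t‖ ≤ B) →
      (q = ⊤ → Continuous F) → tsupport F ⊆ Icc (1 / 4) (1 / 2) →
      (∀ t ∈ tsupport F, (1 - t / k) ^ k ∈ Icc (R₁ + γ) (R₂ - γ)) → MemLp G q →
      IsBesselDerivative s F G → ∀ g : ℝ, 0 < g → eLpNorm G q ≤ ENNReal.ofReal g →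
      LpOperatorBound μ p (borelCalculus ((k : ℂ) • (1 - A)) F) (C * ENNReal.ofReal g) := by
  have hq0 : q ≠ 0 := (two_pos.trans_le hq).ne'
  -- The commutator of order zero is A^k itself, so the powers of A are uniformly bounded on L².
  have hA1 : ‖A‖ ≤ 1 := by
    obtain ⟨C0, h0⟩ := hμ.exists_norm_adPow_le hn hN hM hC₁
    refine norm_le_one_of_powers hA (C := C0) fun k hk => ?_
    simpa [adPow] using h0 k k hk le_rfl (by omega) _ (hker k hk) (fun _ => 0) measurable_const 0
      (by simp) (by simp) 0 (Nat.zero_le _)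
  -- The cutoff w is one on [R₁ + δ, R₂ - δ], which contains [R₁ + γ, R₂ - γ], and is supported in
  -- [R₁ + δ/2, R₂ - δ/2]. The second entry of the minimum keeps these intervals nondegenerate for
  -- large γ.
  set δ := min γ ((R₂ - R₁) / 4) with hδ
  have hδ0 : 0 < δ := lt_min hγ (by linarith)
  have hδγ : δ ≤ γ := min_le_left _ _
  have hδR : δ ≤ (R₂ - R₁) / 4 := min_le_right _ _
  obtain ⟨w, hw, hwc, hw1, hw0, hwγ⟩ := exists_contDiff_bump ((R₁ + R₂) / 2)
    (a := (R₂ - R₁) / 2 - δ) (b := (R₂ - R₁) / 2 - δ / 2) (by linarith) (by linarith)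
  obtain ⟨ψ, hψ, -, hψ1, hψ0, hψF⟩ := exists_contDiff_bump (3 / 8) (a := 1 / 8) (b := 1 / 4)
    (by norm_num) (by norm_num)
  have hψ0' : ∀ t, t ∉ Icc (1 / 8 : ℝ) (5 / 8) → ψ t = 0 := fun t ht => by
    by_contra h
    have := hψ0 t h
    norm_num at this
    exact ht this
  set K := Icc ((R₁ + R₂) / 2 - ((R₂ - R₁) / 2 - δ / 2)) ((R₁ + R₂) / 2 + ((R₂ - R₁) / 2 - δ / 2))
  have hKR : K ⊆ Ioo R₁ R₂ := fun x hx => ⟨by linarith [hx.1], by linarith [hx.2]⟩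
  obtain ⟨C3, hC3⟩ := hμ.exists_smoothPiece_bound hn hN hM hnM hp1 hp2 hq0 hA hA1 hC₁ hker hST hw
    hwc hψ hψ0' isClosed_Icc hKR hw0
  obtain ⟨C4, hC4⟩ := exists_littlewoodPaley hq s (M + 1)
  -- The net exponent of 2^j in the bound of the j-th piece; it is negative by the condition on s.
  set e := (1 + 1 / (M : ℝ)) * (n * (1 / p - 1 / 2)) - s with he
  have hsum := tsum_rpow_two_pow_ne_top (e := e) (by linarith)
  refine ⟨C3 * (C4 + 1) * (∑' j : ℕ, ENNReal.ofReal (((2 : ℝ) ^ j) ^ e)).toNNReal, ?_⟩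
  intro k hk F G hF hFb hFq hFsupp hFR hG hFG g hg hGg
  obtain ⟨Fd, hFd, hFdq, hFdi, hFdlim⟩ := hC4 F G hF hFb
    (isCompact_Icc.of_isClosed_subset (isClosed_tsupport F) hFsupp) hFq hG hFG
  set χ : ℝ → ℂ := fun t => w ((1 - t / k) ^ k) * ψ t with hχ
  have hχc : Continuous χ := by
    have := hw.continuous
    have := hψ.continuous
    rw [hχ]; fun_prop
  have hχ1 : ∀ t, ‖χ t‖ ≤ 1 := fun t => by
    simp only [hχ]
    rw [norm_mul]
    exact mul_le_one₀ (hw1 _) (norm_nonneg _) (hψ1 t)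
  have hχF : ∀ t, χ t * F t = F t := fun t => by
    by_cases ht : t ∈ tsupport F
    · have h1 := hFsupp ht
      have h2 := hFR t ht
      simp only [hχ]
      rw [hwγ _ ⟨by linarith [h2.1], by linarith [h2.2]⟩,
        hψF t ⟨by linarith [h1.1], by linarith [h1.2]⟩, one_mul, one_mul]
    · rw [image_eq_zero_of_notMem_tsupport ht, mul_zero]
  have hχ0 : ∀ t, t ∉ Icc (1 / 8 : ℝ) (5 / 8) → χ t = 0 := fun t ht => by
    simp only [hχ]; rw [hψ0' t ht, mul_zero]
  have hχK : ∀ t, χ t ≠ 0 → (1 - t / k) ^ k ∈ K := fun t ht =>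
    hw0 _ fun h => ht (by simp only [hχ]; rw [h, zero_mul])
  have hlim := hFdlim χ hχc hχ1 hχF fun t ht => hχ0 t fun h =>
    ht ⟨by linarith [h.1], by linarith [h.2]⟩
  have hpiece : ∀ j, LpOperatorBound μ p
      (borelCalculus ((k : ℂ) • (1 - A) : Lp ℂ 2 μ →L[ℂ] Lp ℂ 2 μ) fun t => Fd j t * χ t)
      (C3 * (C4 + 1) * ENNReal.ofReal g * ENNReal.ofReal (((2 : ℝ) ^ j) ^ e)) := by
    intro j
    set L : ℝ := 2 ^ j with hL
    have hL1 : 1 ≤ L := one_le_pow₀ one_le_two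
    have hL0 : 0 < L := by linarith
    -- One is added to C4 so that the bound for the piece is strictly positive, as the estimate of a
    -- single piece requires.
    have hC41 : ((C4 : ℝ≥0∞) + 1) = ENNReal.ofReal (C4 + 1) := by
      rw [ENNReal.ofReal_add C4.coe_nonneg zero_le_one, ENNReal.ofReal_coe_nnreal,
        ENNReal.ofReal_one]
    have hP : C4 * ENNReal.ofReal (L ^ (-s)) * eLpNorm G q
        ≤ ENNReal.ofReal ((C4 + 1) * L ^ (-s) * g) := by
      rw [ENNReal.ofReal_mul (by positivity), ENNReal.ofReal_mul (by positivity), ← hC41]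
      exact mul_le_mul' (mul_le_mul_left le_self_add _) hGg
    have hj := hC3 k hk (Fd j) (hFd j) L ((C4 + 1) * L ^ (-s) * g) hL1 (by positivity)
      ((multiplierNorm_mul_le _ hχ1).trans ((hFdq j).trans hP)) fun i hi x => by
        have h := (hFdi j i hi x).trans (mul_le_mul' (mul_le_mul_left (le_self_add (b := 1)) _) hGg)
        rw [hC41, ← ENNReal.ofReal_mul (by positivity), ← ENNReal.ofReal_mul (by positivity),
          ← ofReal_norm, ENNReal.ofReal_le_ofReal_iff (by positivity)] at h
        refine h.trans_eq ?_
        rw [show (i : ℝ) + 1 / 2 - s = -s + 1 / 2 + i by ring, Real.rpow_add hL0,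
          Real.rpow_add hL0, Real.rpow_natCast, ← Real.sqrt_eq_rpow]
        ring
    refine fun f hf => (hj f hf).trans_eq ?_
    congr 1
    rw [← Real.rpow_mul hL0.le, mul_assoc ((C4 : ℝ) + 1), mul_assoc ((C4 : ℝ) + 1),
      ENNReal.ofReal_mul (by positivity), ← hC41, mul_right_comm (L ^ (-s)) g, ← Real.rpow_add hL0,
      neg_add_eq_sub, ← he, ENNReal.ofReal_mul (by positivity)]
    ring
  have := (hST k hk).lpOperatorBound_of_tendsto hμ hn.le hA hk hp1 hp2 hq0 hF hFb hχc hχF hχ0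
    isClosed_Icc hKR hχK (fun j => (hFd j).continuous) hlim hpiece
  rw [ENNReal.tsum_mul_left] at this
  refine fun f hf => (this f hf).trans_eq ?_
  rw [ENNReal.coe_mul, ENNReal.coe_toNNReal hsum]
  push_cast
  ring

end Multiplier

end SpectralMultiplier

/-! ### The theorem, with commutators of order M = 2[N - n]. -/

theorem theorem5p3 {X : Type*} [MetricSpace X] [TopologicalSpace.SeparableSpace X]
    [MeasurableSpace X] [BorelSpace X] (μ : Measure X)
    (p : ℝ) (hp1 : 1 ≤ p) (hp2 : p < 2) (q : ℝ≥0∞) (hq : 2 ≤ q)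
    (n : ℝ) (hn : 0 < n) (hμ : SpectralMultiplier.IsDoubling μ n)
    (N : ℝ) (hN : n + ⌊n / 2⌋ + 1 < N)
    (A : Lp ℂ 2 μ →L[ℂ] Lp ℂ 2 μ) (hA : IsSelfAdjoint A)
    (hker : ∃ C : ℝ, ∀ k : ℕ, 1 ≤ k →
      SpectralMultiplier.HasPolynomialKernelBound μ (A ^ k) k N C)
    (R₁ R₂ : ℝ) (hR₁ : -1 ≤ R₁) (hR : R₁ < R₂) (hR₂ : R₂ ≤ 1)
    (hST : ∃ C : ℝ≥0, ∀ k : ℕ, 1 ≤ k →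
      SpectralMultiplier.RestrictionBound μ p q (Real.sqrt k) R₁ R₂ (A ^ k) C)
    (s : ℝ) (hs : n * (1 / p - 1 / 2) + n / (4 * ⌊N - n⌋) < s)
    (γ : ℝ) (hγ : 0 < γ) :
    ∃ C : ℝ≥0, ∀ k : ℕ, 1 ≤ k →
      ∀ F : ℝ → ℂ, Measurable F → (∃ M : ℝ, ∀ t, ‖F t‖ ≤ M) → (q = ⊤ → Continuous F) →
        tsupport F ⊆ Icc (1 / 4) (1 / 2) →
        (∀ t ∈ tsupport F, (1 - t / k) ^ k ∈ Icc (R₁ + γ) (R₂ - γ)) →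
        SpectralMultiplier.sobolevNorm s q F ≠ ⊤ →
        SpectralMultiplier.LpOperatorBound μ p
          (SpectralMultiplier.borelCalculus ((k : ℂ) • (1 - A)) F)
          (C * SpectralMultiplier.sobolevNorm s q F) := by
  obtain ⟨C₁, hC₁⟩ := hker
  obtain ⟨C₂, hC₂⟩ := hST
  -- Since N - n > [n/2] + 1 and the right-hand side is an integer, [N - n] ≥ [n/2] + 1 > n/2; hence
  -- M = 2[N - n] satisfies n < M ≤ 2(N - n).
  have hfl : ⌊n / 2⌋ + 1 ≤ ⌊N - n⌋ := Int.le_floor.2 (by push_cast; linarith)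
  have hn2 : n / 2 < ⌊N - n⌋ := (Int.lt_floor_add_one _).trans_le (by exact_mod_cast hfl)
  have hfl0 : (0 : ℝ) < ⌊N - n⌋ := by linarith
  have hfl0' : (0 : ℤ) ≤ ⌊N - n⌋ := by exact_mod_cast hfl0.le
  obtain ⟨a, ha⟩ := Int.eq_ofNat_of_zero_le hfl0'
  have ha' : (⌊N - n⌋ : ℝ) = a := by rw [ha]; rfl
  have hle := Int.floor_le (N - n)
  rw [ha'] at hle hn2 hfl0 hs
  obtain ⟨C, hC⟩ := hμ.exists_multiplier_bound hn (N := N) (by linarith) (M := 2 * a)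
    (by push_cast; linarith) (by push_cast; linarith) hp1 hp2 hq hA (C₁ := |C₁|) (abs_nonneg _)
    (fun k hk => (hC₁ k hk).mono (le_abs_self _)) hR hC₂ (s := s) (by
      refine lt_of_le_of_lt ?_ hs
      -- With σ ≤ 1/2, the loss nσ/M is at most n/(2M) = n/(4a), the excess allowed for s.
      have hp : 1 / p ≤ 1 := (div_le_one (by linarith)).2 hp1
      rw [one_add_mul]
      gcongr
      push_cast
      calc 1 / (2 * (a : ℝ)) * (n * (1 / p - 1 / 2)) ≤ 1 / (2 * (a : ℝ)) * (n * (1 - 1 / 2)) := by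
            gcongr
        _ = n / (4 * a) := by field_simp; norm_num) hγ
  refine ⟨C, fun k hk F hF hFb hFq hFsupp hFR hFs => ?_⟩
  refine SpectralMultiplier.LpOperatorBound.of_forall_gt hFs fun g hg hFg => ?_
  obtain ⟨G, hG, hFG, hGg⟩ := SpectralMultiplier.exists_besselDerivative_of_sobolevNorm_lt hFg
  exact hC k hk F G hF hFb hFq hFsupp hFR hG hFG g hg hGg.le
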